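/- Let $d\ge 1$, $\beta>0$ and $U=V+g$ with $V,g\in C^2(\mathbb R)$, where $U$ is symmetric, $U(-s)=U(s)$. Assume: (A0) there are $A>0$ and $B\in\mathbb R$ with $U(s)\ge A|s|^2-B$ for all $s\in\mathbb R$; (A1) $C_1\le V''\le C_2$ and $-C_0\le g''\le 0$ on $\mathbb R$, for constants $0<C_1<C_2<C_0$; (A2) for some real $q\ge 1$, $g''\in L^q(\mathbb R)$ and $$\beta^{\frac1{2q}}\|g''\|_{L^q(\mathbb R)}<\frac{C_1^{3/2}}{2\,C_2^{\frac{q+1}{2q}}(2d)^{\frac1{2q}}}.$$ For $N\ge 1$ let $\mathbb T_N^d=(\mathbb Z/N\mathbb Z)^d$, with unit vectors $e_1,\dots,e_d$, and for $u\in\mathbb R^d$ and $\phi:\mathbb T_N^d\to\mathbb R$ put $$H_{\mathbb T_N^d}(\phi,u)=\sum_{x\in\mathbb T_N^d}\sum_{i=1}^d U\big(\phi(x+e_i)-\phi(x)+u_i\big),\qquad Z_{\mathbb T_N^d}^\beta(u)=\int e^{-\beta H_{\mathbb T_N^d}(\phi,u)}\prod_{x\in\mathbb T_N^d\setminus\{0\}}d\phi(x)\quad(\phi(0)=0),$$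 $$\sigma_{\mathbb T_N^d}^\beta(u)=-\frac1{|\mathbb T_N^d|}\log\frac{Z_{\mathbb T_N^d}^\beta(u)}{Z_{\mathbb T_N^d}^\beta(0)}.$$ Then $Z_{\mathbb T_N^d}^\beta(u)<\infty$ for all $N\ge 1$ and $u\in\mathbb R^d$, the limit $\sigma^\beta(u)=\lim_{N\to\infty}\sigma_{\mathbb T_N^d}^\beta(u)$ exists in $\mathbb R$ for every $u\in\mathbb R^d$, and the surface tension $\sigma^\beta$ is strictly convex on $\mathbb R^d$. -/

import Mathlib

open MeasureTheory Filter Topology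

noncomputable section

/-- The lattice torus `(ℤ/Nℤ)^d`. -/
abbrev LatticeTorus (d N : ℕ) : Type := Fin d → ZMod N

/-- The discrete gradient `∇_i φ(x) = φ(x + e_i) - φ(x)` on the torus. -/
def torusGradient {d N : ℕ} (φ : LatticeTorus d N → ℝ) (i : Fin d) (x : LatticeTorus d N) : ℝ :=
  φ (x + Pi.single i 1) - φ x

/-- The Hamiltonian `H(φ, u) = ∑_x ∑_{i = 1}^d U(∇_i φ(x) + u_i)` on the torus. -/
def torusHamiltonian {d N : ℕ} [NeZero N] (U : ℝ → ℝ) (φ : LatticeTorus d N → ℝ)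
    (u : Fin d → ℝ) : ℝ :=
  ∑ x : LatticeTorus d N, ∑ i : Fin d, U (torusGradient φ i x + u i)

/-- The height field on the torus that vanishes at the origin and has the given heights at all
other sites. -/
def pinnedField {d N : ℕ} (ψ : {x : LatticeTorus d N // x ≠ 0} → ℝ) : LatticeTorus d N → ℝ :=
  fun x => if h : x = 0 then 0 else ψ ⟨x, h⟩

/-- The Boltzmann weight `exp(-β H(φ, u))`, as a function of the heights off the origin. -/
def boltzmannWeight (d N : ℕ) [NeZero N] (U : ℝ → ℝ) (β : ℝ) (u : Fin d → ℝ)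
    (ψ : {x : LatticeTorus d N // x ≠ 0} → ℝ) : ℝ :=
  Real.exp (-β * torusHamiltonian U (pinnedField ψ) u)

/-- The partition function `Z(u) = ∫ exp(-β H(φ, u)) ∏_{x ≠ 0} dφ(x)` of the torus. The weight
depends on `φ` through its gradients only, so the height at the origin is fixed to be `0`. -/
def torusPartitionFunction (d N : ℕ) [NeZero N] (U : ℝ → ℝ) (β : ℝ) (u : Fin d → ℝ) : ℝ :=
  ∫ ψ : {x : LatticeTorus d N // x ≠ 0} → ℝ, boltzmannWeight d N U β u ψ

/-- The surface tension `-(1/|T|) log (Z(u) / Z(0))` on the torus `T = (ℤ/Nℤ)^d`. -/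
def torusSurfaceTension (d N : ℕ) [NeZero N] (U : ℝ → ℝ) (β : ℝ) (u : Fin d → ℝ) : ℝ :=
  -(1 / (Fintype.card (LatticeTorus d N) : ℝ)) *
    Real.log (torusPartitionFunction d N U β u / torusPartitionFunction d N U β 0)

end

/-! The energy is not convex, so strict convexity must come from integrating out some of the
heights, with an estimate uniform in `N`. On a torus of even side every bond joins an even and an
odd site. Given the even heights the odd ones are independent, and integrating them out leaves a
product over odd sites of `sitePartition`, a function Z(t) of the shifted heights t of the 2d
neighbours.

Although U need not be convex, -log Z is, strictly so modulo constants. Integration by parts turns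
its second derivative in the direction v into (β²/2) Σ_{j,k} (v_j - v_k)² Cov(U'(t_j - s), U'(t_k -
s)), the covariance being that of the single-site Gibbs measure in s. It suffices that these
covariances are at least some κ > 0. A covariance is half the double integral of a product of two
increments of U'. Over a distance r the increments of V' lie between C₁r and C₂r, and those of g'
are at most ‖g''‖_q r^(1-1/q) by Hölder, so the product is at least k₁r² - k₀
(`exists_increment_lower_bound`). Hence the covariance is at least k₁ Var(s) - k₀/2
(`covariance_ge`), while the Cramér–Rao bound (`variance_ge`) and U'' ≤ C₂ give Var(s) ≥ 1/(2dβC₂).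
Assumption (A2) makes the resulting constant κ positive.

The Prékopa–Leindler inequality in the even heights then makes the partition function log-concave in
the tilt. The gain in the exponent is at least a multiple of |T| |u' - u|², whatever the heights
are, because the terms linear in the heights sum to zero over the torus. So log Z_N / N^d is
strictly concave in u, uniformly over even N (`pinnedIntegral_logConcave`).

The thermodynamic limit is an almost superadditivity argument. A large torus is tiled by copies of a
small one of side M, and near the block boundaries (the skeleton) the heights are kept close to one
fixed profile Φ. By translation invariance the mean energy at the skeleton is of the order of its
size, so Jensen's inequality and averaging yield a profile that costs only O(M^(d-1)) per block
(`exists_skeleton_heights`, `pow_lmarginal_skeleton_le`). As the limit exists along all N, it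
inherits the concavity estimate from the even ones. -/

/-! ### The Brunn–Minkowski and Prékopa–Leindler inequalities. -/

open scoped ENNReal Pointwise in
/-- One-dimensional Brunn–Minkowski inequality for a set containing a weighted Minkowski sum. -/
theorem volume_add_le_of_combination_mem {a b : ℝ} (ha : 0 < a) (hb : 0 < b) {A B C : Set ℝ}
    (hA : MeasurableSet A) (hB : MeasurableSet B) (hA0 : A.Nonempty) (hB0 : B.Nonempty)
    (h : ∀ x ∈ A, ∀ y ∈ B, a * x + b * y ∈ C) :
    ENNReal.ofReal a * volume A + ENNReal.ofReal b * volume B ≤ volume C := by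
  have key : ∀ K ⊆ A, IsCompact K → K.Nonempty → ∀ L ⊆ B, IsCompact L → L.Nonempty →
      ENNReal.ofReal a * volume K + ENNReal.ofReal b * volume L ≤ volume C := by
    intro K hKA hK hK0 L hLB hL hL0
    obtain ⟨k, hkK, hk⟩ := hK.exists_isGreatest hK0
    obtain ⟨l, hlL, hl⟩ := hL.exists_isLeast hL0
    -- With k the maximum of K and l the minimum of L, the translates bl + aK and ak + bL both lie
    -- in aK + bL and meet at most in the point ak + bl, so their measures add up.
    have h1 : volume ((b * l) +ᵥ (a • K)) = ENNReal.ofReal a * volume K := by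
      rw [measure_vadd, Measure.addHaar_smul]; simp [abs_of_pos ha]
    have h2 : volume ((a * k) +ᵥ (b • L)) = ENNReal.ofReal b * volume L := by
      rw [measure_vadd, Measure.addHaar_smul]; simp [abs_of_pos hb]
    have hm : MeasurableSet ((a * k) +ᵥ (b • L)) :=
      ((hL.smul b).vadd (a * k)).isClosed.measurableSet
    have hd : AEDisjoint volume ((b * l) +ᵥ (a • K)) ((a * k) +ᵥ (b • L)) := by
      refine measure_mono_null (t := {a * k + b * l}) ?_ (by simp)
      rintro z ⟨hz1, hz2⟩
      simp only [Set.mem_vadd_set, Set.mem_smul_set, smul_eq_mul, vadd_eq_add] at hz1 hz2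
      obtain ⟨_, ⟨x, hx, rfl⟩, rfl⟩ := hz1
      obtain ⟨_, ⟨y, hy, rfl⟩, hz⟩ := hz2
      have e1 := mul_le_mul_of_nonneg_left (hk hx) ha.le
      have e2 := mul_le_mul_of_nonneg_left (hl hy) hb.le
      simp only [Set.mem_singleton_iff]
      linarith
    rw [← h1, ← h2, ← measure_union₀ hm.nullMeasurableSet hd]
    refine measure_mono ?_
    rintro z (hz | hz)
    · simp only [Set.mem_vadd_set, Set.mem_smul_set, smul_eq_mul, vadd_eq_add] at hz
      obtain ⟨_, ⟨x, hx, rfl⟩, rfl⟩ := hz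
      rw [add_comm]; exact h x (hKA hx) l (hLB hlL)
    · simp only [Set.mem_vadd_set, Set.mem_smul_set, smul_eq_mul, vadd_eq_add] at hz
      obtain ⟨_, ⟨x, hx, rfl⟩, rfl⟩ := hz
      exact h k (hKA hkK) x (hLB hx)
  obtain ⟨x0, hx0⟩ := hA0
  obtain ⟨y0, hy0⟩ := hB0
  -- The suprema of inner regularity include empty compact sets. Inserting a point of A and a point
  -- of B reduces these to `key`.
  have key2 : ∀ K ⊆ A, IsCompact K → ∀ L ⊆ B, IsCompact L →
      ENNReal.ofReal a * volume K + ENNReal.ofReal b * volume L ≤ volume C := by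
    intro K hKA hK L hLB hL
    refine le_trans ?_ (key (insert x0 K) (Set.insert_subset hx0 hKA) (hK.insert x0) (by simp)
      (insert y0 L) (Set.insert_subset hy0 hLB) (hL.insert y0) (by simp))
    gcongr <;> simp
  rw [hA.measure_eq_iSup_isCompact, hB.measure_eq_iSup_isCompact]
  simp only [ENNReal.mul_iSup, iSup_and']
  exact ENNReal.biSup_add_biSup_le' (p := fun K => K ⊆ A ∧ IsCompact K)
    (q := fun L => L ⊆ B ∧ IsCompact L) ⟨∅, by simp⟩ ⟨∅, by simp⟩
    fun K hK L hL => key2 K hK.1 hK.2 L hL.1 hL.2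

theorem ENNReal.rpow_mul_rpow_le_add {a b : ℝ} (ha : 0 < a) (hb : 0 < b) (hab : a + b = 1)
    (x y : ENNReal) : x ^ a * y ^ b ≤ ENNReal.ofReal a * x + ENNReal.ofReal b * y := by
  have ha' : ENNReal.ofReal a ≠ 0 := by simpa using ha
  have hb' : ENNReal.ofReal b ≠ 0 := by simpa using hb
  by_cases hx : x = ⊤
  · subst hx; simp [ENNReal.mul_top ha']
  by_cases hy : y = ⊤
  · subst hy; simp [ENNReal.mul_top hb']
  lift x to NNReal using hx
  lift y to NNReal using hy
  rw [← ENNReal.coe_rpow_of_nonneg _ ha.le, ← ENNReal.coe_rpow_of_nonneg _ hb.le,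
    ENNReal.ofReal, ENNReal.ofReal]
  norm_cast
  have := NNReal.geom_mean_le_arith_mean2_weighted a.toNNReal b.toNNReal x y
    (by rw [← Real.toNNReal_add ha.le hb.le, hab]; simp)
  simpa [ha.le, hb.le] using this

/-- The Prékopa–Leindler inequality for functions whose suprema are both equal to one. -/
theorem lintegral_add_le_of_iSup_eq_one {a b : ℝ} (ha : 0 < a) (hb : 0 < b) (hab : a + b = 1)
    {f g h : ℝ → ℝ} (hf : Measurable f) (hg : Measurable g) (hh : Measurable h)
    (hf0 : ∀ x, 0 ≤ f x) (hg0 : ∀ x, 0 ≤ g x) (hh0 : ∀ x, 0 ≤ h x)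
    (hf1 : ∀ x, f x ≤ 1) (hg1 : ∀ x, g x ≤ 1)
    (hfs : ∀ t < 1, ∃ x, t < f x) (hgs : ∀ t < 1, ∃ x, t < g x)
    (hfgh : ∀ x y, f x ^ a * g y ^ b ≤ h (a * x + b * y)) :
    ENNReal.ofReal a * (∫⁻ x, ENNReal.ofReal (f x)) + ENNReal.ofReal b *
      (∫⁻ x, ENNReal.ofReal (g x)) ≤ ∫⁻ x, ENNReal.ofReal (h x) := by
  -- Layer cake formula. For 0 < t < 1 the sets {f > t} and {g > t} are nonempty and their weighted
  -- Minkowski sum lies in {h > t}; for t ≥ 1 both are empty.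
  rw [lintegral_eq_lintegral_meas_lt volume (Eventually.of_forall hf0) hf.aemeasurable,
    lintegral_eq_lintegral_meas_lt volume (Eventually.of_forall hg0) hg.aemeasurable,
    lintegral_eq_lintegral_meas_lt volume (Eventually.of_forall hh0) hh.aemeasurable,
    ← lintegral_const_mul' _ _ ENNReal.ofReal_ne_top,
    ← lintegral_const_mul' _ _ ENNReal.ofReal_ne_top, ← lintegral_add_left']
  swap
  · refine AEMeasurable.const_mul (Antitone.measurable ?_).aemeasurable _
    exact fun s t hst => measure_mono fun x (hx : t < f x) => lt_of_le_of_lt hst hx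
  refine setLIntegral_mono' measurableSet_Ioi fun t (ht : 0 < t) => ?_
  rcases lt_or_ge t 1 with h1 | h1
  · refine volume_add_le_of_combination_mem ha hb (measurableSet_lt measurable_const hf)
      (measurableSet_lt measurable_const hg) (hfs t h1) (hgs t h1) ?_
    intro x (hx : t < f x) y (hy : t < g y)
    refine lt_of_lt_of_le ?_ (hfgh x y)
    calc t = t ^ a * t ^ b := by rw [← Real.rpow_add ht, hab, Real.rpow_one]
      _ < f x ^ a * g y ^ b := by
        have e1 := Real.rpow_lt_rpow ht.le hx ha
        have e2 := Real.rpow_lt_rpow ht.le hy hb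
        exact mul_lt_mul'' e1 e2 (by positivity) (by positivity)
  · have e1 : {x | t < f x} = ∅ := by
      ext x; simpa using (hf1 x).trans h1
    have e2 : {x | t < g x} = ∅ := by
      ext x; simpa using (hg1 x).trans h1
    simp [e1, e2]

/-- Dividing f, g and h by F, G and F^a G^b, with F and G the suprema, reduces to suprema equal to
one. The additive inequality obtained there is stronger than the multiplicative one, by the weighted
AM–GM inequality. -/
theorem prekopa_leindler_of_bddAbove {a b : ℝ} (ha : 0 < a) (hb : 0 < b) (hab : a + b = 1)
    {f g h : ℝ → ℝ} (hf : Measurable f) (hg : Measurable g) (hh : Measurable h)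
    (hf0 : ∀ x, 0 ≤ f x) (hg0 : ∀ x, 0 ≤ g x) (hh0 : ∀ x, 0 ≤ h x)
    (hfb : BddAbove (Set.range f)) (hgb : BddAbove (Set.range g))
    (hfgh : ∀ x y, f x ^ a * g y ^ b ≤ h (a * x + b * y)) :
    (∫⁻ x, ENNReal.ofReal (f x)) ^ a * (∫⁻ x, ENNReal.ofReal (g x)) ^ b ≤
      ∫⁻ x, ENNReal.ofReal (h x) := by
  set F := ⨆ x, f x with hF
  set G := ⨆ x, g x with hG
  have hfF : ∀ x, f x ≤ F := fun x => le_ciSup hfb x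
  have hgG : ∀ x, g x ≤ G := fun x => le_ciSup hgb x
  rcases (hf0 0).trans (hfF 0) |>.eq_or_lt with hF0 | hF0
  · have : f = 0 := by ext x; exact le_antisymm ((hfF x).trans hF0.symm.le) (hf0 x)
    simp [this, ha]
  rcases (hg0 0).trans (hgG 0) |>.eq_or_lt with hG0 | hG0
  · have : g = 0 := by ext x; exact le_antisymm ((hgG x).trans hG0.symm.le) (hg0 x)
    simp [this, hb]
  set K := F ^ a * G ^ b with hK
  have hK0 : 0 < K := by positivity
  have key := lintegral_add_le_of_iSup_eq_one ha hb hab (f := fun x => f x / F)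
    (g := fun x => g x / G) (h := fun x => h x / K) (hf.div_const _) (hg.div_const _)
    (hh.div_const _) (fun x => div_nonneg (hf0 x) hF0.le) (fun x => div_nonneg (hg0 x) hG0.le)
    (fun x => div_nonneg (hh0 x) hK0.le) (fun x => (div_le_one hF0).2 (hfF x))
    (fun x => (div_le_one hG0).2 (hgG x)) ?_ ?_ ?_
  · have hscale : ∀ (k : ℝ → ℝ) (c : ℝ), 0 < c → ∫⁻ x, ENNReal.ofReal (k x) =
        ENNReal.ofReal c * ∫⁻ x, ENNReal.ofReal (k x / c) := by
      intro k c hc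
      rw [← lintegral_const_mul' _ _ ENNReal.ofReal_ne_top]
      congr 1 with x
      rw [← ENNReal.ofReal_mul hc.le, mul_div_cancel₀ _ hc.ne']
    rw [hscale f F hF0, hscale g G hG0, hscale h K hK0, ENNReal.mul_rpow_of_nonneg _ _ ha.le,
      ENNReal.mul_rpow_of_nonneg _ _ hb.le, ENNReal.ofReal_rpow_of_nonneg hF0.le ha.le,
      ENNReal.ofReal_rpow_of_nonneg hG0.le hb.le, mul_mul_mul_comm,
      ← ENNReal.ofReal_mul (by positivity)]
    gcongr
    exact (ENNReal.rpow_mul_rpow_le_add ha hb hab _ _).trans key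
  · intro t ht
    obtain ⟨x, hx⟩ := exists_lt_of_lt_ciSup (show t * F < ⨆ x, f x by nlinarith)
    exact ⟨x, (lt_div_iff₀ hF0).2 hx⟩
  · intro t ht
    obtain ⟨x, hx⟩ := exists_lt_of_lt_ciSup (show t * G < ⨆ x, g x by nlinarith)
    exact ⟨x, (lt_div_iff₀ hG0).2 hx⟩
  · intro x y
    rw [Real.div_rpow (hf0 x) hF0.le, Real.div_rpow (hg0 y) hG0.le, div_mul_div_comm]
    gcongr
    exact hfgh x y

/-- The one-dimensional Prékopa–Leindler inequality. -/
theorem prekopa_leindler {a b : ℝ} (ha : 0 < a) (hb : 0 < b) (hab : a + b = 1)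
    {f g h : ℝ → ENNReal} (hf : Measurable f) (hg : Measurable g) (hh : Measurable h)
    (hfgh : ∀ x y, f x ^ a * g y ^ b ≤ h (a * x + b * y)) :
    (∫⁻ x, f x) ^ a * (∫⁻ x, g x) ^ b ≤ ∫⁻ x, h x := by
  have htr : ∀ (k : ℝ → ENNReal) (n : NNReal) (x : ℝ), min (k x) n =
      ENNReal.ofReal (min (k x) n).toReal := fun k n x =>
    (ENNReal.ofReal_toReal (ne_top_of_le_ne_top ENNReal.coe_ne_top (min_le_right _ _))).symm
  -- Truncating all three functions at the same level n preserves the hypothesis, because n^a n^b =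
  -- n.
  have hbd : ∀ (n : NNReal), (∫⁻ x, min (f x) n) ^ a * (∫⁻ x, min (g x) n) ^ b ≤
      ∫⁻ x, h x := by
    intro n
    refine le_trans ?_ (lintegral_mono fun x => min_le_left (h x) n)
    rw [lintegral_congr (htr f n), lintegral_congr (htr g n), lintegral_congr (htr h n)]
    refine prekopa_leindler_of_bddAbove ha hb hab (hf.min measurable_const).ennreal_toReal
      (hg.min measurable_const).ennreal_toReal (hh.min measurable_const).ennreal_toReal
      (fun _ => ENNReal.toReal_nonneg) (fun _ => ENNReal.toReal_nonneg)
      (fun _ => ENNReal.toReal_nonneg) ?_ ?_ ?_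
    · refine ⟨n, ?_⟩
      rintro _ ⟨x, rfl⟩
      exact ENNReal.toReal_le_coe_of_le_coe (min_le_right _ _)
    · refine ⟨n, ?_⟩
      rintro _ ⟨x, rfl⟩
      exact ENNReal.toReal_le_coe_of_le_coe (min_le_right _ _)
    · intro x y
      rw [ENNReal.toReal_rpow, ENNReal.toReal_rpow, ← ENNReal.toReal_mul]
      refine ENNReal.toReal_mono (ne_top_of_le_ne_top ENNReal.coe_ne_top (min_le_right _ _)) ?_
      refine le_min (le_trans ?_ (hfgh x y)) ?_
      · gcongr <;> exact min_le_left _ _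
      · calc min (f x) n ^ a * min (g y) n ^ b ≤ (n : ENNReal) ^ a * (n : ENNReal) ^ b := by
              gcongr <;> exact min_le_right _ _
          _ = n := by
              rw [← ENNReal.rpow_add_of_nonneg _ _ ha.le hb.le, hab, ENNReal.rpow_one]
  have hlim : ∀ k : ℝ → ENNReal, Measurable k →
      Tendsto (fun n : ℕ => ∫⁻ x, min (k x) (n : NNReal)) atTop (𝓝 (∫⁻ x, k x)) := by
    intro k hk
    refine lintegral_tendsto_of_tendsto_of_monotone
      (fun n => (hk.min measurable_const).aemeasurable) (Eventually.of_forall fun x => ?_)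
      (Eventually.of_forall fun x => ?_)
    · intro m n hmn
      exact min_le_min le_rfl (by exact_mod_cast hmn)
    · have : Tendsto (fun n : ℕ => min (k x) ((n : NNReal) : ENNReal)) atTop
          (𝓝 (min (k x) ⊤)) := by
        refine tendsto_const_nhds.min ?_
        simpa using ENNReal.tendsto_nat_nhds_top
      simpa using this
  by_cases hf0 : ∫⁻ x, f x = 0
  · simp [hf0, ha]
  by_cases hg0 : ∫⁻ x, g x = 0
  · simp [hg0, hb]
  refine le_of_tendsto (ENNReal.Tendsto.mul ((hlim f hf).ennrpow_const a) (Or.inl ?_)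
    ((hlim g hg).ennrpow_const b) (Or.inl ?_)) (Eventually.of_forall fun n => hbd n)
  · simp [hf0, ha, ha.le]
  · simp [hg0, hb, hb.le]

/-- The Prékopa–Leindler inequality for iterated integrals over a finite set of coordinates. -/
theorem prekopa_leindler_lmarginal {ι : Type*} [DecidableEq ι] {a b : ℝ} (ha : 0 < a)
    (hb : 0 < b) (hab : a + b = 1) (s : Finset ι) {f g h : (ι → ℝ) → ENNReal}
    (hf : Measurable f) (hg : Measurable g) (hh : Measurable h)
    (hfgh : ∀ x y : ι → ℝ, f x ^ a * g y ^ b ≤ h (a • x + b • y)) (x y : ι → ℝ) :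
    lmarginal (fun _ => volume) s f x ^ a * lmarginal (fun _ => volume) s g y ^ b ≤
      lmarginal (fun _ => volume) s h (a • x + b • y) := by
  induction s using Finset.induction generalizing x y with
  | empty => simpa using hfgh x y
  | insert i s hi ih =>
    -- The marginals over `s` satisfy the pointwise hypothesis by induction, so the one-dimensional
    -- inequality applies to them in the coordinate `i`.
    rw [lmarginal_insert _ hf hi, lmarginal_insert _ hg hi, lmarginal_insert _ hh hi]
    refine prekopa_leindler ha hb hab ((hf.lmarginal _).comp (measurable_update x))
      ((hg.lmarginal _).comp (measurable_update y))
      ((hh.lmarginal _).comp (measurable_update _)) fun s t => ?_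
    refine (ih _ _).trans_eq ?_
    congr 1
    ext j
    by_cases hj : j = i
    · subst hj; simp
    · simp [hj]

/-! ### Single-site integrals: Gaussian domination and integration by parts. -/

/-- A `C²` potential with derivatives `U₁`, `U₂`, at least quadratic growth, and bounded second
derivative. -/
structure SmoothPotential (U U₁ U₂ : ℝ → ℝ) (A B K : ℝ) : Prop where
  hasDerivAt : ∀ s, HasDerivAt U (U₁ s) s
  hasDerivAt' : ∀ s, HasDerivAt U₁ (U₂ s) s
  continuous₂ : Continuous U₂
  abs_le : ∀ s, |U₂ s| ≤ K
  pos : 0 < A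
  lower : ∀ s, A * s ^ 2 - B ≤ U s

/-- The Boltzmann weight of a height `s` whose neighbours have heights `t j`. -/
noncomputable def siteWeight {ι : Type*} [Fintype ι] (U : ℝ → ℝ) (β : ℝ) (t : ι → ℝ) (s : ℝ) : ℝ :=
  Real.exp (-(β * ∑ j, U (t j - s)))

/-- The partition function of a single site whose neighbours have heights `t j`. -/
noncomputable def sitePartition {ι : Type*} [Fintype ι] (U : ℝ → ℝ) (β : ℝ) (t : ι → ℝ) : ℝ :=
  ∫ s, siteWeight U β t s

theorem integrable_one_add_sq_mul_exp {c : ℝ} (hc : 0 < c) :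
    Integrable fun s : ℝ => (1 + s ^ 2) * Real.exp (-c * s ^ 2) := by
  have h1 := integrable_exp_neg_mul_sq hc
  have h2 := integrable_rpow_mul_exp_neg_mul_sq hc (s := 2) (by norm_num)
  simp only [Real.rpow_two] at h2
  refine (h1.add h2).congr (Eventually.of_forall fun s => ?_)
  simp only [Pi.add_apply]; ring

theorem abs_mul_le_quadratic {C D x y s : ℝ} (hx : |x| ≤ C * (1 + |s|))
    (hy : |y| ≤ D * (1 + |s|)) : |x * y| ≤ 2 * (C * D) * (1 + s ^ 2) := by
  have hs := abs_nonneg s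
  have hC : 0 ≤ C := by by_contra h; nlinarith [abs_nonneg x]
  have hD : 0 ≤ D := by by_contra h; nlinarith [abs_nonneg y]
  rw [abs_mul]
  calc |x| * |y| ≤ (C * (1 + |s|)) * (D * (1 + |s|)) := by gcongr
    _ = (C * D) * (1 + |s|) ^ 2 := by ring
    _ ≤ (C * D) * (2 * (1 + s ^ 2)) := by
        gcongr
        rw [← sq_abs s]; nlinarith [sq_nonneg (1 - |s|)]
    _ = _ := by ring

theorem abs_le_quadratic {C x s : ℝ} (hx : |x| ≤ C * (1 + |s|)) : |x| ≤ 2 * C * (1 + s ^ 2) := by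
  have := abs_mul_le_quadratic (y := 1) (D := 1) hx (by simp)
  simpa using this

namespace SmoothPotential

variable {U U₁ U₂ : ℝ → ℝ} {A B K : ℝ}

theorem continuous₁ (h : SmoothPotential U U₁ U₂ A B K) : Continuous U₁ :=
  continuous_iff_continuousAt.2 fun s => (h.hasDerivAt' s).continuousAt

theorem continuous (h : SmoothPotential U U₁ U₂ A B K) : Continuous U :=
  continuous_iff_continuousAt.2 fun s => (h.hasDerivAt s).continuousAt

theorem bound_nonneg (h : SmoothPotential U U₁ U₂ A B K) : 0 ≤ K :=
  (abs_nonneg _).trans (h.abs_le 0)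

theorem abs_deriv_le (h : SmoothPotential U U₁ U₂ A B K) (x : ℝ) : |U₁ x| ≤ |U₁ 0| + K * |x| := by
  have := (convex_univ (𝕜 := ℝ) (E := ℝ)).norm_image_sub_le_of_norm_hasDerivWithin_le (f := U₁)
    (f' := U₂) (fun x _ => (h.hasDerivAt' x).hasDerivWithinAt) (fun x _ => h.abs_le x)
    (Set.mem_univ 0) (Set.mem_univ x)
  simp only [Real.norm_eq_abs, sub_zero] at this
  calc |U₁ x| = |U₁ 0 + (U₁ x - U₁ 0)| := by ring_nf
    _ ≤ _ := (abs_add_le _ _).trans (by linarith)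

theorem abs_deriv_sub_le (h : SmoothPotential U U₁ U₂ A B K) {x R : ℝ} (hx : |x| ≤ R) (s : ℝ) :
    |U₁ (x - s)| ≤ (|U₁ 0| + K * R + K) * (1 + |s|) := by
  have hK := h.bound_nonneg
  have hR : 0 ≤ R := (abs_nonneg _).trans hx
  have := h.abs_deriv_le (x - s)
  have h2 : |x - s| ≤ R + |s| := (abs_sub _ _).trans (by linarith)
  have h3 := abs_nonneg s
  have h4 := abs_nonneg (U₁ 0)
  have h5 := mul_le_mul_of_nonneg_left h2 hK
  have h6 : 0 ≤ (|U₁ 0| + K * R) * |s| := by positivity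
  nlinarith

variable {ι : Type*} [Fintype ι] [Nonempty ι] {β : ℝ}

/-- One Gaussian majorant serves all boundary conditions bounded by R, since (t - s)² ≥ s²/2 - t².
The uniformity is what permits differentiation under the integral. -/
theorem siteWeight_le (h : SmoothPotential U U₁ U₂ A B K) (hβ : 0 < β) (R : ℝ) :
    ∃ C c : ℝ, 0 < c ∧ 0 ≤ C ∧ ∀ (t : ι → ℝ), (∀ j, |t j| ≤ R) → ∀ s,
      siteWeight U β t s ≤ C * Real.exp (-c * s ^ 2) := by
  have hn : 0 < (Fintype.card ι : ℝ) := by exact_mod_cast Fintype.card_pos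
  have hA := h.pos
  refine ⟨Real.exp (β * Fintype.card ι * (A * R ^ 2 + B)), β * Fintype.card ι * (A / 2),
    by positivity, (Real.exp_pos _).le, fun t ht s => ?_⟩
  rw [siteWeight, ← Real.exp_add, Real.exp_le_exp]
  have : ∀ j, A * (s ^ 2 / 2 - R ^ 2) - B ≤ U (t j - s) := by
    intro j
    refine le_trans ?_ (h.lower _)
    have h1 : (t j) ^ 2 ≤ R ^ 2 := sq_le_sq' (_root_.abs_le.1 (ht j)).1 (_root_.abs_le.1 (ht j)).2
    have : s ^ 2 / 2 - R ^ 2 ≤ (t j - s) ^ 2 := by nlinarith [sq_nonneg (2 * t j - s)]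
    nlinarith
  have h2 := Finset.sum_le_sum fun j (_ : j ∈ Finset.univ) => this j
  rw [Finset.sum_const, Finset.card_univ, nsmul_eq_mul] at h2
  have h3 := mul_le_mul_of_nonneg_left h2 hβ.le
  linarith

omit [Nonempty ι] in
theorem continuous_siteWeight (h : SmoothPotential U U₁ U₂ A B K) (t : ι → ℝ) :
    Continuous (siteWeight U β t) := by
  have := h.continuous
  unfold siteWeight; fun_prop

theorem integrable_mul_siteWeight (h : SmoothPotential U U₁ U₂ A B K) (hβ : 0 < β) (t : ι → ℝ)
    {f : ℝ → ℝ} (hf : Continuous f) {D : ℝ} (hfD : ∀ s, |f s| ≤ D * (1 + s ^ 2)) :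
    Integrable fun s => f s * siteWeight U β t s := by
  obtain ⟨C, c, hc, hC, hb⟩ := h.siteWeight_le (ι := ι) hβ (∑ j, |t j|)
  refine ((integrable_one_add_sq_mul_exp hc).const_mul (D * C)).mono'
    (hf.mul (h.continuous_siteWeight t)).aestronglyMeasurable (Eventually.of_forall fun s => ?_)
  have h1 := hb t (fun j => Finset.single_le_sum (f := fun j => |t j|) (fun _ _ => abs_nonneg _)
    (Finset.mem_univ j)) s
  have h0 : 0 < siteWeight U β t s := Real.exp_pos _
  rw [norm_mul, Real.norm_eq_abs, Real.norm_eq_abs, abs_of_pos h0]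
  calc |f s| * siteWeight U β t s ≤ (D * (1 + s ^ 2)) * (C * Real.exp (-c * s ^ 2)) := by
        gcongr
        · exact (abs_nonneg _).trans (hfD s)
        · exact hfD s
    _ = _ := by ring

theorem integrable_siteWeight (h : SmoothPotential U U₁ U₂ A B K) (hβ : 0 < β) (t : ι → ℝ) :
    Integrable (siteWeight U β t) := by
  simpa using h.integrable_mul_siteWeight hβ t (f := fun _ => 1) continuous_const (D := 1)
    (fun s => by simpa using sq_nonneg s)

theorem sitePartition_pos (h : SmoothPotential U U₁ U₂ A B K) (hβ : 0 < β) (t : ι → ℝ) :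
    0 < sitePartition U β t := by
  have h0 : ∀ s, 0 ≤ siteWeight U β t s := fun s => (Real.exp_pos _).le
  unfold sitePartition
  rw [integral_pos_iff_support_of_nonneg h0 (h.integrable_siteWeight hβ t)]
  have : Function.support (siteWeight U β t) = Set.univ :=
    Set.eq_univ_of_forall fun s => (Real.exp_pos _).ne'
  simp [this]

omit [Nonempty ι] in
theorem hasDerivAt_siteWeight (h : SmoothPotential U U₁ U₂ A B K) (t : ι → ℝ) (s : ℝ) :
    HasDerivAt (siteWeight U β t) ((β * ∑ j, U₁ (t j - s)) * siteWeight U β t s) s := by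
  have h1 : ∀ j, HasDerivAt (fun s => U (t j - s)) (-U₁ (t j - s)) s := fun j => by
    simpa [Function.comp_def] using
      (h.hasDerivAt (t j - s)).comp s ((hasDerivAt_id s).const_sub (t j))
  have h2 : HasDerivAt (fun s => -(β * ∑ j, U (t j - s))) (-(β * ∑ j, -U₁ (t j - s))) s :=
    ((HasDerivAt.fun_sum fun j (_ : j ∈ Finset.univ) => h1 j).const_mul β).neg
  refine h2.exp.congr_deriv ?_
  rw [Finset.sum_neg_distrib, siteWeight]; ring

omit [Nonempty ι] in
theorem hasDerivAt_siteWeight_line (h : SmoothPotential U U₁ U₂ A B K) (t v : ι → ℝ) (s τ : ℝ) :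
    HasDerivAt (fun τ => siteWeight U β (t + τ • v) s)
      (-(β * ∑ j, v j * U₁ ((t + τ • v) j - s)) * siteWeight U β (t + τ • v) s) τ := by
  have h1 : ∀ j, HasDerivAt (fun τ : ℝ => U ((t + τ • v) j - s))
      (v j * U₁ ((t + τ • v) j - s)) τ := fun j => by
    have e : HasDerivAt (fun τ : ℝ => (t + τ • v) j - s) (v j) τ := by
      simpa using (((hasDerivAt_id τ).mul_const (v j)).const_add (t j)).sub_const s
    have := (h.hasDerivAt ((t + τ • v) j - s)).comp τ e
    rwa [mul_comm] at this
  have h2 : HasDerivAt (fun τ : ℝ => -(β * ∑ j, U ((t + τ • v) j - s)))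
      (-(β * ∑ j, v j * U₁ ((t + τ • v) j - s))) τ :=
    ((HasDerivAt.fun_sum fun j (_ : j ∈ Finset.univ) => h1 j).const_mul β).neg
  refine h2.exp.congr_deriv ?_
  rw [siteWeight]; ring

/-- The `s`-derivative of the weight times a function of linear growth integrates to zero. -/
theorem integral_by_parts (h : SmoothPotential U U₁ U₂ A B K) (hβ : 0 < β) (t : ι → ℝ)
    {f f' : ℝ → ℝ} (hf : ∀ s, HasDerivAt f (f' s) s) (hf' : Continuous f') {D D' : ℝ}
    (hD : ∀ s, |f s| ≤ D * (1 + |s|)) (hD' : ∀ s, |f' s| ≤ D') :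
    ∫ s, f' s * siteWeight U β t s =
      -∫ s, (f s * (β * ∑ j, U₁ (t j - s))) * siteWeight U β t s := by
  have hfc : Continuous f := continuous_iff_continuousAt.2 fun s => (hf s).continuousAt
  have hU := h.continuous₁
  have hD'0 : 0 ≤ D' := (abs_nonneg _).trans (hD' 0)
  have i1 := h.integrable_mul_siteWeight hβ t hf' (D := D') fun s =>
    (hD' s).trans (le_mul_of_one_le_right hD'0 (by nlinarith [sq_nonneg s]))
  obtain ⟨D₁, hD₁⟩ : ∃ D₁, ∀ s, |β * ∑ j, U₁ (t j - s)| ≤ D₁ * (1 + |s|) := by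
    refine ⟨β * ∑ j, (|U₁ 0| + K * |t j| + K), fun s => ?_⟩
    rw [abs_mul, abs_of_pos hβ, mul_assoc, Finset.sum_mul]
    gcongr
    exact (Finset.abs_sum_le_sum_abs _ _).trans
      (Finset.sum_le_sum fun j _ => h.abs_deriv_sub_le le_rfl s)
  have i2 := h.integrable_mul_siteWeight hβ t (f := fun s => f s * (β * ∑ j, U₁ (t j - s)))
    (by fun_prop) fun s => abs_mul_le_quadratic (hD s) (hD₁ s)
  have i3 := h.integrable_mul_siteWeight hβ t hfc fun s => abs_le_quadratic (hD s)
  have := integral_eq_zero_of_hasDerivAt_of_integrable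
    (fun s => (hf s).mul (h.hasDerivAt_siteWeight (β := β) t s))
    ((i1.add i2).congr (Eventually.of_forall fun s => by simp only [Pi.add_apply]; ring)) i3
  rw [eq_neg_iff_add_eq_zero, ← integral_add i1 i2, ← this]
  congr 1 with s
  ring

end SmoothPotential

/-! ### Variance of a single height and covariances of the forces on it. -/

theorem integral_linear_combination₄ {α : Type*} [MeasurableSpace α] {μ : Measure α}
    {f₁ f₂ f₃ f₄ : α → ℝ} (h₁ : Integrable f₁ μ) (h₂ : Integrable f₂ μ) (h₃ : Integrable f₃ μ)
    (h₄ : Integrable f₄ μ) (c₁ c₂ c₃ c₄ : ℝ) :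
    Integrable (fun s => c₁ * f₁ s + c₂ * f₂ s + c₃ * f₃ s + c₄ * f₄ s) μ ∧
    ∫ s, (c₁ * f₁ s + c₂ * f₂ s + c₃ * f₃ s + c₄ * f₄ s) ∂μ =
      c₁ * ∫ s, f₁ s ∂μ + c₂ * ∫ s, f₂ s ∂μ + c₃ * ∫ s, f₃ s ∂μ + c₄ * ∫ s, f₄ s ∂μ := by
  have i2 : Integrable (fun s => c₁ * f₁ s + c₂ * f₂ s) μ := (h₁.const_mul c₁).add (h₂.const_mul c₂)
  have i3 : Integrable (fun s => c₁ * f₁ s + c₂ * f₂ s + c₃ * f₃ s) μ := i2.add (h₃.const_mul c₃)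
  refine ⟨i3.add (h₄.const_mul c₄), ?_⟩
  rw [integral_add i3 (h₄.const_mul c₄), integral_add i2 (h₃.const_mul c₃),
    integral_add (h₁.const_mul c₁) (h₂.const_mul c₂)]
  simp only [integral_const_mul]

theorem integral_linear_combination₆ {α : Type*} [MeasurableSpace α] {μ : Measure α}
    {f₁ f₂ f₃ f₄ f₅ f₆ : α → ℝ} (h₁ : Integrable f₁ μ) (h₂ : Integrable f₂ μ)
    (h₃ : Integrable f₃ μ) (h₄ : Integrable f₄ μ) (h₅ : Integrable f₅ μ) (h₆ : Integrable f₆ μ)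
    (c₁ c₂ c₃ c₄ c₅ c₆ : ℝ) :
    ∫ s, (c₁ * f₁ s + c₂ * f₂ s + c₃ * f₃ s + c₄ * f₄ s + c₅ * f₅ s + c₆ * f₆ s) ∂μ =
      c₁ * ∫ s, f₁ s ∂μ + c₂ * ∫ s, f₂ s ∂μ + c₃ * ∫ s, f₃ s ∂μ + c₄ * ∫ s, f₄ s ∂μ +
        c₅ * ∫ s, f₅ s ∂μ + c₆ * ∫ s, f₆ s ∂μ := by
  have h := integral_linear_combination₄ h₁ h₂ h₃ h₄ c₁ c₂ c₃ c₄
  have i5 : Integrable (fun s => c₁ * f₁ s + c₂ * f₂ s + c₃ * f₃ s + c₄ * f₄ s + c₅ * f₅ s) μ :=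
    h.1.add (h₅.const_mul c₅)
  rw [integral_add i5 (h₆.const_mul c₆), integral_add h.1 (h₅.const_mul c₅), h.2]
  simp only [integral_const_mul]

namespace SmoothPotential

variable {U U₁ U₂ : ℝ → ℝ} {A B K : ℝ} {ι : Type*} [Fintype ι] [Nonempty ι] {β : ℝ}

theorem integrable_deriv_mul (h : SmoothPotential U U₁ U₂ A B K) (hβ : 0 < β) (t : ι → ℝ)
    (j : ι) : Integrable fun s => U₁ (t j - s) * siteWeight U β t s := by
  have := h.continuous₁
  exact h.integrable_mul_siteWeight hβ t (by fun_prop)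
    fun s => abs_le_quadratic (h.abs_deriv_sub_le le_rfl s)

theorem integrable_deriv_mul_deriv (h : SmoothPotential U U₁ U₂ A B K) (hβ : 0 < β) (t : ι → ℝ)
    (j k : ι) :
    Integrable fun s => U₁ (t j - s) * U₁ (t k - s) * siteWeight U β t s := by
  have := h.continuous₁
  exact h.integrable_mul_siteWeight hβ t (by fun_prop)
    fun s => abs_mul_le_quadratic (h.abs_deriv_sub_le le_rfl s) (h.abs_deriv_sub_le le_rfl s)

theorem integrable_deriv₂_mul (h : SmoothPotential U U₁ U₂ A B K) (hβ : 0 < β) (t : ι → ℝ)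
    (j : ι) : Integrable fun s => U₂ (t j - s) * siteWeight U β t s := by
  have := h.continuous₂
  exact h.integrable_mul_siteWeight hβ t (by fun_prop) (D := K) fun s => (h.abs_le _).trans
    (le_mul_of_one_le_right h.bound_nonneg (by nlinarith [sq_nonneg s]))

/-- Integration by parts against the constant 1: the total force on the site has mean zero. -/
theorem sum_integral_deriv (h : SmoothPotential U U₁ U₂ A B K) (hβ : 0 < β) (t : ι → ℝ) :
    ∑ j, ∫ s, U₁ (t j - s) * siteWeight U β t s = 0 := by
  have := h.integral_by_parts hβ t (f := fun _ => 1) (f' := fun _ => 0)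
    (fun s => hasDerivAt_const s 1) continuous_const (D := 1) (by simp) (D' := 0) (by simp)
  simp only [zero_mul, integral_zero, one_mul, mul_assoc, integral_const_mul] at this
  rw [← integral_finsetSum _ fun j _ => h.integrable_deriv_mul hβ t j]
  simp only [← Finset.sum_mul]
  have h2 : β * ∫ s, (∑ j, U₁ (t j - s)) * siteWeight U β t s = 0 := by linarith
  exact (mul_eq_zero.1 h2).resolve_left hβ.ne'

/-- Integration by parts against a single force. This trades U'' for products of forces, so that the
Hessian of log Z involves covariances only. -/
theorem integral_deriv₂ (h : SmoothPotential U U₁ U₂ A B K) (hβ : 0 < β) (t : ι → ℝ) (j : ι) :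
    ∫ s, U₂ (t j - s) * siteWeight U β t s =
      β * ∑ k, ∫ s, U₁ (t j - s) * U₁ (t k - s) * siteWeight U β t s := by
  have hc := h.continuous₂
  have := h.integral_by_parts hβ t (f := fun s => U₁ (t j - s)) (f' := fun s => -U₂ (t j - s))
    (fun s => by
      simpa [Function.comp_def] using
        (h.hasDerivAt' (t j - s)).comp s ((hasDerivAt_id s).const_sub (t j)))
    (by fun_prop) (h.abs_deriv_sub_le le_rfl) (D' := K) (fun s => by simpa using h.abs_le _)
  simp only [neg_mul, integral_neg, neg_inj] at this
  rw [this, ← integral_finsetSum _ fun k _ => h.integrable_deriv_mul_deriv hβ t j k,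
    ← integral_const_mul]
  congr 1 with s
  rw [← Finset.sum_mul, ← Finset.mul_sum]; ring

theorem integrable_id_mul (h : SmoothPotential U U₁ U₂ A B K) (hβ : 0 < β) (t : ι → ℝ) :
    Integrable fun s => s * siteWeight U β t s :=
  h.integrable_mul_siteWeight hβ t (f := fun s => s) continuous_id (D := 1) fun s => by
    rw [one_mul]; nlinarith [sq_nonneg (|s| - 1), sq_abs s, abs_nonneg s]

theorem integrable_sq_mul (h : SmoothPotential U U₁ U₂ A B K) (hβ : 0 < β) (t : ι → ℝ) :
    Integrable fun s => s ^ 2 * siteWeight U β t s :=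
  h.integrable_mul_siteWeight hβ t (by fun_prop) (D := 1) fun s => by
    rw [abs_of_nonneg (sq_nonneg s)]; linarith

/-- A Cramér–Rao lower bound for the variance of a single height. -/
theorem variance_ge (h : SmoothPotential U U₁ U₂ A B K) (hβ : 0 < β) (t : ι → ℝ) {C₂ : ℝ}
    (hC₂ : 0 < C₂) (hU₂ : ∀ s, U₂ s ≤ C₂) :
    sitePartition U β t ^ 2 / (β * Fintype.card ι * C₂) ≤
      sitePartition U β t * (∫ s, s ^ 2 * siteWeight U β t s) -
        (∫ s, s * siteWeight U β t s) ^ 2 := by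
  have hn : 0 < (Fintype.card ι : ℝ) := by exact_mod_cast Fintype.card_pos
  set Z := sitePartition U β t with hZ
  have hZ0 : 0 < Z := h.sitePartition_pos hβ t
  set L := β * Fintype.card ι * C₂ with hL
  have hL0 : 0 < L := by positivity
  set P : ℝ → ℝ := fun s => β * ∑ j, U₁ (t j - s) with hP
  have hPc : Continuous P := by have := h.continuous₁; fun_prop
  obtain ⟨D, hD⟩ : ∃ D, ∀ s, |P s| ≤ D * (1 + |s|) := by
    refine ⟨β * ∑ j, (|U₁ 0| + K * |t j| + K), fun s => ?_⟩
    rw [hP, abs_mul, abs_of_pos hβ, mul_assoc, Finset.sum_mul]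
    gcongr
    exact (Finset.abs_sum_le_sum_abs _ _).trans
      (Finset.sum_le_sum fun j _ => h.abs_deriv_sub_le le_rfl s)
  have i0 := h.integrable_siteWeight hβ t
  have i1 := h.integrable_id_mul hβ t
  have i2 := h.integrable_sq_mul hβ t
  have iP := h.integrable_mul_siteWeight hβ t hPc fun s => abs_le_quadratic (hD s)
  have iPP := h.integrable_mul_siteWeight hβ t (hPc.mul hPc)
    fun s => abs_mul_le_quadratic (hD s) (hD s)
  have isP := h.integrable_mul_siteWeight hβ t (continuous_id.mul hPc)
    fun s => abs_mul_le_quadratic (C := 1) (by rw [id]; linarith [abs_nonneg s]) (hD s)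
  simp only [Pi.mul_apply, id] at iPP isP
  have eP : ∫ s, P s * siteWeight U β t s = 0 := by
    have e := h.sum_integral_deriv hβ t
    rw [← integral_finsetSum _ fun j _ => h.integrable_deriv_mul hβ t j] at e
    rw [← mul_zero β, ← e, ← integral_const_mul]
    congr 1 with s
    rw [hP, ← Finset.sum_mul]; ring
  have esP : ∫ s, (s * P s) * siteWeight U β t s = -Z := by
    have := h.integral_by_parts hβ t (f := fun s => s) (f' := fun _ => 1)
      (fun s => hasDerivAt_id s) continuous_const (D := 1)
      (fun s => by linarith [abs_nonneg s]) (D' := 1) (by simp)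
    simp only [one_mul] at this
    rw [hZ, sitePartition, this, neg_neg]
  -- `P` is the score, the logarithmic derivative of the weight. Its second moment, the Fisher
  -- information, equals the integral of β Σ_j U''(t_j - s) against the weight, and only the upper
  -- bound on U'' is needed.
  have ePP : ∫ s, (P s * P s) * siteWeight U β t s ≤ L * Z := by
    have e : ∫ s, (P s * P s) * siteWeight U β t s =
        β * ∑ j, ∫ s, U₂ (t j - s) * siteWeight U β t s := by
      have : ∀ s, (P s * P s) * siteWeight U β t s = ∑ j, β * ∑ k, β *
          (U₁ (t j - s) * U₁ (t k - s) * siteWeight U β t s) := by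
        intro s
        simp only [hP, ← Finset.mul_sum, ← Finset.sum_mul]
        ring
      simp only [this]
      have iJ : ∀ j, Integrable fun s => β * ∑ k, β *
          (U₁ (t j - s) * U₁ (t k - s) * siteWeight U β t s) := fun j =>
        (integrable_finsetSum _ fun k _ =>
          (h.integrable_deriv_mul_deriv hβ t j k).const_mul β).const_mul β
      rw [integral_finsetSum _ fun j _ => iJ j, Finset.mul_sum]
      refine Finset.sum_congr rfl fun j _ => ?_
      rw [integral_const_mul, integral_finsetSum _ fun k _ =>
        (h.integrable_deriv_mul_deriv hβ t j k).const_mul β, h.integral_deriv₂ hβ t j]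
      simp only [integral_const_mul, ← Finset.mul_sum]
    have e2 : ∀ j, ∫ s, U₂ (t j - s) * siteWeight U β t s ≤ C₂ * Z := by
      intro j
      rw [hZ, sitePartition, ← integral_const_mul]
      refine integral_mono (h.integrable_deriv₂_mul hβ t j) (i0.const_mul C₂) fun s => ?_
      exact mul_le_mul_of_nonneg_right (hU₂ _) (Real.exp_pos _).le
    have e3 := Finset.sum_le_sum fun j (_ : j ∈ Finset.univ) => e2 j
    rw [Finset.sum_const, Finset.card_univ, nsmul_eq_mul] at e3
    rw [e, hL]
    nlinarith [mul_le_mul_of_nonneg_left e3 hβ.le]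
  set m₁ := ∫ s, s * siteWeight U β t s with hm₁
  set m₂ := ∫ s, s ^ 2 * siteWeight U β t s with hm₂
  -- Cauchy–Schwarz for s - m₁/Z and P in expanded form. Since s P integrates to -Z and P² to at
  -- most L Z, the factor 1/L gives -2Z/L + Z/L = -Z/L, the best constant these bounds allow.
  have hsq : 0 ≤ ∫ s, (s - m₁ / Z + L⁻¹ * P s) ^ 2 * siteWeight U β t s :=
    integral_nonneg fun s => mul_nonneg (sq_nonneg _) (Real.exp_pos _).le
  have hexp : ∫ s, (s - m₁ / Z + L⁻¹ * P s) ^ 2 * siteWeight U β t s =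
      m₂ - 2 * (m₁ / Z) * m₁ + (m₁ / Z) ^ 2 * Z + 2 * L⁻¹ * (-Z) +
        (-(2 * (m₁ / Z) * L⁻¹)) * 0 + L⁻¹ ^ 2 * ∫ s, (P s * P s) * siteWeight U β t s := by
    have := integral_linear_combination₆ i2 i1 i0 isP iP iPP 1 (-(2 * (m₁ / Z))) ((m₁ / Z) ^ 2)
      (2 * L⁻¹) (-(2 * (m₁ / Z) * L⁻¹)) (L⁻¹ ^ 2)
    rw [eP, esP, ← hm₁, ← hm₂, show ∫ s, siteWeight U β t s = Z from rfl] at this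
    refine Eq.trans ?_ (this.trans (by ring))
    congr 1 with s
    ring
  rw [hexp] at hsq
  have h3 : L⁻¹ ^ 2 * (∫ s, (P s * P s) * siteWeight U β t s) ≤ L⁻¹ * Z := by
    calc _ ≤ L⁻¹ ^ 2 * (L * Z) := by gcongr
      _ = L⁻¹ * Z := by field_simp
  have h4 : L⁻¹ * Z ≤ m₂ - m₁ ^ 2 / Z := by
    have : m₂ - 2 * (m₁ / Z) * m₁ + (m₁ / Z) ^ 2 * Z = m₂ - m₁ ^ 2 / Z := by field_simp; ring
    linarith
  calc Z ^ 2 / L = Z * (L⁻¹ * Z) := by field_simp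
    _ ≤ Z * (m₂ - m₁ ^ 2 / Z) := by gcongr
    _ = Z * m₂ - m₁ ^ 2 := by field_simp

/-- A lower bound for the covariance of the forces that two neighbours exert on a single height,
from a pointwise lower bound for the products of their increments. -/
theorem covariance_ge (h : SmoothPotential U U₁ U₂ A B K) (hβ : 0 < β) (t : ι → ℝ) {C₂ k₀ k₁ : ℝ}
    (hC₂ : 0 < C₂) (hU₂ : ∀ s, U₂ s ≤ C₂) (hk₁ : 0 ≤ k₁)
    (hinc : ∀ x y r, k₁ * r ^ 2 - k₀ ≤ (U₁ (x + r) - U₁ x) * (U₁ (y + r) - U₁ y)) (j k : ι) :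
    (k₁ / (β * Fintype.card ι * C₂) - k₀ / 2) * sitePartition U β t ^ 2 ≤
      sitePartition U β t * (∫ s, U₁ (t j - s) * U₁ (t k - s) * siteWeight U β t s) -
        (∫ s, U₁ (t j - s) * siteWeight U β t s) * (∫ s, U₁ (t k - s) * siteWeight U β t s) := by
  have hvar := h.variance_ge hβ t hC₂ hU₂
  set Z := sitePartition U β t with hZ
  have i0 := h.integrable_siteWeight hβ t
  have i1 := h.integrable_id_mul hβ t
  have i2 := h.integrable_sq_mul hβ t
  have ij := h.integrable_deriv_mul hβ t j
  have ik := h.integrable_deriv_mul hβ t k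
  have ijk := h.integrable_deriv_mul_deriv hβ t j k
  set m₁ := ∫ s, s * siteWeight U β t s with hm₁
  set m₂ := ∫ s, s ^ 2 * siteWeight U β t s with hm₂
  set pj := ∫ s, U₁ (t j - s) * siteWeight U β t s with hpj
  set pk := ∫ s, U₁ (t k - s) * siteWeight U β t s with hpk
  set pjk := ∫ s, U₁ (t j - s) * U₁ (t k - s) * siteWeight U β t s with hpjk
  -- The covariance is doubled: two independent copies s, r of the height are used, and `hinc` is
  -- applied to the increments between them. `inner` integrates over s, `outer` over r. The two
  -- sides become 2k₁ times the unnormalised variance minus k₀Z², and twice the unnormalised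
  -- covariance, whence the k₀/2.
  have inner : ∀ r, k₁ * m₂ - (2 * k₁ * r) * m₁ + (k₁ * r ^ 2 - k₀) * Z ≤
      pjk - U₁ (t k - r) * pj - U₁ (t j - r) * pk + (U₁ (t j - r) * U₁ (t k - r)) * Z := by
    intro r
    have hZ' : Z = ∫ s, siteWeight U β t s := rfl
    have l1 := integral_linear_combination₄ i2 i1 i0 i0 k₁ (-(2 * k₁ * r)) (k₁ * r ^ 2 - k₀) 0
    have l2 := integral_linear_combination₄ ijk ij ik i0 1 (-U₁ (t k - r)) (-U₁ (t j - r))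
      (U₁ (t j - r) * U₁ (t k - r))
    rw [← hm₁, ← hm₂, ← hZ'] at l1
    rw [← hpj, ← hpk, ← hpjk, ← hZ'] at l2
    have l3 := integral_mono l1.1 l2.1 fun s => ?_
    · rw [l1.2, l2.2] at l3
      linarith
    have h0 : 0 ≤ siteWeight U β t s := (Real.exp_pos _).le
    have h1 := hinc (t j - r) (t k - r) (r - s)
    have e1 : t j - r + (r - s) = t j - s := by ring
    have e2 : t k - r + (r - s) = t k - s := by ring
    rw [e1, e2] at h1
    have h2 := mul_le_mul_of_nonneg_right h1 h0
    linarith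
  have outer : k₁ * m₂ * Z - (2 * k₁ * m₁) * m₁ + (k₁ * Z) * m₂ - (k₀ * Z) * Z ≤
      pjk * Z - pj * pk - pk * pj + Z * pjk := by
    have hZ' : Z = ∫ s, siteWeight U β t s := rfl
    have l1 := integral_linear_combination₄ i0 i1 i2 i0 (k₁ * m₂) (-(2 * k₁ * m₁)) (k₁ * Z)
      (-(k₀ * Z))
    have l2 := integral_linear_combination₄ i0 ik ij ijk pjk (-pj) (-pk) Z
    rw [← hm₁, ← hm₂, ← hZ'] at l1
    rw [← hpj, ← hpk, ← hpjk, ← hZ'] at l2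
    have l3 := integral_mono l1.1 l2.1 fun s => ?_
    · rw [l1.2, l2.2] at l3
      linarith
    have h0 : 0 ≤ siteWeight U β t s := (Real.exp_pos _).le
    have h2 := mul_le_mul_of_nonneg_right (inner s) h0
    linarith
  have h5 := mul_le_mul_of_nonneg_left hvar hk₁
  have h6 : (k₁ / (β * Fintype.card ι * C₂) - k₀ / 2) * Z ^ 2 =
      k₁ * (Z ^ 2 / (β * Fintype.card ι * C₂)) - k₀ / 2 * Z ^ 2 := by ring
  rw [h6]
  linarith

end SmoothPotential

/-! ### Strict log-concavity of the single-site partition function. -/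

namespace SmoothPotential

variable {U U₁ U₂ : ℝ → ℝ} {A B K : ℝ} {ι : Type*} [Fintype ι] [Nonempty ι] {β : ℝ}

omit [Nonempty ι] in
theorem abs_line_le {R τ : ℝ} (t v : ι → ℝ) (hτ : |τ| ≤ R) (j : ι) :
    |(t + τ • v) j| ≤ ∑ k, (|t k| + R * |v k|) := by
  have hR : 0 ≤ R := (abs_nonneg _).trans hτ
  refine le_trans ?_ (Finset.single_le_sum (f := fun k => |t k| + R * |v k|)
    (fun k _ => by positivity) (Finset.mem_univ j))
  simp only [Pi.add_apply, Pi.smul_apply, smul_eq_mul]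
  refine (abs_add_le _ _).trans ?_
  rw [abs_mul]
  gcongr

omit [Nonempty ι] in
theorem exists_abs_force_le (h : SmoothPotential U U₁ U₂ A B K) (t v : ι → ℝ) (R : ℝ) :
    ∃ D, ∀ τ, |τ| ≤ R → ∀ s, |β * ∑ j, v j * U₁ ((t + τ • v) j - s)| ≤ D * (1 + |s|) := by
  refine ⟨|β| * ∑ j, |v j| * (|U₁ 0| + K * (∑ k, (|t k| + R * |v k|)) + K), fun τ hτ s => ?_⟩
  rw [abs_mul, mul_assoc, Finset.sum_mul]
  gcongr
  refine (Finset.abs_sum_le_sum_abs _ _).trans (Finset.sum_le_sum fun j _ => ?_)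
  rw [abs_mul, mul_assoc]
  gcongr
  exact h.abs_deriv_sub_le (abs_line_le t v hτ j) s

/-- Differentiation of single-site integrals along a line of boundary conditions. -/
theorem hasDerivAt_integral_line (h : SmoothPotential U U₁ U₂ A B K) (hβ : 0 < β) (t v : ι → ℝ)
    {f f' : ℝ → ℝ → ℝ} (hf : ∀ τ s, HasDerivAt (fun τ => f τ s) (f' τ s) τ)
    (hfc : ∀ τ, Continuous (f τ)) (hfc' : ∀ τ, Continuous (f' τ))
    (hfb : ∀ R, ∃ D, ∀ τ, |τ| ≤ R → ∀ s, |f τ s| ≤ D * (1 + |s|))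
    (hfb' : ∀ R, ∃ D, ∀ τ, |τ| ≤ R → ∀ s, |f' τ s| ≤ D * (1 + |s|)) (τ₀ : ℝ) :
    HasDerivAt (fun τ => ∫ s, f τ s * siteWeight U β (t + τ • v) s)
      (∫ s, (f' τ₀ s - f τ₀ s * (β * ∑ j, v j * U₁ ((t + τ₀ • v) j - s))) *
        siteWeight U β (t + τ₀ • v) s) τ₀ := by
  have hU₁ := h.continuous₁
  -- All constants are uniform over |τ| ≤ |τ₀| + 1, which contains the unit ball around τ₀; they
  -- combine to one integrable majorant, a multiple of (1 + s²) exp(-c s²).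
  obtain ⟨D₁, hD₁⟩ := hfb (|τ₀| + 1)
  obtain ⟨D₂, hD₂⟩ := hfb' (|τ₀| + 1)
  obtain ⟨D₃, hD₃⟩ := h.exists_abs_force_le (β := β) t v (|τ₀| + 1)
  obtain ⟨C, c, hc, hC, hb⟩ := h.siteWeight_le (ι := ι) hβ (∑ k, (|t k| + (|τ₀| + 1) * |v k|))
  have hball : ∀ τ ∈ Metric.ball τ₀ 1, |τ| ≤ |τ₀| + 1 := by
    intro τ hτ
    rw [Metric.mem_ball, Real.dist_eq] at hτ
    have := abs_add_le (τ - τ₀) τ₀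
    rw [sub_add_cancel] at this
    linarith
  have h0 : |τ₀| ≤ |τ₀| + 1 := by linarith
  have hquad : ∀ τ, |τ| ≤ |τ₀| + 1 → ∀ s,
      |f' τ s - f τ s * (β * ∑ j, v j * U₁ ((t + τ • v) j - s))| ≤
        (2 * D₂ + 2 * (D₁ * D₃)) * (1 + s ^ 2) := by
    intro τ hτ s
    refine (abs_sub _ _).trans ?_
    rw [add_mul]
    exact add_le_add (abs_le_quadratic (hD₂ τ hτ s))
      (abs_mul_le_quadratic (hD₁ τ hτ s) (hD₃ τ hτ s))
  refine (hasDerivAt_integral_of_dominated_loc_of_deriv_le (Metric.ball_mem_nhds τ₀ one_pos)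
    (Eventually.of_forall fun τ =>
      ((hfc τ).mul (h.continuous_siteWeight _)).aestronglyMeasurable)
    (h.integrable_mul_siteWeight hβ _ (hfc τ₀) fun s => abs_le_quadratic (hD₁ τ₀ h0 s))
    (F' := fun τ s => (f' τ s - f τ s * (β * ∑ j, v j * U₁ ((t + τ • v) j - s))) *
        siteWeight U β (t + τ • v) s)
    (h.integrable_mul_siteWeight hβ _ ?_ (hquad τ₀ h0)).aestronglyMeasurable
    (Eventually.of_forall fun s τ hτ => ?_)
    ((integrable_one_add_sq_mul_exp hc).const_mul ((2 * D₂ + 2 * (D₁ * D₃)) * C))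
    (Eventually.of_forall fun s τ _ => ?_)).2
  · have := hfc τ₀
    have := hfc' τ₀
    fun_prop
  · have hτ' := hball τ hτ
    have hw : 0 < siteWeight U β (t + τ • v) s := Real.exp_pos _
    rw [norm_mul, Real.norm_eq_abs, Real.norm_eq_abs, abs_of_pos hw]
    calc _ ≤ ((2 * D₂ + 2 * (D₁ * D₃)) * (1 + s ^ 2)) * (C * Real.exp (-c * s ^ 2)) := by
          gcongr
          · exact (abs_nonneg _).trans (hquad τ hτ' s)
          · exact hquad τ hτ' s
          · exact hb _ (abs_line_le t v hτ') s
      _ = _ := by ring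
  · refine ((hf τ s).mul (h.hasDerivAt_siteWeight_line t v s τ)).congr_deriv ?_
    ring

theorem hasDerivAt_sitePartition_line (h : SmoothPotential U U₁ U₂ A B K) (hβ : 0 < β)
    (t v : ι → ℝ) (τ : ℝ) :
    HasDerivAt (fun τ => sitePartition U β (t + τ • v))
      (∫ s, -(β * ∑ j, v j * U₁ ((t + τ • v) j - s)) * siteWeight U β (t + τ • v) s) τ := by
  have := h.hasDerivAt_integral_line hβ t v (f := fun _ _ => 1) (f' := fun _ _ => 0)
    (fun τ s => hasDerivAt_const τ 1) (fun _ => continuous_const) (fun _ => continuous_const)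
    (fun R => ⟨1, fun τ _ s => by simp⟩) (fun R => ⟨0, fun τ _ s => by simp⟩) τ
  simpa [sitePartition] using this

theorem hasDerivAt_deriv_sitePartition_line (h : SmoothPotential U U₁ U₂ A B K) (hβ : 0 < β)
    (t v : ι → ℝ) (τ : ℝ) :
    HasDerivAt (fun τ => ∫ s, -(β * ∑ j, v j * U₁ ((t + τ • v) j - s)) *
        siteWeight U β (t + τ • v) s)
      (∫ s, (-(β * ∑ j, v j * (v j * U₂ ((t + τ • v) j - s))) +
        (β * ∑ j, v j * U₁ ((t + τ • v) j - s)) ^ 2) * siteWeight U β (t + τ • v) s) τ := by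
  have hc₁ := h.continuous₁
  have hc₂ := h.continuous₂
  refine (h.hasDerivAt_integral_line hβ t v
    (f := fun τ s => -(β * ∑ j, v j * U₁ ((t + τ • v) j - s)))
    (f' := fun τ s => -(β * ∑ j, v j * (v j * U₂ ((t + τ • v) j - s))))
    (fun τ s => ?_) (fun _ => by fun_prop) (fun _ => by fun_prop)
    (fun R => ?_) (fun R => ⟨|β| * ∑ j, |v j| * (|v j| * K), fun τ _ s => ?_⟩) τ).congr_deriv ?_
  · have h1 : ∀ j, HasDerivAt (fun τ : ℝ => U₁ ((t + τ • v) j - s))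
        (v j * U₂ ((t + τ • v) j - s)) τ := fun j => by
      have e : HasDerivAt (fun τ : ℝ => (t + τ • v) j - s) (v j) τ := by
        simpa using (((hasDerivAt_id τ).mul_const (v j)).const_add (t j)).sub_const s
      have := (h.hasDerivAt' ((t + τ • v) j - s)).comp τ e
      rwa [mul_comm] at this
    exact ((HasDerivAt.fun_sum fun j (_ : j ∈ Finset.univ) =>
      (h1 j).const_mul (v j)).const_mul β).neg
  · obtain ⟨D, hD⟩ := h.exists_abs_force_le (β := β) t v R
    exact ⟨D, fun τ hτ s => by rw [abs_neg]; exact hD τ hτ s⟩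
  · rw [abs_neg, abs_mul, mul_assoc]
    have hK := h.bound_nonneg
    gcongr
    refine le_trans ?_ (le_mul_of_one_le_right (Finset.sum_nonneg fun j _ => by positivity)
      (by linarith [abs_nonneg s]))
    refine (Finset.abs_sum_le_sum_abs _ _).trans (Finset.sum_le_sum fun j _ => ?_)
    rw [abs_mul, abs_mul]
    gcongr
    exact h.abs_le _
  · congr 1 with s
    ring

/-- The second derivative of the single-site partition function along a line, in terms of the
covariances of the forces. -/
theorem integral_second_deriv_eq (h : SmoothPotential U U₁ U₂ A B K) (hβ : 0 < β) (t v : ι → ℝ) :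
    (∫ s, -(β * ∑ j, v j * U₁ (t j - s)) * siteWeight U β t s) ^ 2 - sitePartition U β t *
      (∫ s, (-(β * ∑ j, v j * (v j * U₂ (t j - s))) + (β * ∑ j, v j * U₁ (t j - s)) ^ 2) *
        siteWeight U β t s) =
      β ^ 2 / 2 * ∑ j, ∑ k, (v j - v k) ^ 2 *
        (sitePartition U β t * (∫ s, U₁ (t j - s) * U₁ (t k - s) * siteWeight U β t s) -
        (∫ s, U₁ (t j - s) * siteWeight U β t s) * (∫ s, U₁ (t k - s) * siteWeight U β t s)) := by
  set Z := sitePartition U β t with hZ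
  set m : ι → ℝ := fun j => ∫ s, U₁ (t j - s) * siteWeight U β t s with hm
  set M : ι → ι → ℝ := fun j k => ∫ s, U₁ (t j - s) * U₁ (t k - s) * siteWeight U β t s with hM
  have hM' : ∀ j k, M j k = M k j := fun j k => by
    simp only [hM]; congr 1 with s; ring
  have hm0 : ∑ j, m j = 0 := h.sum_integral_deriv hβ t
  have e1 : ∫ s, -(β * ∑ j, v j * U₁ (t j - s)) * siteWeight U β t s = -(β * ∑ j, v j * m j) := by
    simp only [hm, ← integral_const_mul]
    rw [← integral_finsetSum _ fun j _ => (h.integrable_deriv_mul hβ t j).const_mul (v j),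
      ← integral_const_mul, ← integral_neg]
    congr 1 with s
    rw [← neg_mul, ← neg_mul, mul_assoc, Finset.sum_mul]
    simp only [mul_assoc]
  have e2 : ∫ s, (-(β * ∑ j, v j * (v j * U₂ (t j - s))) + (β * ∑ j, v j * U₁ (t j - s)) ^ 2) *
      siteWeight U β t s = -(β ^ 2 * ∑ j, ∑ k, v j ^ 2 * M j k) +
        β ^ 2 * ∑ j, ∑ k, v j * v k * M j k := by
    have a1 : ∀ s, (-(β * ∑ j, v j * (v j * U₂ (t j - s))) +
        (β * ∑ j, v j * U₁ (t j - s)) ^ 2) * siteWeight U β t s =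
        (∑ j, (-(β * v j ^ 2)) * (U₂ (t j - s) * siteWeight U β t s)) +
        ∑ j, ∑ k, (β ^ 2 * (v j * v k)) * (U₁ (t j - s) * U₁ (t k - s) * siteWeight U β t s) := by
      intro s
      rw [mul_pow, sq (∑ j, v j * U₁ (t j - s)), Finset.sum_mul_sum, add_mul, neg_mul]
      simp only [Finset.mul_sum, Finset.sum_mul, ← Finset.sum_neg_distrib]
      congr 1
      · exact Finset.sum_congr rfl fun j _ => by ring
      · exact Finset.sum_congr rfl fun j _ => Finset.sum_congr rfl fun k _ => by ring
    simp only [a1]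
    rw [integral_add (integrable_finsetSum _ fun j _ =>
        (h.integrable_deriv₂_mul hβ t j).const_mul _)
      (integrable_finsetSum _ fun j _ => integrable_finsetSum _ fun k _ =>
        (h.integrable_deriv_mul_deriv hβ t j k).const_mul _),
      integral_finsetSum _ fun j _ => (h.integrable_deriv₂_mul hβ t j).const_mul _,
      integral_finsetSum _ fun j _ => integrable_finsetSum _ fun k _ =>
        (h.integrable_deriv_mul_deriv hβ t j k).const_mul _]
    have a2 : ∀ j, ∫ s, (∑ k, (β ^ 2 * (v j * v k)) *
        (U₁ (t j - s) * U₁ (t k - s) * siteWeight U β t s)) =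
        ∑ k, (β ^ 2 * (v j * v k)) * M j k := fun j => by
      rw [integral_finsetSum _ fun k _ => (h.integrable_deriv_mul_deriv hβ t j k).const_mul _]
      simp only [integral_const_mul, hM]
    simp only [a2, integral_const_mul, h.integral_deriv₂ hβ t]
    simp only [Finset.mul_sum, ← Finset.sum_neg_distrib]
    congr 1
    · exact Finset.sum_congr rfl fun j _ => Finset.sum_congr rfl fun k _ => by
        simp only [hM]; ring
    · exact Finset.sum_congr rfl fun j _ => Finset.sum_congr rfl fun k _ => by ring
  rw [e1, e2]
  change _ = β ^ 2 / 2 * ∑ j, ∑ k, (v j - v k) ^ 2 * (Z * M j k - m j * m k)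
  have s1 : ∑ j, ∑ k, v k ^ 2 * M j k = ∑ j, ∑ k, v j ^ 2 * M j k := by
    rw [Finset.sum_comm]
    exact Finset.sum_congr rfl fun j _ => Finset.sum_congr rfl fun k _ => by rw [hM']
  -- As the mean forces sum to zero, the diagonal terms v_j² m_j m_k can be added at no cost. They
  -- complete the products v_j v_k to squares (v_j - v_k)².
  have s2 : ∑ j, ∑ k, v j ^ 2 * (m j * m k) = 0 := by
    simp only [← Finset.mul_sum, hm0, mul_zero, Finset.sum_const_zero]
  have s3 : ∑ j, ∑ k, v k ^ 2 * (m j * m k) = 0 := by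
    rw [Finset.sum_comm, ← s2]
    exact Finset.sum_congr rfl fun j _ => Finset.sum_congr rfl fun k _ => by ring
  have s4 : ∑ j, ∑ k, v j * v k * (m j * m k) = (∑ j, v j * m j) ^ 2 := by
    rw [sq, Finset.sum_mul_sum]
    exact Finset.sum_congr rfl fun j _ => Finset.sum_congr rfl fun k _ => by ring
  have s5 : ∑ j, ∑ k, (v j - v k) ^ 2 * (Z * M j k - m j * m k) =
      Z * ∑ j, ∑ k, v j ^ 2 * M j k + Z * ∑ j, ∑ k, v k ^ 2 * M j k
        - 2 * Z * ∑ j, ∑ k, v j * v k * M j k - ∑ j, ∑ k, v j ^ 2 * (m j * m k)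
        - ∑ j, ∑ k, v k ^ 2 * (m j * m k) + 2 * ∑ j, ∑ k, v j * v k * (m j * m k) := by
    simp only [Finset.mul_sum, ← Finset.sum_add_distrib, ← Finset.sum_sub_distrib]
    exact Finset.sum_congr rfl fun j _ => Finset.sum_congr rfl fun k _ => by ring
  rw [s5, s1, s2, s3, s4]
  ring

/-- Uniform strict log-concavity, modulo constants, of the single-site partition function. -/
theorem sitePartition_logConcave (h : SmoothPotential U U₁ U₂ A B K) (hβ : 0 < β) {κ : ℝ}
    (hκ : ∀ (t : ι → ℝ) (j k : ι), κ * sitePartition U β t ^ 2 ≤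
      sitePartition U β t * (∫ s, U₁ (t j - s) * U₁ (t k - s) * siteWeight U β t s) -
        (∫ s, U₁ (t j - s) * siteWeight U β t s) * (∫ s, U₁ (t k - s) * siteWeight U β t s))
    {a b : ℝ} (ha : 0 < a) (hb : 0 < b) (hab : a + b = 1) (t t' : ι → ℝ) :
    Real.exp (β ^ 2 * κ / 4 * (a * b) * ∑ j, ∑ k, ((t' j - t j) - (t' k - t k)) ^ 2) *
      (sitePartition U β t ^ a * sitePartition U β t' ^ b) ≤
      sitePartition U β (a • t + b • t') := by
  set v := t' - t with hv
  set S := ∑ j, ∑ k, (v j - v k) ^ 2 with hS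
  set w : ℝ → ℝ := fun τ => sitePartition U β (t + τ • v) with hw
  set w₁ : ℝ → ℝ := fun τ => ∫ s, -(β * ∑ j, v j * U₁ ((t + τ • v) j - s)) *
        siteWeight U β (t + τ • v) s with hw₁
  set w₂ : ℝ → ℝ := fun τ => ∫ s, (-(β * ∑ j, v j * (v j * U₂ ((t + τ • v) j - s))) +
        (β * ∑ j, v j * U₁ ((t + τ • v) j - s)) ^ 2) * siteWeight U β (t + τ • v) s with hw₂
  have hwpos : ∀ τ, 0 < w τ := fun τ => h.sitePartition_pos hβ _
  have d1 : ∀ τ, HasDerivAt w (w₁ τ) τ := h.hasDerivAt_sitePartition_line hβ t v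
  have d2 : ∀ τ, HasDerivAt w₁ (w₂ τ) τ := h.hasDerivAt_deriv_sitePartition_line hβ t v
  -- `q` is a lower bound for -(log w)'' on the line, so -log w - qτ²/2 is convex. Comparing the
  -- values at 0, 1 and b gains (q/2)(b - b²) = (q/2)ab.
  set q := β ^ 2 * κ / 2 * S with hq
  have hbound : ∀ τ, q * w τ ^ 2 ≤ w₁ τ ^ 2 - w τ * w₂ τ := by
    intro τ
    have := h.integral_second_deriv_eq hβ (t + τ • v) v
    simp only [hw, hw₁, hw₂]
    rw [this, hq, hS]
    rw [show β ^ 2 * κ / 2 * (∑ j, ∑ k, (v j - v k) ^ 2) * sitePartition U β (t + τ • v) ^ 2 =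
      β ^ 2 / 2 * ∑ j, ∑ k, (v j - v k) ^ 2 * (κ * sitePartition U β (t + τ • v) ^ 2) by
        simp only [← Finset.sum_mul]; ring]
    gcongr with j _ k _
    exact hκ _ j k
  have g1 : ∀ τ, HasDerivAt (fun τ => -Real.log (w τ) - q / 2 * τ ^ 2)
      (-(w₁ τ / w τ) - q * τ) τ := fun τ => by
    have := ((d1 τ).log (hwpos τ).ne').fun_neg.fun_sub
      (((hasDerivAt_id τ).fun_pow 2).const_mul (q / 2))
    refine this.congr_deriv ?_
    simp; ring
  have g2 : ∀ τ, HasDerivAt (fun τ => -(w₁ τ / w τ) - q * τ)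
      (-((w₂ τ * w τ - w₁ τ * w₁ τ) / w τ ^ 2) - q) τ := fun τ => by
    have := ((d2 τ).fun_div (d1 τ) (hwpos τ).ne').fun_neg.fun_sub ((hasDerivAt_id τ).const_mul q)
    refine this.congr_deriv ?_
    simp
  have hconv : ConvexOn ℝ Set.univ (fun τ => -Real.log (w τ) - q / 2 * τ ^ 2) := by
    have e1 : deriv (fun τ => -Real.log (w τ) - q / 2 * τ ^ 2) =
        fun τ => -(w₁ τ / w τ) - q * τ := funext fun τ => (g1 τ).deriv
    refine convexOn_of_deriv2_nonneg' convex_univ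
      (fun τ _ => (g1 τ).differentiableAt.differentiableWithinAt) ?_ fun τ _ => ?_
    · rw [e1]; exact fun τ _ => (g2 τ).differentiableAt.differentiableWithinAt
    · simp only [Function.iterate_succ, Function.iterate_zero, Function.comp_apply, id]
      rw [e1, (g2 τ).deriv, sub_nonneg, ← neg_div, le_div_iff₀ (pow_pos (hwpos τ) 2)]
      linarith [hbound τ]
  have hc := hconv.2 (Set.mem_univ 0) (Set.mem_univ 1) ha.le hb.le hab
  simp only [smul_eq_mul, mul_zero, mul_one, zero_add, ne_eq, OfNat.ofNat_ne_zero,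
    not_false_eq_true, zero_pow, sub_zero, one_pow] at hc
  have w0 : w 0 = sitePartition U β t := by simp [hw]
  have w1 : w 1 = sitePartition U β t' := by simp [hw, hv]
  have wb : w b = sitePartition U β (a • t + b • t') := by
    simp only [hw, hv]
    congr 1
    rw [← eq_sub_iff_add_eq] at hab
    rw [hab]; ext j; simp; ring
  rw [← w0, ← w1, ← wb, ← Real.exp_log (hwpos b), Real.rpow_def_of_pos (hwpos 0),
    Real.rpow_def_of_pos (hwpos 1), ← Real.exp_add, ← Real.exp_add, Real.exp_le_exp]
  change β ^ 2 * κ / 4 * (a * b) * S + _ ≤ _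
  have hq' : β ^ 2 * κ / 4 * (a * b) * S = q / 2 * (b - b ^ 2) := by
    rw [hq, ← eq_sub_iff_add_eq] at *
    rw [hab]; ring
  rw [hq']
  nlinarith

end SmoothPotential

/-! ### Increments of U' under the smallness condition on g''. -/

/-- A function with derivative in `L^q` is Hölder continuous with exponent `1 - 1 / q`. -/
theorem abs_sub_le_eLpNorm_mul_rpow {φ φ' : ℝ → ℝ} (hφ : ∀ s, HasDerivAt φ (φ' s) s)
    (hc : Continuous φ') {q : ℝ} (hq : 1 ≤ q) (hm : MemLp φ' (ENNReal.ofReal q) volume)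
    (x : ℝ) {r : ℝ} (hr : 0 ≤ r) :
    |φ (x + r) - φ x| ≤ (eLpNorm φ' (ENNReal.ofReal q) volume).toReal * r ^ (1 - 1 / q) := by
  have hq0 : 0 < q := by linarith
  have h1 : ∫ s in x..(x + r), φ' s = φ (x + r) - φ x :=
    intervalIntegral.integral_eq_sub_of_hasDerivAt (fun s _ => hφ s) (hc.intervalIntegrable _ _)
  rw [← h1, intervalIntegral.integral_of_le (by linarith), ← Real.norm_eq_abs, ← toReal_enorm]
  have h2 : ‖∫ s in Set.Ioc x (x + r), φ' s‖ₑ ≤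
      eLpNorm φ' (ENNReal.ofReal q) volume * ENNReal.ofReal r ^ (1 - 1 / q) := by
    calc _ ≤ ∫⁻ s in Set.Ioc x (x + r), ‖φ' s‖ₑ := enorm_integral_le_lintegral_enorm _
      _ = eLpNorm φ' 1 (volume.restrict (Set.Ioc x (x + r))) := eLpNorm_one_eq_lintegral_enorm.symm
      _ ≤ eLpNorm φ' (ENNReal.ofReal q) (volume.restrict (Set.Ioc x (x + r))) *
          (volume.restrict (Set.Ioc x (x + r))) Set.univ ^
            (1 / (1 : ENNReal).toReal - 1 / (ENNReal.ofReal q).toReal) :=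
        eLpNorm_le_eLpNorm_mul_rpow_measure_univ (by simpa using hq) hc.aestronglyMeasurable
      _ ≤ _ := by
        rw [ENNReal.toReal_ofReal hq0.le, Measure.restrict_apply_univ, Real.volume_Ioc]
        simp only [ENNReal.toReal_one, div_one, add_sub_cancel_left]
        gcongr
        exact Measure.restrict_le_self
  have h3 : 0 ≤ 1 - 1 / q := by
    rw [sub_nonneg, div_le_one hq0]; exact hq
  refine (ENNReal.toReal_mono (ENNReal.mul_ne_top hm.2.ne
    (ENNReal.rpow_ne_top_of_nonneg h3 ENNReal.ofReal_ne_top)) h2).trans_eq ?_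
  rw [ENNReal.toReal_mul, ← ENNReal.toReal_rpow, ENNReal.toReal_ofReal hr]

/-- Here a, b stand for increments of V' and γ₁, γ₂ for those of -g'. Young's inequality bounds the
mixed terms by (C₁/4) r (a + b) plus a multiple of Γ². Since C₁r ≤ a and C₁r ≤ b, the former is at
most ab/2, and the remaining ab/2 is at least C₁²r²/2. -/
theorem sub_mul_sub_ge {a b γ₁ γ₂ r C₁ C₂ Γ : ℝ} (hC₁ : 0 < C₁) (hr : 0 ≤ r)
    (ha : C₁ * r ≤ a) (ha' : a ≤ C₂ * r) (hb : C₁ * r ≤ b) (hb' : b ≤ C₂ * r) (hγ₁ : 0 ≤ γ₁)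
    (hγ₂ : 0 ≤ γ₂) (hγ₁' : γ₁ ≤ Γ) (hγ₂' : γ₂ ≤ Γ) (hC₂ : 0 < C₂) :
    C₁ ^ 2 / 2 * r ^ 2 - 2 * (C₂ / C₁) * Γ ^ 2 ≤ (a - γ₁) * (b - γ₂) := by
  -- The weight C₁/(4C₂) on z² is chosen so that z ≤ C₂r turns it into (C₁/4) r z.
  have young : ∀ z γ : ℝ, C₁ * r ≤ z → z ≤ C₂ * r → 0 ≤ γ → γ ≤ Γ →
      z * γ ≤ C₁ / 4 * (r * z) + C₂ / C₁ * Γ ^ 2 := by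
    intro z γ hz hz' hγ hγ'
    have hz0 : 0 ≤ z := (by positivity : 0 ≤ C₁ * r).trans hz
    have e1 : z * γ ≤ C₁ / (4 * C₂) * z ^ 2 + C₂ / C₁ * γ ^ 2 := by
      have : C₁ / (4 * C₂) * z ^ 2 + C₂ / C₁ * γ ^ 2 - z * γ =
          (C₁ * z - 2 * C₂ * γ) ^ 2 / (4 * C₂ * C₁) := by field_simp; ring
      have h2 : 0 ≤ (C₁ * z - 2 * C₂ * γ) ^ 2 / (4 * C₂ * C₁) := by positivity
      linarith
    have e2 : C₁ / (4 * C₂) * z ^ 2 ≤ C₁ / 4 * (r * z) := by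
      calc C₁ / (4 * C₂) * z ^ 2 = C₁ / (4 * C₂) * (z * z) := by ring
        _ ≤ C₁ / (4 * C₂) * ((C₂ * r) * z) := by gcongr
        _ = _ := by field_simp
    have e3 : C₂ / C₁ * γ ^ 2 ≤ C₂ / C₁ * Γ ^ 2 := by gcongr
    linarith
  have y1 := young a γ₂ ha ha' hγ₂ hγ₂'
  have y2 := young b γ₁ hb hb' hγ₁ hγ₁'
  have hrC : 0 ≤ C₁ * r := by positivity
  have p1 : C₁ * r * b ≤ a * b := mul_le_mul_of_nonneg_right ha (hrC.trans hb)
  have p2 : C₁ * r * a ≤ a * b := by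
    rw [mul_comm a b]; exact mul_le_mul_of_nonneg_right hb (hrC.trans ha)
  have p3 : C₁ * r * r ≤ r * a := by nlinarith
  have p4 : C₁ * r * r ≤ r * b := by nlinarith
  have p5 : 0 ≤ γ₁ * γ₂ := mul_nonneg hγ₁ hγ₂
  have p6 := mul_le_mul_of_nonneg_left p3 hC₁.le
  have p7 := mul_le_mul_of_nonneg_left p4 hC₁.le
  have e : 2 * (C₂ / C₁) * Γ ^ 2 = C₂ / C₁ * Γ ^ 2 + C₂ / C₁ * Γ ^ 2 := by ring
  nlinarith

/-- Assumption (A2) squared. With L = βnC₂ it says that 2(C₂/C₁) G² L^(1/q) is less than C₁²/2, the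
coefficient of r² in `sub_mul_sub_ge`. -/
theorem sq_mul_rpow_lt_of_lt {β G C₁ C₂ n q : ℝ} (hβ : 0 < β) (hG : 0 ≤ G) (hC₁ : 0 < C₁)
    (hC₂ : 0 < C₂) (hn : 0 < n) (hq : 1 ≤ q)
    (h : β ^ (1 / (2 * q)) * G <
      C₁ ^ ((3 : ℝ) / 2) / (2 * C₂ ^ ((q + 1) / (2 * q)) * n ^ (1 / (2 * q)))) :
    G ^ 2 * (β * n * C₂) ^ (1 / q) < C₁ ^ 3 / (4 * C₂) := by
  have hq0 : 0 < q := by linarith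
  have h2 := pow_lt_pow_left₀ h (by positivity) two_ne_zero
  have sqr : ∀ {x : ℝ} (y : ℝ), 0 < x → (x ^ y) ^ 2 = x ^ (2 * y) := by
    intro x y hx
    rw [← Real.rpow_natCast, ← Real.rpow_mul hx.le]; congr 1; push_cast; ring
  rw [mul_pow, div_pow, mul_pow, mul_pow, sqr _ hβ, sqr _ hC₁, sqr _ hC₂, sqr _ hn] at h2
  have e1 : 2 * (1 / (2 * q)) = 1 / q := by field_simp
  have e2 : 2 * ((3 : ℝ) / 2) = (3 : ℕ) := by norm_num
  have e3 : 2 * ((q + 1) / (2 * q)) = 1 + 1 / q := by field_simp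
  rw [e1, e2, e3, Real.rpow_natCast, Real.rpow_add hC₂, Real.rpow_one, lt_div_iff₀ (by positivity)]
    at h2
  rw [Real.mul_rpow (by positivity) hC₂.le, Real.mul_rpow hβ.le hn.le, lt_div_iff₀ (by positivity)]
  linarith

/-- The products of increments of `U'` are bounded below by a quadratic function, with constants
that make the forces on a single site positively correlated. -/
theorem exists_increment_lower_bound {β : ℝ} (hβ : 0 < β) {n : ℝ} (hn : 0 < n) {V₁ V₂ g₁ g₂ : ℝ → ℝ}
    (hV : ∀ s, HasDerivAt V₁ (V₂ s) s) (hg : ∀ s, HasDerivAt g₁ (g₂ s) s) (hgc : Continuous g₂)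
    {C₁ C₂ : ℝ} (hC₁ : 0 < C₁) (hC₁₂ : C₁ < C₂) (hV₂ : ∀ s, C₁ ≤ V₂ s ∧ V₂ s ≤ C₂)
    (hg₂ : ∀ s, g₂ s ≤ 0) {q : ℝ} (hq : 1 ≤ q) (hm : MemLp g₂ (ENNReal.ofReal q) volume)
    (h : β ^ (1 / (2 * q)) * (eLpNorm g₂ (ENNReal.ofReal q) volume).toReal <
      C₁ ^ ((3 : ℝ) / 2) / (2 * C₂ ^ ((q + 1) / (2 * q)) * n ^ (1 / (2 * q)))) :
    ∃ k₀ k₁ : ℝ, 0 ≤ k₁ ∧ 0 < k₁ / (β * n * C₂) - k₀ / 2 ∧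
      ∀ x y r, k₁ * r ^ 2 - k₀ ≤ ((V₁ (x + r) + g₁ (x + r)) - (V₁ x + g₁ x)) *
        ((V₁ (y + r) + g₁ (y + r)) - (V₁ y + g₁ y)) := by
  have hC₂ : 0 < C₂ := hC₁.trans hC₁₂
  have hq0 : 0 < q := by linarith
  set G := (eLpNorm g₂ (ENNReal.ofReal q) volume).toReal with hG
  have hG0 : 0 ≤ G := ENNReal.toReal_nonneg
  set L := β * n * C₂ with hL
  have hL0 : 0 < L := by positivity
  have hmain := sq_mul_rpow_lt_of_lt hβ hG0 hC₁ hC₂ hn hq h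
  set k₂ := 2 * (C₂ / C₁) * (G ^ 2 * L ^ (1 / q)) with hk₂
  have hk₂0 : 0 ≤ k₂ := by positivity
  have hk₂' : k₂ < C₁ ^ 2 / 2 := by
    calc k₂ < 2 * (C₂ / C₁) * (C₁ ^ 3 / (4 * C₂)) := by rw [hk₂]; gcongr
      _ = _ := by field_simp; norm_num
  have hp0 : 0 < 1 / q := by positivity
  have hp1 : 1 / q ≤ 1 := by rw [div_le_one hq0]; exact hq
  have hp2 := mul_nonneg hk₂0 hp0.le
  -- By weighted AM–GM, k₂ L^(-1/q) r^(2(1-1/q)) is at most k₂/(qL) + k₂(1 - 1/q) r². The first term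
  -- is k₀ and the second is deducted from C₁²/2. Then k₁/L - k₀/2 = (C₁²/2 - k₂ + k₂/(2q))/L, which
  -- is positive because k₂ < C₁²/2.
  refine ⟨k₂ * (1 / q) / L, C₁ ^ 2 / 2 - k₂ * (1 - 1 / q), by linarith, ?_, ?_⟩
  · have : (C₁ ^ 2 / 2 - k₂ * (1 - 1 / q)) / L - k₂ * (1 / q) / L / 2 =
        (C₁ ^ 2 / 2 - k₂ + k₂ * (1 / q) / 2) / L := by ring
    rw [this]
    apply div_pos _ hL0
    linarith
  have key : ∀ x y r, 0 ≤ r → (C₁ ^ 2 / 2 - k₂ * (1 - 1 / q)) * r ^ 2 - k₂ * (1 / q) / L ≤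
      ((V₁ (x + r) + g₁ (x + r)) - (V₁ x + g₁ x)) *
        ((V₁ (y + r) + g₁ (y + r)) - (V₁ y + g₁ y)) := by
    intro x y r hr
    have hVb : ∀ x, C₁ * r ≤ V₁ (x + r) - V₁ x ∧ V₁ (x + r) - V₁ x ≤ C₂ * r := by
      intro x
      have hd : Differentiable ℝ V₁ := fun s => (hV s).differentiableAt
      have l := mul_sub_le_image_sub_of_le_deriv (C := C₁) hd
        (fun s => by rw [(hV s).deriv]; exact (hV₂ s).1) (show x ≤ x + r by linarith)
      have u := image_sub_le_mul_sub_of_deriv_le (C := C₂) hd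
        (fun s => by rw [(hV s).deriv]; exact (hV₂ s).2) (show x ≤ x + r by linarith)
      simp only [add_sub_cancel_left] at l u
      exact ⟨l, u⟩
    have hgb : ∀ x, 0 ≤ g₁ x - g₁ (x + r) ∧ g₁ x - g₁ (x + r) ≤ G * r ^ (1 - 1 / q) := by
      intro x
      have hd : Differentiable ℝ g₁ := fun s => (hg s).differentiableAt
      have u := image_sub_le_mul_sub_of_deriv_le (C := 0) hd
        (fun s => by rw [(hg s).deriv]; exact hg₂ s) (show x ≤ x + r by linarith)
      have := abs_sub_le_eLpNorm_mul_rpow hg hgc hq hm x hr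
      rw [abs_sub_comm] at this
      exact ⟨by linarith, (le_abs_self _).trans this⟩
    have h1 := sub_mul_sub_ge hC₁ hr (hVb x).1 (hVb x).2 (hVb y).1 (hVb y).2 (hgb x).1 (hgb y).1
      (hgb x).2 (hgb y).2 hC₂
    have h2 : (G * r ^ (1 - 1 / q)) ^ 2 ≤
        G ^ 2 * (L ^ (1 / q) * ((1 / q) * L⁻¹ + (1 - 1 / q) * r ^ 2)) := by
      have h3 := Real.geom_mean_le_arith_mean2_weighted hp0.le (sub_nonneg.2 hp1)
        (inv_pos.2 hL0).le (sq_nonneg r) (by ring)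
      have h4 : (r ^ (1 - 1 / q)) ^ 2 = (r ^ 2) ^ (1 - 1 / q) := by
        rw [← Real.rpow_natCast, ← Real.rpow_natCast, ← Real.rpow_mul hr, ← Real.rpow_mul hr,
          mul_comm]
      have h5 : L ^ (1 / q) * L⁻¹ ^ (1 / q) = 1 := by
        rw [← Real.mul_rpow hL0.le (inv_pos.2 hL0).le, mul_inv_cancel₀ hL0.ne', Real.one_rpow]
      rw [mul_pow, h4]
      gcongr
      calc (r ^ 2) ^ (1 - 1 / q) = L ^ (1 / q) * (L⁻¹ ^ (1 / q) * (r ^ 2) ^ (1 - 1 / q)) := by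
            rw [← mul_assoc, h5, one_mul]
        _ ≤ _ := by gcongr
    have h6 := mul_le_mul_of_nonneg_left h2 (show 0 ≤ 2 * (C₂ / C₁) by positivity)
    have h7 : 2 * (C₂ / C₁) * (G ^ 2 * (L ^ (1 / q) * ((1 / q) * L⁻¹ + (1 - 1 / q) * r ^ 2))) =
        k₂ * (1 / q) / L + k₂ * (1 - 1 / q) * r ^ 2 := by
      rw [hk₂]; ring
    rw [h7] at h6
    have h8 : ((V₁ (x + r) + g₁ (x + r)) - (V₁ x + g₁ x)) *
        ((V₁ (y + r) + g₁ (y + r)) - (V₁ y + g₁ y)) =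
        (V₁ (x + r) - V₁ x - (g₁ x - g₁ (x + r))) * (V₁ (y + r) - V₁ y - (g₁ y - g₁ (y + r))) := by
      ring
    rw [h8]
    linarith
  intro x y r
  rcases le_total 0 r with hr | hr
  · exact key x y r hr
  -- A negative increment read from its other endpoint is a positive one; both factors change sign.
  · have := key (x + r) (y + r) (-r) (by linarith)
    simp only [add_neg_cancel_right, neg_sq] at this
    linarith

/-! ### Iterated integrals: blocks of variables, forests, and change of the pinned site. -/

section LMarginal

variable {ι : Type*} [DecidableEq ι]

theorem DependsOn.lmarginal {f : (ι → ℝ) → ENNReal} {t : Set ι} (hf : DependsOn f t)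
    (s : Finset ι) : DependsOn (∫⋯∫⁻_s, f) t := by
  intro x y hxy
  simp only [MeasureTheory.lmarginal]
  congr 1 with z
  refine hf fun i hi => ?_
  by_cases his : i ∈ s
  · simp [Function.updateFinset, his]
  · simp [Function.updateFinset, his, hxy i hi]

theorem lmarginal_mul_of_dependsOn {f g : (ι → ℝ) → ENNReal} (hf : Measurable f) {s : Finset ι}
    (hg : DependsOn g (↑s)ᶜ) : (∫⋯∫⁻_s, fun x => g x * f x) = fun x => g x * (∫⋯∫⁻_s, f) x := by
  ext x
  simp only [MeasureTheory.lmarginal]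
  rw [← lintegral_const_mul (f := fun y => f (Function.updateFinset x s y)) _
    (hf.comp measurable_updateFinset)]
  congr 1 with z
  congr 1
  refine hg fun i hi => ?_
  have : i ∉ s := by simpa using hi
  simp [Function.updateFinset, this]

/-- Tonelli's theorem for a product of functions of disjoint blocks of variables. -/
theorem lmarginal_biUnion_prod {γ : Type*} [DecidableEq γ] (T : Finset γ) (s : γ → Finset ι)
    (f : γ → (ι → ℝ) → ENNReal) (hf : ∀ c, Measurable (f c))
    (hs : ∀ c ∈ T, ∀ c' ∈ T, c ≠ c' → Disjoint (s c) (s c'))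
    (hfs : ∀ c ∈ T, ∀ c' ∈ T, c ≠ c' → DependsOn (f c) (↑(s c'))ᶜ) (x : ι → ℝ) :
    (∫⋯∫⁻_(T.biUnion s), fun x => ∏ c ∈ T, f c x) x = ∏ c ∈ T, (∫⋯∫⁻_(s c), f c) x := by
  induction T using Finset.induction generalizing x with
  | empty => simp
  | insert c T hc ih =>
    have hne : ∀ c' ∈ T, c ≠ c' := fun c' hc' e => hc (e ▸ hc')
    have ih' := ih (fun a ha b hb => hs a (Finset.mem_insert_of_mem ha) b
      (Finset.mem_insert_of_mem hb)) (fun a ha b hb => hfs a (Finset.mem_insert_of_mem ha) b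
      (Finset.mem_insert_of_mem hb))
    have hprod : Measurable fun x => ∏ c ∈ T, f c x :=
      Finset.measurable_prod _ fun c _ => hf c
    rw [Finset.biUnion_insert, lmarginal_union _ _ (Finset.measurable_prod _ fun c _ => hf c)]
    · simp only [Finset.prod_insert hc]
      rw [lmarginal_mul_of_dependsOn hprod]
      · simp only [ih', mul_comm (f c _)]
        rw [lmarginal_mul_of_dependsOn (hf c)]
        · rw [mul_comm]
        · intro y z hyz
          refine Finset.prod_congr rfl fun c' hc' => ?_
          exact (hfs c' (Finset.mem_insert_of_mem hc') c (Finset.mem_insert_self _ _)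
            (hne c' hc').symm).lmarginal _ hyz
      · intro y z hyz
        -- Independence of each block separately gives independence of their union by changing the
        -- variables one block at a time.
        have : ∀ t : Finset γ, t ⊆ T → ∀ y z : ι → ℝ, (∀ i ∉ t.biUnion s, y i = z i) →
            f c y = f c z := by
          intro t
          induction t using Finset.induction with
          | empty => intro _ y z h; exact congrArg _ (funext fun i => h i (by simp))
          | insert a t _ iht =>
            intro hat y z h
            have ha : a ∈ T := hat (Finset.mem_insert_self _ _)
            calc f c y = f c (fun i => if i ∈ s a then z i else y i) := by
                  refine hfs c (Finset.mem_insert_self _ _) a (Finset.mem_insert_of_mem ha)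
                    (hne a ha) fun i hi => ?_
                  have : i ∉ s a := by simpa using hi
                  simp [this]
              _ = f c z := by
                  refine iht ((Finset.subset_insert _ _).trans hat) _ _ fun i hi => ?_
                  by_cases his : i ∈ s a
                  · simp [his]
                  · simp only [his, if_false]
                    exact h i (by rw [Finset.biUnion_insert]; simp [his, hi])
        exact this T subset_rfl y z fun i hi => hyz i (by simpa using hi)
    · rw [Finset.disjoint_biUnion_right]
      exact fun c' hc' => hs c (Finset.mem_insert_self _ _) c' (Finset.mem_insert_of_mem hc')
        (hne c' hc')

theorem lmarginal_prod_single (s : Finset ι) (f : ι → ℝ → ENNReal) (hf : ∀ i, Measurable (f i))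
    (x : ι → ℝ) : (∫⋯∫⁻_s, fun x => ∏ i ∈ s, f i (x i)) x = ∏ i ∈ s, ∫⁻ y, f i y := by
  have := lmarginal_biUnion_prod s (fun i => {i}) (fun i x => f i (x i))
    (fun i => (hf i).comp (measurable_pi_apply i)) (fun a _ b _ hab => by simpa using hab)
    (fun a _ b _ hab y z hyz => by
      simp only
      rw [hyz a (by simpa using hab)]) x
  simpa [lmarginal_singleton] using this

/-- The integral of a product over the edges of a rooted forest. -/
theorem lmarginal_prod_forest (p : ι → ι) (rank : ι → ℕ) (s : Finset ι)
    (hp : ∀ i ∈ s, rank (p i) < rank i) (g : ι → ℝ → ENNReal) (hg : ∀ i, Measurable (g i))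
    (x : ι → ℝ) :
    (∫⋯∫⁻_s, fun x => ∏ i ∈ s, g i (x i - x (p i))) x = ∏ i ∈ s, ∫⁻ y, g i y := by
  induction s using Finset.induction_on_max_value rank generalizing x with
  | empty => simp
  | insert i s hi hmax ih =>
    have hm : ∀ s : Finset ι, Measurable fun x : ι → ℝ => ∏ i ∈ s, g i (x i - x (p i)) :=
      fun s => Finset.measurable_prod _ fun j _ =>
        (hg j).comp ((measurable_pi_apply j).sub (measurable_pi_apply (p j)))
    have hpi : p i ≠ i := fun e => by
      have := hp i (Finset.mem_insert_self _ _)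
      rw [e] at this; exact lt_irrefl _ this
    have hps : ∀ j ∈ s, j ≠ i ∧ p j ≠ i := fun j hj => by
      refine ⟨fun e => hi (e ▸ hj), fun e => ?_⟩
      have := hp j (Finset.mem_insert_of_mem hj)
      rw [e] at this
      exact absurd (hmax j hj) (not_le.2 this)
    -- A vertex of maximal rank is nobody's parent, so its variable occurs in a single factor. It is
    -- integrated first, and translation invariance removes the height of its parent.
    rw [lmarginal_insert' _ (hm _) hi, Finset.prod_insert hi, ← ih (fun j hj =>
      hp j (Finset.mem_insert_of_mem hj))]
    have : (fun x : ι → ℝ => ∫⁻ y, ∏ j ∈ insert i s,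
        g j (Function.update x i y j - Function.update x i y (p j))) =
        fun x => (∫⁻ y, g i y) * ∏ j ∈ s, g j (x j - x (p j)) := by
      ext x
      have e : ∀ y, ∏ j ∈ insert i s,
          g j (Function.update x i y j - Function.update x i y (p j)) =
          g i (y - x (p i)) * ∏ j ∈ s, g j (x j - x (p j)) := by
        intro y
        rw [Finset.prod_insert hi]
        simp only [Function.update_self, Function.update_of_ne hpi]
        congr 1
        refine Finset.prod_congr rfl fun j hj => ?_
        rw [Function.update_of_ne (hps j hj).1, Function.update_of_ne (hps j hj).2]
      simp only [e]
      rw [lintegral_mul_const (f := fun y => g i (y - x (p i))) _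
        ((hg i).comp (measurable_id.sub_const _)),
        lintegral_sub_right_eq_self (g i)]
    rw [this, lmarginal_mul_of_dependsOn (hm s) (g := fun _ => ∫⁻ y, g i y)
      (fun _ _ _ => rfl)]

theorem lmarginal_add_const [Fintype ι] {F : (ι → ℝ) → ENNReal}
    (hF : ∀ (x : ι → ℝ) (c : ℝ), F (fun i => x i + c) = F x) (s : Finset ι) (x : ι → ℝ) (c : ℝ) :
    (∫⋯∫⁻_s, F) (fun i => x i + c) = (∫⋯∫⁻_s, F) x := by
  simp only [MeasureTheory.lmarginal]
  rw [← lintegral_add_right_eq_self (μ := Measure.pi fun _ : s => (volume : Measure ℝ))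
    (fun y => F (Function.updateFinset (fun i => x i + c) s y)) (fun _ => c)]
  congr 1 with y
  rw [← hF (Function.updateFinset x s y) c]
  congr 1
  ext i
  by_cases hi : i ∈ s <;> simp [Function.updateFinset, hi]

/-- The integral of a function that is invariant under the addition of constants does not depend
on the pinned variable. -/
theorem lmarginal_erase_eq [Fintype ι] {F : (ι → ℝ) → ENNReal} (hFm : Measurable F)
    (hF : ∀ (x : ι → ℝ) (c : ℝ), F (fun i => x i + c) = F x) (r r' : ι) :
    (∫⋯∫⁻_(Finset.univ.erase r), F) 0 = (∫⋯∫⁻_(Finset.univ.erase r'), F) 0 := by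
  by_cases hr : r = r'
  · rw [hr]
  -- The free height among r, r' is split off on both sides. Adding a constant carries a
  -- configuration with heights (0, -s) at (r, r') to one with heights (s, 0), which explains the
  -- reflection of the integration variable.
  rw [lmarginal_erase F hFm (show r' ∈ Finset.univ.erase r by simpa using Ne.symm hr),
    lmarginal_erase F hFm (show r ∈ Finset.univ.erase r' by simpa using hr),
    Finset.erase_right_comm, ← lintegral_neg_eq_self]
  congr 1 with s
  rw [← lmarginal_add_const hF _ _ s]
  refine lmarginal_congr _ _ fun i hi => ?_
  simp only [Finset.mem_erase, Finset.mem_univ, and_true, not_and_or, not_not] at hi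
  rcases hi with hi | hi
  · subst hi; simp [Function.update_of_ne hr]
  · subst hi; simp [Function.update_of_ne (Ne.symm hr)]

/-- A relabelling moves the pinned site, and `lmarginal_erase_eq` moves it back. For the torus this
yields translation invariance of pinned integrals. -/
theorem lmarginal_erase_comp_equiv [Fintype ι] {F : (ι → ℝ) → ENNReal} (hFm : Measurable F)
    (hF : ∀ (x : ι → ℝ) (c : ℝ), F (fun i => x i + c) = F x) (r : ι) (e : ι ≃ ι) :
    (∫⋯∫⁻_(Finset.univ.erase r), fun x : ι → ℝ => F (fun i => x (e i))) 0 =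
      (∫⋯∫⁻_(Finset.univ.erase r), F) 0 := by
  have hm : Measurable fun x : ι → ℝ => F (fun i => x (e i)) :=
    hFm.comp (measurable_pi_iff.2 fun i => measurable_pi_apply (e i))
  rw [lmarginal_erase_eq hm (fun x c => hF _ c) r (e r)]
  have := lmarginal_image (μ := fun _ : ι => (volume : Measure ℝ)) e.injective
    (Finset.univ.erase r) hFm 0
  rw [show (Finset.univ.erase r).image e = Finset.univ.erase (e r) by
    ext i
    simp only [Finset.mem_image, Finset.mem_erase, Finset.mem_univ, and_true]
    constructor
    · rintro ⟨j, hj, rfl⟩; exact fun h => hj (e.injective h)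
    · exact fun h => ⟨e.symm i, fun h' => h (by rw [← h', e.apply_symm_apply]), by simp⟩] at this
  exact this

end LMarginal

/-! ### Pinned integrals on the torus. -/

/-- The integral over the heights of the torus, with height zero at the origin. -/
noncomputable def pinnedIntegral {d N : ℕ} [NeZero N] (F : (LatticeTorus d N → ℝ) → ENNReal) :
    ENNReal :=
  (∫⋯∫⁻_(Finset.univ.erase 0), F) 0

/-- The passage from an integral over a subtype to an iterated integral, in which the heights can be
integrated in any order and in blocks. -/
theorem lintegral_pinnedField {d N : ℕ} [NeZero N] (F : (LatticeTorus d N → ℝ) → ENNReal) :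
    ∫⁻ ψ : {x : LatticeTorus d N // x ≠ 0} → ℝ, F (pinnedField ψ) = pinnedIntegral F := by
  let e : {x : LatticeTorus d N // x ∈ Finset.univ.erase (0 : LatticeTorus d N)} ≃
      {x : LatticeTorus d N // x ≠ 0} := Equiv.subtypeEquivRight (by simp)
  rw [pinnedIntegral, MeasureTheory.lmarginal]
  have := (volume_measurePreserving_piCongrLeft
    (fun _ : {x : LatticeTorus d N // x ≠ 0} => ℝ) e).lintegral_map_equiv
    (fun ψ => F (pinnedField ψ))
  rw [this]
  refine lintegral_congr fun y => ?_
  congr 1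
  ext x
  by_cases hx : x = 0
  · simp [pinnedField, Function.updateFinset, hx]
  · simp only [pinnedField, hx, dif_neg, not_false_eq_true, Function.updateFinset,
      Finset.mem_erase, Finset.mem_univ, and_true, ne_eq, dif_pos]
    exact Equiv.piCongrLeft_apply_apply (fun _ => ℝ) e y ⟨x, by simpa using hx⟩

/-- The Boltzmann weight of a height field on the torus. -/
noncomputable def fieldWeight {d N : ℕ} [NeZero N] (U : ℝ → ℝ) (β : ℝ) (u : Fin d → ℝ)
    (φ : LatticeTorus d N → ℝ) : ENNReal :=
  ENNReal.ofReal (Real.exp (-β * torusHamiltonian U φ u))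

theorem continuous_torusHamiltonian {d N : ℕ} [NeZero N] {U : ℝ → ℝ} (hU : Continuous U)
    (u : Fin d → ℝ) : Continuous fun φ : LatticeTorus d N → ℝ => torusHamiltonian U φ u := by
  unfold torusHamiltonian torusGradient
  fun_prop

theorem measurable_fieldWeight {d N : ℕ} [NeZero N] {U : ℝ → ℝ} (hU : Continuous U) (β : ℝ)
    (u : Fin d → ℝ) : Measurable (fieldWeight (N := N) U β u) := by
  have := continuous_torusHamiltonian (N := N) hU u
  unfold fieldWeight
  fun_prop

/-! ### Even tori: integrating out the odd sites. -/

section Parity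

variable {d N : ℕ}

/-- The parity of a site of a torus of even side length. -/
def siteParity (h : 2 ∣ N) : LatticeTorus d N →+ ZMod 2 where
  toFun x := ∑ i, ZMod.castHom h (ZMod 2) (x i)
  map_zero' := by simp
  map_add' x y := by simp only [Pi.add_apply, map_add, Finset.sum_add_distrib]

theorem siteParity_single (h : 2 ∣ N) (i : Fin d) : siteParity h (Pi.single i 1) = 1 := by
  change ∑ j, ZMod.castHom h (ZMod 2) ((Pi.single i 1 : LatticeTorus d N) j) = 1
  rw [Finset.sum_eq_single i]
  · rw [Pi.single_eq_same, map_one]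
  · intro j _ hj; rw [Pi.single_eq_of_ne hj, map_zero]
  · simp

/-- The odd sites of a torus of even side length. -/
def oddSites (d : ℕ) {N : ℕ} [NeZero N] (h : 2 ∣ N) : Finset (LatticeTorus d N) :=
  Finset.univ.filter fun x => siteParity h x = 1

/-- The shifted heights of the `2 d` neighbours of a site. -/
def neighbourHeights (φ : LatticeTorus d N → ℝ) (u : Fin d → ℝ) (x : LatticeTorus d N) :
    Fin d ⊕ Fin d → ℝ :=
  Sum.elim (fun i => φ (x + Pi.single i 1) + u i) (fun i => φ (x - Pi.single i 1) - u i)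

theorem neighbourHeights_combination (a b : ℝ) (φ φ' : LatticeTorus d N → ℝ) (u u' : Fin d → ℝ)
    (x : LatticeTorus d N) :
    a • neighbourHeights φ u x + b • neighbourHeights φ' u' x =
      neighbourHeights (a • φ + b • φ') (a • u + b • u') x := by
  ext j
  rcases j with i | i <;> simp [neighbourHeights] <;> ring

variable [NeZero N]

theorem zmod_two_ne_one_iff (a : ZMod 2) : a ≠ 1 ↔ a + 1 = 1 := by
  revert a; decide

theorem add_single_mem_oddSites (h : 2 ∣ N) (x : LatticeTorus d N) (i : Fin d) :
    x + Pi.single i 1 ∈ oddSites d h ↔ x ∉ oddSites d h := by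
  simp only [oddSites, Finset.mem_filter, Finset.mem_univ, true_and, map_add,
    siteParity_single]
  exact (zmod_two_ne_one_iff _).symm

theorem sub_single_mem_oddSites (h : 2 ∣ N) (x : LatticeTorus d N) (i : Fin d) :
    x - Pi.single i 1 ∈ oddSites d h ↔ x ∉ oddSites d h := by
  have := add_single_mem_oddSites h (x - Pi.single i 1) i
  rw [sub_add_cancel] at this
  tauto

theorem sum_compl_oddSites_eq_sub (h : 2 ∣ N) (i : Fin d) (f : LatticeTorus d N → ℝ) :
    ∑ x ∈ (oddSites d h)ᶜ, f x = ∑ x ∈ oddSites d h, f (x - Pi.single i 1) := by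
  refine Finset.sum_nbij' (fun x => x + Pi.single i 1) (fun x => x - Pi.single i 1) ?_ ?_ ?_ ?_ ?_
  · intro x hx; exact (add_single_mem_oddSites h x i).2 (by simpa using hx)
  · intro x hx; rw [Finset.mem_compl, sub_single_mem_oddSites]; exact not_not.2 hx
  · intro x _; simp
  · intro x _; simp
  · intro x _; simp

theorem sum_compl_oddSites_eq_add (h : 2 ∣ N) (i : Fin d) (f : LatticeTorus d N → ℝ) :
    ∑ x ∈ (oddSites d h)ᶜ, f x = ∑ x ∈ oddSites d h, f (x + Pi.single i 1) := by
  refine Finset.sum_nbij' (fun x => x - Pi.single i 1) (fun x => x + Pi.single i 1) ?_ ?_ ?_ ?_ ?_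
  · intro x hx; exact (sub_single_mem_oddSites h x i).2 (by simpa using hx)
  · intro x hx; rw [Finset.mem_compl, add_single_mem_oddSites]; exact not_not.2 hx
  · intro x _; simp
  · intro x _; simp
  · intro x _; simp

theorem two_mul_card_oddSites (h : 2 ∣ N) (hd : 0 < d) :
    2 * ((oddSites d h).card : ℝ) = Fintype.card (LatticeTorus d N) := by
  have h1 := sum_compl_oddSites_eq_add h (⟨0, hd⟩ : Fin d) fun _ => (1 : ℝ)
  have h2 := Finset.card_add_card_compl (oddSites d h)
  simp only [Finset.sum_const, nsmul_eq_mul, mul_one] at h1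
  rw [← h2, Nat.cast_add, h1]; ring

theorem neighbourHeights_congr (h : 2 ∣ N) {φ φ' : LatticeTorus d N → ℝ} (u : Fin d → ℝ)
    {x : LatticeTorus d N} (hx : x ∈ oddSites d h) (hφ : ∀ y ∉ oddSites d h, φ y = φ' y) :
    neighbourHeights φ u x = neighbourHeights φ' u x := by
  ext j
  rcases j with i | i
  · simp only [neighbourHeights, Sum.elim_inl]
    rw [hφ _ (by rw [add_single_mem_oddSites]; exact not_not.2 hx)]
  · simp only [neighbourHeights, Sum.elim_inr]
    rw [hφ _ (by rw [sub_single_mem_oddSites]; exact not_not.2 hx)]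

/-- Each bond has exactly one odd endpoint and is assigned to it. The symmetry of U reverses the
bonds that leave even sites, which is why the backward neighbours carry -u_i in `neighbourHeights`.
-/
theorem torusHamiltonian_eq_sum_oddSites (h : 2 ∣ N) {U : ℝ → ℝ} (hU : ∀ s, U (-s) = U s)
    (φ : LatticeTorus d N → ℝ) (u : Fin d → ℝ) :
    torusHamiltonian U φ u = ∑ x ∈ oddSites d h, ∑ j, U (neighbourHeights φ u x j - φ x) := by
  unfold torusHamiltonian
  rw [← Finset.sum_add_sum_compl (oddSites d h)]
  rw [Finset.sum_comm (s := (oddSites d h)ᶜ)]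
  have hshift := fun i => sum_compl_oddSites_eq_sub h i fun x => U (torusGradient φ i x + u i)
  simp only [hshift]
  rw [Finset.sum_comm (s := Finset.univ) (t := oddSites d h), ← Finset.sum_add_distrib]
  refine Finset.sum_congr rfl fun x _ => ?_
  rw [Fintype.sum_sum_type]
  congr 1
  · refine Finset.sum_congr rfl fun i _ => ?_
    simp only [torusGradient, neighbourHeights, Sum.elim_inl]
    congr 1; ring
  · refine Finset.sum_congr rfl fun i _ => ?_
    simp only [torusGradient, neighbourHeights, Sum.elim_inr, sub_add_cancel]
    rw [← hU]
    congr 1; ring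

theorem fieldWeight_eq_prod_siteWeight (h : 2 ∣ N) {U : ℝ → ℝ} (hU : ∀ s, U (-s) = U s) (β : ℝ)
    (φ : LatticeTorus d N → ℝ) (u : Fin d → ℝ) :
    fieldWeight U β u φ =
      ∏ x ∈ oddSites d h, ENNReal.ofReal (siteWeight U β (neighbourHeights φ u x) (φ x)) := by
  simp only [siteWeight]
  rw [← ENNReal.ofReal_prod_of_nonneg fun _ _ => (Real.exp_pos _).le, ← Real.exp_sum,
    fieldWeight, torusHamiltonian_eq_sum_oddSites h hU, Finset.sum_neg_distrib,
    ← Finset.mul_sum, neg_mul]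

/-- The sum over odd sites of the squared differences of opposite neighbours, of an interpolation
with tilt `v`, is at least `2 |T| |v|²`. -/
theorem sum_sq_neighbourHeights_ge (h : 2 ∣ N) (hd : 0 < d) (ψ : LatticeTorus d N → ℝ)
    (v : Fin d → ℝ) :
    2 * Fintype.card (LatticeTorus d N) * ∑ i, v i ^ 2 ≤
      ∑ x ∈ oddSites d h, ∑ j, ∑ k,
        (neighbourHeights ψ v x j - neighbourHeights ψ v x k) ^ 2 := by
  have h1 : ∀ x, ∑ i, (ψ (x + Pi.single i 1) - ψ (x - Pi.single i 1) + 2 * v i) ^ 2 ≤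
      ∑ j, ∑ k, (neighbourHeights ψ v x j - neighbourHeights ψ v x k) ^ 2 := by
    intro x
    rw [Fintype.sum_sum_type]
    refine le_trans ?_ (le_add_of_nonneg_right
      (Finset.sum_nonneg fun _ _ => Finset.sum_nonneg fun _ _ => sq_nonneg _))
    refine Finset.sum_le_sum fun i _ => ?_
    refine le_trans (le_of_eq ?_) (Finset.single_le_sum (f := fun k =>
      (neighbourHeights ψ v x (Sum.inl i) - neighbourHeights ψ v x k) ^ 2)
      (fun _ _ => sq_nonneg _) (Finset.mem_univ (Sum.inr i)))
    simp only [neighbourHeights, Sum.elim_inl, Sum.elim_inr]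
    ring
  refine le_trans ?_ (Finset.sum_le_sum fun x _ => h1 x)
  rw [Finset.sum_comm, Finset.mul_sum]
  refine Finset.sum_le_sum fun i _ => ?_
  -- The square of the height difference is dropped. The terms linear in ψ cancel after summation,
  -- because both shifts carry the odd sites bijectively onto the even sites.
  have h2 : ∀ x ∈ oddSites d h, 4 * v i ^ 2 + 4 * v i * ψ (x + Pi.single i 1) -
      4 * v i * ψ (x - Pi.single i 1) ≤
      (ψ (x + Pi.single i 1) - ψ (x - Pi.single i 1) + 2 * v i) ^ 2 := fun x _ => by
    nlinarith [sq_nonneg (ψ (x + Pi.single i 1) - ψ (x - Pi.single i 1))]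
  refine le_trans (le_of_eq ?_) (Finset.sum_le_sum h2)
  rw [Finset.sum_sub_distrib, Finset.sum_add_distrib]
  simp only [← Finset.mul_sum]
  rw [← sum_compl_oddSites_eq_sub h i ψ, ← sum_compl_oddSites_eq_add h i ψ, Finset.sum_const,
    nsmul_eq_mul, ← two_mul_card_oddSites h hd]
  ring

/-- Integrating out the odd sites. -/
theorem lmarginal_oddSites_fieldWeight (h : 2 ∣ N) (hd : 0 < d) {U U₁ U₂ : ℝ → ℝ} {A B K : ℝ}
    (hU : SmoothPotential U U₁ U₂ A B K) (hsymm : ∀ s, U (-s) = U s) {β : ℝ} (hβ : 0 < β)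
    (u : Fin d → ℝ) (φ : LatticeTorus d N → ℝ) :
    (∫⋯∫⁻_(oddSites d h), fieldWeight U β u) φ =
      ENNReal.ofReal (∏ x ∈ oddSites d h, sitePartition U β (neighbourHeights φ u x)) := by
  have : Nonempty (Fin d ⊕ Fin d) := ⟨Sum.inl ⟨0, hd⟩⟩
  have hUc := hU.continuous
  have e1 : fieldWeight (N := N) U β u = fun φ => ∏ x ∈ oddSites d h,
      ENNReal.ofReal (siteWeight U β (neighbourHeights φ u x) (φ x)) :=
    funext fun φ => fieldWeight_eq_prod_siteWeight h hsymm β φ u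
  have hm : ∀ x, Measurable fun φ : LatticeTorus d N → ℝ =>
      ENNReal.ofReal (siteWeight U β (neighbourHeights φ u x) (φ x)) := by
    intro x
    have hc : Continuous fun φ : LatticeTorus d N → ℝ =>
        siteWeight U β (neighbourHeights φ u x) (φ x) := by
      unfold siteWeight neighbourHeights
      simp only [Fintype.sum_sum_type, Sum.elim_inl, Sum.elim_inr]
      fun_prop
    exact hc.measurable.ennreal_ofReal
  have key := lmarginal_biUnion_prod (oddSites d h) (fun x => {x})
    (fun x φ => ENNReal.ofReal (siteWeight U β (neighbourHeights φ u x) (φ x))) hm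
    (fun a _ b _ hab => by simpa using hab)
    (fun a ha b hb hab y z hyz => by
      have hyz' : ∀ c, c ≠ b → y c = z c := fun c hc => hyz c (by simpa using hc)
      beta_reduce
      rw [hyz' a hab, neighbourHeights_congr h u ha fun c hc => hyz' c fun e => hc (e ▸ hb)]) φ
  rw [Finset.biUnion_singleton_eq_self] at key
  rw [e1, key, ENNReal.ofReal_prod_of_nonneg fun _ _ => (hU.sitePartition_pos hβ _).le]
  refine Finset.prod_congr rfl fun x hx => ?_
  rw [lmarginal_singleton, sitePartition, ofReal_integral_eq_lintegral_ofReal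
    (hU.integrable_siteWeight hβ _) (Eventually.of_forall fun s => (Real.exp_pos _).le)]
  refine lintegral_congr fun s => ?_
  rw [Function.update_self, neighbourHeights_congr h u hx fun y hy =>
    Function.update_of_ne (fun e => hy (by rw [e]; exact hx)) _ _]

/-- Uniform strict log-concavity in the tilt of the partition function of an even torus. -/
theorem pinnedIntegral_logConcave (h : 2 ∣ N) (hd : 0 < d) {U U₁ U₂ : ℝ → ℝ} {A B K : ℝ}
    (hU : SmoothPotential U U₁ U₂ A B K) (hsymm : ∀ s, U (-s) = U s) {β : ℝ} (hβ : 0 < β)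
    {κ : ℝ} (hκ0 : 0 ≤ κ)
    (hκ : ∀ (t : Fin d ⊕ Fin d → ℝ) j k, κ * sitePartition U β t ^ 2 ≤
      sitePartition U β t * (∫ s, U₁ (t j - s) * U₁ (t k - s) * siteWeight U β t s) -
        (∫ s, U₁ (t j - s) * siteWeight U β t s) * (∫ s, U₁ (t k - s) * siteWeight U β t s))
    {a b : ℝ} (ha : 0 < a) (hb : 0 < b) (hab : a + b = 1) (u u' : Fin d → ℝ) :
    pinnedIntegral (N := N) (fieldWeight U β u) ^ a *
      pinnedIntegral (N := N) (fieldWeight U β u') ^ b ≤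
    ENNReal.ofReal (Real.exp (-(β ^ 2 * κ / 2 * (a * b) * Fintype.card (LatticeTorus d N) *
      ∑ i, (u' i - u i) ^ 2))) * pinnedIntegral (N := N) (fieldWeight U β (a • u + b • u')) := by
  have : Nonempty (Fin d ⊕ Fin d) := ⟨Sum.inl ⟨0, hd⟩⟩
  set c := β ^ 2 * κ / 2 * (a * b) * Fintype.card (LatticeTorus d N) *
      ∑ i, (u' i - u i) ^ 2 with hc
  set E := (Finset.univ.erase (0 : LatticeTorus d N)) \ oddSites d h with hE
  -- The pinned site is even, so all odd heights are free and can be integrated out first; `E`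
  -- collects the remaining even sites.
  have h0 : (0 : LatticeTorus d N) ∉ oddSites d h := by
    simp [oddSites]
  have hsplit : Finset.univ.erase (0 : LatticeTorus d N) = E ∪ oddSites d h := by
    rw [hE, Finset.sdiff_union_of_subset]
    intro x hx
    exact Finset.mem_erase.2 ⟨fun e => h0 (e ▸ hx), Finset.mem_univ _⟩
  have hm : ∀ u : Fin d → ℝ, Measurable (fieldWeight (N := N) U β u) :=
    fun u => measurable_fieldWeight hU.continuous β u
  have hpin : ∀ u : Fin d → ℝ, pinnedIntegral (N := N) (fieldWeight U β u) =
      (∫⋯∫⁻_E, (∫⋯∫⁻_(oddSites d h), fieldWeight U β u)) 0 := fun u => by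
    rw [pinnedIntegral, hsplit, lmarginal_union _ _ (hm u) Finset.sdiff_disjoint]
  rw [hpin, hpin, hpin]
  have hmm := fun u : Fin d → ℝ => (hm u).lmarginal
    (fun _ : LatticeTorus d N => (volume : Measure ℝ))
    (s := oddSites d h)
  have key := prekopa_leindler_lmarginal ha hb hab E (hmm u) (hmm u')
    (h := fun φ => ENNReal.ofReal (Real.exp (-c)) *
      (∫⋯∫⁻_(oddSites d h), fieldWeight U β (a • u + b • u')) φ)
    ((hmm _).const_mul _) (fun φ φ' => ?_) 0 0
  · rw [lmarginal_mul_of_dependsOn (hmm _) (g := fun _ => ENNReal.ofReal (Real.exp (-c)))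
      (fun _ _ _ => rfl), smul_zero, smul_zero, add_zero] at key
    exact key
  · simp only [lmarginal_oddSites_fieldWeight h hd hU hsymm hβ]
    have hpos : ∀ t : Fin d ⊕ Fin d → ℝ, 0 < sitePartition U β t :=
      fun t => hU.sitePartition_pos hβ t
    have hpr : ∀ (φ : LatticeTorus d N → ℝ) u,
        0 < ∏ x ∈ oddSites d h, sitePartition U β (neighbourHeights φ u x) :=
      fun φ u => Finset.prod_pos fun x _ => hpos _
    rw [ENNReal.ofReal_rpow_of_pos (hpr _ _), ENNReal.ofReal_rpow_of_pos (hpr _ _),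
      ← ENNReal.ofReal_mul (Real.rpow_nonneg (hpr _ _).le _),
      ← ENNReal.ofReal_mul (Real.exp_pos _).le]
    refine ENNReal.ofReal_le_ofReal ?_
    rw [Real.exp_neg, ← div_eq_inv_mul, le_div_iff₀ (Real.exp_pos _),
      ← Real.finsetProd_rpow _ _ fun x _ => (hpos _).le,
      ← Real.finsetProd_rpow _ _ fun x _ => (hpos _).le, ← Finset.prod_mul_distrib, mul_comm]
    have h3 := Finset.prod_le_prod (s := oddSites d h) (fun x _ => by
      have := hpos (neighbourHeights φ u x)
      have := hpos (neighbourHeights φ' u' x)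
      positivity) fun x _ =>
      hU.sitePartition_logConcave hβ hκ ha hb hab (neighbourHeights φ u x)
        (neighbourHeights φ' u' x)
    simp only [neighbourHeights_combination] at h3
    rw [Finset.prod_mul_distrib] at h3
    refine le_trans ?_ h3
    have hnn : 0 ≤ ∏ x ∈ oddSites d h, (sitePartition U β (neighbourHeights φ u x) ^ a *
        sitePartition U β (neighbourHeights φ' u' x) ^ b) :=
      Finset.prod_nonneg fun x _ =>
        mul_nonneg (Real.rpow_nonneg (hpos _).le _) (Real.rpow_nonneg (hpos _).le _)
    refine mul_le_mul_of_nonneg_right ?_ hnn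
    rw [← Real.exp_sum, Real.exp_le_exp, ← Finset.mul_sum]
    -- The gain, summed over the odd sites, has a lower bound that does not depend on φ and φ', and
    -- so it factors out of the Prékopa–Leindler inequality.
    have h4 := sum_sq_neighbourHeights_ge h hd (φ' - φ) (u' - u)
    have h5 : ∀ x j, neighbourHeights φ' u' x j - neighbourHeights φ u x j =
        neighbourHeights (φ' - φ) (u' - u) x j := fun x j => by
      rcases j with i | i <;> simp [neighbourHeights] <;> ring
    simp only [h5]
    calc c = β ^ 2 * κ / 4 * (a * b) * (2 * Fintype.card (LatticeTorus d N) *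
          ∑ i, (u' - u) i ^ 2) := by rw [hc]; simp only [Pi.sub_apply]; ring
      _ ≤ _ := by gcongr

end Parity

/-! ### A priori bounds for the partition function, by a spanning tree. -/

/-- A continuous potential with quadratic lower and upper bounds. -/
structure QuadraticPotential (U : ℝ → ℝ) (A C : ℝ) : Prop where
  continuous : Continuous U
  pos : 0 < A
  lower : ∀ s, A * s ^ 2 ≤ U s
  upper : ∀ s, U s ≤ C * (1 + s ^ 2)

namespace QuadraticPotential

variable {U : ℝ → ℝ} {A C : ℝ}

theorem nonneg (h : QuadraticPotential U A C) (s : ℝ) : 0 ≤ U s :=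
  (mul_nonneg h.pos.le (sq_nonneg s)).trans (h.lower s)

theorem const_nonneg (h : QuadraticPotential U A C) : 0 ≤ C := by
  have := (h.nonneg 0).trans (h.upper 0)
  simpa using this

end QuadraticPotential

section LMarginal

variable {ι : Type*} [DecidableEq ι]

theorem lmarginal_mono_at {f g : (ι → ℝ) → ENNReal} (s : Finset ι) (x : ι → ℝ)
    (hfg : ∀ y : ι → ℝ, (∀ i ∉ s, y i = x i) → f y ≤ g y) :
    (∫⋯∫⁻_s, f) x ≤ (∫⋯∫⁻_s, g) x := by
  simp only [MeasureTheory.lmarginal]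
  refine lintegral_mono fun z => hfg _ fun i hi => ?_
  simp [Function.updateFinset, hi]

theorem lmarginal_sum {γ : Type*} (T : Finset γ) {f : γ → (ι → ℝ) → ENNReal}
    (hf : ∀ c, Measurable (f c)) (s : Finset ι) (x : ι → ℝ) :
    (∫⋯∫⁻_s, fun y => ∑ c ∈ T, f c y) x = ∑ c ∈ T, (∫⋯∫⁻_s, f c) x := by
  simp only [MeasureTheory.lmarginal]
  exact lintegral_finsetSum T fun c _ => (hf c).comp measurable_updateFinset

theorem lmarginal_add {f g : (ι → ℝ) → ENNReal} (hf : Measurable f) (s : Finset ι) (x : ι → ℝ) :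
    (∫⋯∫⁻_s, fun y => f y + g y) x = (∫⋯∫⁻_s, f) x + (∫⋯∫⁻_s, g) x := by
  simp only [MeasureTheory.lmarginal]
  exact lintegral_add_left (hf.comp measurable_updateFinset) _

theorem lmarginal_const_mul {f : (ι → ℝ) → ENNReal} (hf : Measurable f) (c : ENNReal)
    (s : Finset ι) (x : ι → ℝ) :
    (∫⋯∫⁻_s, fun y => c * f y) x = c * (∫⋯∫⁻_s, f) x := by
  rw [lmarginal_mul_of_dependsOn hf (g := fun _ => c) fun _ _ _ => rfl]

end LMarginal

theorem lintegral_gaussian_add {c : ℝ} (hc : 0 < c) (w : ℝ) :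
    ∫⁻ y : ℝ, ENNReal.ofReal (Real.exp (-c * (y + w) ^ 2)) =
      ENNReal.ofReal (Real.sqrt (Real.pi / c)) := by
  rw [lintegral_add_right_eq_self (fun y : ℝ => ENNReal.ofReal (Real.exp (-c * y ^ 2))),
    ← ofReal_integral_eq_lintegral_ofReal (integrable_exp_neg_mul_sq hc)
      (Eventually.of_forall fun y => (Real.exp_pos _).le), integral_gaussian]

section Torus

variable {d N : ℕ}

/-- The tilted gradient of a height field along the bond that leaves `x` in direction `i`. -/
def tiltedGradient (φ : LatticeTorus d N → ℝ) (u : Fin d → ℝ) (x : LatticeTorus d N) (i : Fin d) :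
    ℝ :=
  torusGradient φ i x + u i

theorem continuous_tiltedGradient (u : Fin d → ℝ) (x : LatticeTorus d N) (i : Fin d) :
    Continuous fun φ : LatticeTorus d N → ℝ => tiltedGradient φ u x i := by
  unfold tiltedGradient torusGradient
  fun_prop

theorem tiltedGradient_add_const (φ : LatticeTorus d N → ℝ) (u : Fin d → ℝ) (x : LatticeTorus d N)
    (i : Fin d) (c : ℝ) : tiltedGradient (fun y => φ y + c) u x i = tiltedGradient φ u x i := by
  simp [tiltedGradient, torusGradient]

theorem tiltedGradient_comp_add (φ : LatticeTorus d N → ℝ) (u : Fin d → ℝ)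
    (x z : LatticeTorus d N) (i : Fin d) :
    tiltedGradient (fun y => φ (y + z)) u x i = tiltedGradient φ u (x + z) i := by
  simp [tiltedGradient, torusGradient, add_right_comm]

open Classical in
/-- A direction in which the site `x ≠ 0` has a nonzero coordinate. -/
noncomputable def descentDirection [NeZero d] (x : LatticeTorus d N) : Fin d :=
  if h : ∃ i, x i ≠ 0 then h.choose else 0

/-- The neighbour of `x` that is one step closer to the origin. -/
noncomputable def torusParent [NeZero d] (x : LatticeTorus d N) : LatticeTorus d N :=
  x - Pi.single (descentDirection x) 1

theorem descentDirection_spec [NeZero d] {x : LatticeTorus d N} (hx : x ≠ 0) :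
    x (descentDirection x) ≠ 0 := by
  have h : ∃ i, x i ≠ 0 := Function.ne_iff.1 hx
  rw [descentDirection, dif_pos h]
  exact h.choose_spec

theorem ZMod.val_sub_one_lt [NeZero N] {a : ZMod N} (ha : a ≠ 0) : (a - 1).val < a.val := by
  have h1 : 0 < a.val := Nat.pos_of_ne_zero fun h => ha ((ZMod.val_eq_zero a).1 h)
  have hN : 1 < N := lt_of_le_of_lt h1 (ZMod.val_lt a)
  have : Fact (1 < N) := ⟨hN⟩
  rw [ZMod.val_sub (by rw [ZMod.val_one]; exact h1), ZMod.val_one]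
  omega

/-- The sum of the coordinates is a rank that decreases towards the origin, so the bonds to the
parents form a spanning tree rooted at 0. -/
theorem sum_val_torusParent_lt [NeZero d] [NeZero N] {x : LatticeTorus d N} (hx : x ≠ 0) :
    ∑ i, (torusParent x i).val < ∑ i, (x i).val := by
  refine Finset.sum_lt_sum (fun i _ => ?_) ⟨descentDirection x, Finset.mem_univ _, ?_⟩
  · by_cases hi : i = descentDirection x
    · subst hi
      simpa [torusParent] using (ZMod.val_sub_one_lt (descentDirection_spec hx)).le
    · simp [torusParent, Pi.single_eq_of_ne hi]
  · simpa [torusParent] using ZMod.val_sub_one_lt (descentDirection_spec hx)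

theorem tiltedGradient_torusParent [NeZero d] (φ : LatticeTorus d N → ℝ) (u : Fin d → ℝ)
    (x : LatticeTorus d N) : tiltedGradient φ u (torusParent x) (descentDirection x) =
      φ x - φ (torusParent x) + u (descentDirection x) := by
  simp [tiltedGradient, torusGradient, torusParent]

variable [NeZero N]

theorem torusHamiltonian_eq_sum (U : ℝ → ℝ) (φ : LatticeTorus d N → ℝ) (u : Fin d → ℝ) :
    torusHamiltonian U φ u = ∑ x, ∑ i, U (tiltedGradient φ u x i) := rfl

theorem fieldWeight_add_const (U : ℝ → ℝ) (β : ℝ) (u : Fin d → ℝ) (φ : LatticeTorus d N → ℝ)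
    (c : ℝ) : fieldWeight U β u (fun x => φ x + c) = fieldWeight U β u φ := by
  simp only [fieldWeight, torusHamiltonian_eq_sum, tiltedGradient_add_const]

theorem fieldWeight_comp_add (U : ℝ → ℝ) (β : ℝ) (u : Fin d → ℝ) (φ : LatticeTorus d N → ℝ)
    (z : LatticeTorus d N) : fieldWeight U β u (fun x => φ (x + z)) = fieldWeight U β u φ := by
  simp only [fieldWeight, torusHamiltonian_eq_sum, tiltedGradient_comp_add]
  rw [show ∑ x, ∑ i, U (tiltedGradient φ u (x + z) i) = ∑ x, ∑ i, U (tiltedGradient φ u x i) from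
    Fintype.sum_equiv (Equiv.addRight z) _ _ fun x => rfl]

/-- A bond joins at most one site to its parent in this way, so the energy of the tree is part of
the total energy. -/
theorem sum_torusParent_le [NeZero d] (S : Finset (LatticeTorus d N))
    {f : LatticeTorus d N → Fin d → ℝ} (hf : ∀ x i, 0 ≤ f x i) :
    ∑ x ∈ S, f (torusParent x) (descentDirection x) ≤ ∑ x, ∑ i, f x i := by
  calc ∑ x ∈ S, f (torusParent x) (descentDirection x)
      ≤ ∑ x, f (torusParent x) (descentDirection x) :=
        Finset.sum_le_univ_sum_of_nonneg fun x => hf _ _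
    _ ≤ ∑ x, ∑ i, f (x - Pi.single i 1) i := Finset.sum_le_sum fun x _ =>
        Finset.single_le_sum (f := fun i => f (x - Pi.single i 1) i) (fun i _ => hf _ _)
          (Finset.mem_univ (descentDirection x))
    _ = ∑ x, ∑ i, f x i := by
        rw [Finset.sum_comm, Finset.sum_comm (f := f)]
        exact Finset.sum_congr rfl fun i _ => (Equiv.subRight (Pi.single i 1)).sum_comp (f · i)

/-- Gaussian integrals over the bonds that join the sites to their parents. -/
theorem lmarginal_gaussian_forest [NeZero d] {c : ℝ} (hc : 0 < c) (u : Fin d → ℝ)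
    (S : Finset (LatticeTorus d N)) (hS : ∀ x ∈ S, x ≠ 0) (φ : LatticeTorus d N → ℝ) :
    (∫⋯∫⁻_S, fun φ => ∏ x ∈ S, ENNReal.ofReal
      (Real.exp (-c * tiltedGradient φ u (torusParent x) (descentDirection x) ^ 2))) φ =
      ENNReal.ofReal (Real.sqrt (Real.pi / c)) ^ S.card := by
  simp only [tiltedGradient_torusParent]
  have := lmarginal_prod_forest torusParent (fun x : LatticeTorus d N => ∑ i, (x i).val) S
    (fun x hx => sum_val_torusParent_lt (hS x hx))
    (fun x y => ENNReal.ofReal (Real.exp (-c * (y + u (descentDirection x)) ^ 2)))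
    (fun x => by fun_prop) φ
  rw [this]
  simp only [lintegral_gaussian_add hc, Finset.prod_const]

/-- Only the bonds of the spanning tree are kept; their gradients are free coordinates, so the
integral factors into one-dimensional Gaussians. -/
theorem pinnedIntegral_gaussian_le [NeZero d] {c : ℝ} (hc : 0 < c) (u : Fin d → ℝ) :
    pinnedIntegral (N := N) (fun φ => ENNReal.ofReal
      (Real.exp (-c * ∑ x, ∑ i, tiltedGradient φ u x i ^ 2))) ≤
      ENNReal.ofReal (Real.sqrt (Real.pi / c)) ^
        (Finset.univ.erase (0 : LatticeTorus d N)).card := by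
  rw [← lmarginal_gaussian_forest hc u _ (fun x hx => (Finset.mem_erase.1 hx).1) 0,
    pinnedIntegral]
  refine lmarginal_mono (fun φ => ?_) 0
  rw [← ENNReal.ofReal_prod_of_nonneg fun _ _ => (Real.exp_pos _).le, ← Real.exp_sum,
    ← Finset.mul_sum]
  refine ENNReal.ofReal_le_ofReal (Real.exp_le_exp.2 ?_)
  have := sum_torusParent_le (Finset.univ.erase (0 : LatticeTorus d N))
    (f := fun x i => tiltedGradient φ u x i ^ 2) (fun _ _ => sq_nonneg _)
  nlinarith

theorem measurable_gaussian (c : ℝ) (u : Fin d → ℝ) :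
    Measurable fun φ : LatticeTorus d N → ℝ => ENNReal.ofReal
      (Real.exp (-c * ∑ x, ∑ i, tiltedGradient φ u x i ^ 2)) := by
  have := continuous_tiltedGradient (N := N) u
  fun_prop

variable {U : ℝ → ℝ} {A C : ℝ} {β : ℝ}

theorem fieldWeight_le_gaussian (h : QuadraticPotential U A C) (hβ : 0 < β) (u : Fin d → ℝ)
    (φ : LatticeTorus d N → ℝ) : fieldWeight U β u φ ≤ ENNReal.ofReal
      (Real.exp (-(β * A) * ∑ x, ∑ i, tiltedGradient φ u x i ^ 2)) := by
  refine ENNReal.ofReal_le_ofReal (Real.exp_le_exp.2 ?_)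
  rw [torusHamiltonian_eq_sum, neg_mul, neg_mul, neg_le_neg_iff, mul_assoc]
  refine mul_le_mul_of_nonneg_left ?_ hβ.le
  rw [Finset.mul_sum]
  refine Finset.sum_le_sum fun x _ => ?_
  rw [Finset.mul_sum]
  exact Finset.sum_le_sum fun i _ => h.lower _

theorem pinnedIntegral_fieldWeight_ne_top [NeZero d] (h : QuadraticPotential U A C) (hβ : 0 < β)
    (u : Fin d → ℝ) : pinnedIntegral (N := N) (fieldWeight U β u) ≠ ⊤ := by
  refine ne_top_of_le_ne_top ?_ ((lmarginal_mono (fieldWeight_le_gaussian h hβ u) 0).trans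
    (pinnedIntegral_gaussian_le (mul_pos hβ h.pos) u))
  exact ENNReal.pow_ne_top ENNReal.ofReal_ne_top

/-- The partition function is at least exponentially small in the volume. -/
theorem exp_le_pinnedIntegral (h : QuadraticPotential U A C) (hβ : 0 < β) (u : Fin d → ℝ) :
    ENNReal.ofReal (Real.exp (-(β * (C * ∑ i, (1 + (1 + |u i|) ^ 2)) *
      Fintype.card (LatticeTorus d N)))) ≤ pinnedIntegral (N := N) (fieldWeight U β u) := by
  set c := ENNReal.ofReal (Real.exp (-(β * (C * ∑ i, (1 + (1 + |u i|) ^ 2)) *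
      Fintype.card (LatticeTorus d N)))) with hc
  -- The integral is restricted to heights in [0, 1], a set of volume one on which all gradients are
  -- at most 1 in absolute value.
  have h1 := lmarginal_prod_single (Finset.univ.erase (0 : LatticeTorus d N))
    (fun _ => Set.indicator (Set.Icc (0 : ℝ) 1) 1)
    (fun _ => measurable_one.indicator measurableSet_Icc) 0
  have h2 : ∫⁻ y : ℝ, Set.indicator (Set.Icc (0 : ℝ) 1) (1 : ℝ → ENNReal) y = 1 := by
    rw [lintegral_indicator_one measurableSet_Icc]; simp
  simp only [h2, Finset.prod_const_one] at h1
  have hm : Measurable fun φ : LatticeTorus d N → ℝ => ∏ x ∈ Finset.univ.erase 0,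
      Set.indicator (Set.Icc (0 : ℝ) 1) (1 : ℝ → ENNReal) (φ x) :=
    Finset.measurable_prod _ fun x _ =>
      (measurable_one.indicator measurableSet_Icc).comp (measurable_pi_apply x)
  calc c = c * (∫⋯∫⁻_(Finset.univ.erase (0 : LatticeTorus d N)), fun φ =>
        ∏ x ∈ Finset.univ.erase 0, Set.indicator (Set.Icc (0 : ℝ) 1) (1 : ℝ → ENNReal) (φ x)) 0 := by
        rw [h1, mul_one]
    _ ≤ _ := by
        rw [← lmarginal_const_mul hm]
        refine lmarginal_mono_at _ _ fun φ hφ => ?_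
        have h0 : φ 0 = 0 := hφ 0 (by simp)
        by_cases hall : ∀ x ∈ Finset.univ.erase (0 : LatticeTorus d N), φ x ∈ Set.Icc (0 : ℝ) 1
        · have hall' : ∀ x, φ x ∈ Set.Icc (0 : ℝ) 1 := fun x => by
            by_cases hx : x = 0
            · rw [hx, h0]; simp
            · exact hall x (by simpa using hx)
          rw [Finset.prod_congr rfl fun x hx => Set.indicator_of_mem (hall x hx) _]
          simp only [Pi.one_apply, Finset.prod_const_one, mul_one]
          refine ENNReal.ofReal_le_ofReal (Real.exp_le_exp.2 ?_)
          rw [neg_mul, neg_le_neg_iff, torusHamiltonian_eq_sum, mul_assoc]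
          refine mul_le_mul_of_nonneg_left ?_ hβ.le
          rw [mul_comm, ← nsmul_eq_mul, ← Finset.card_univ, ← Finset.sum_const]
          refine Finset.sum_le_sum fun x _ => ?_
          rw [Finset.mul_sum]
          refine Finset.sum_le_sum fun i _ => (h.upper _).trans ?_
          refine mul_le_mul_of_nonneg_left ?_ h.const_nonneg
          rw [add_le_add_iff_left, ← sq_abs]
          refine pow_le_pow_left₀ (abs_nonneg _) ?_ 2
          refine (abs_add_le _ _).trans (add_le_add_left ?_ _)
          have p := hall' (x + Pi.single i 1)
          have q := hall' x
          rw [torusGradient, abs_le]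
          constructor <;> linarith [p.1, p.2, q.1, q.2]
        · push Not at hall
          obtain ⟨x, hx, hx'⟩ := hall
          rw [Finset.prod_eq_zero hx (Set.indicator_of_notMem hx' _), mul_zero]
          exact zero_le

theorem pinnedIntegral_fieldWeight_ne_zero (h : QuadraticPotential U A C) (hβ : 0 < β)
    (u : Fin d → ℝ) : pinnedIntegral (N := N) (fieldWeight U β u) ≠ 0 := by
  refine (lt_of_lt_of_le ?_ (exp_le_pinnedIntegral h hβ u)).ne'
  simpa using Real.exp_pos _

end Torus

section Torus

variable {d : ℕ} {U : ℝ → ℝ} {A C : ℝ} {β : ℝ}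

theorem pinnedIntegral_const_mul {N : ℕ} [NeZero N] {f : (LatticeTorus d N → ℝ) → ENNReal}
    (hf : Measurable f) (c : ENNReal) :
    pinnedIntegral (fun φ => c * f φ) = c * pinnedIntegral f :=
  lmarginal_const_mul hf c _ _

theorem pinnedIntegral_add {N : ℕ} [NeZero N] {f g : (LatticeTorus d N → ℝ) → ENNReal}
    (hf : Measurable f) :
    pinnedIntegral (fun φ => f φ + g φ) = pinnedIntegral f + pinnedIntegral g :=
  lmarginal_add hf _ _

theorem pinnedIntegral_mono {N : ℕ} [NeZero N] {f g : (LatticeTorus d N → ℝ) → ENNReal}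
    (hfg : ∀ φ, f φ ≤ g φ) : pinnedIntegral f ≤ pinnedIntegral g :=
  lmarginal_mono hfg 0

/-! ### Expected gradient energy and Jensen's inequality. -/

/-- The expected gradient energy is at most proportional to the volume. -/
theorem exists_energy_bound [NeZero d] (h : QuadraticPotential U A C) (hβ : 0 < β)
    (u : Fin d → ℝ) : ∃ K : ℝ, 0 ≤ K ∧ ∀ (N : ℕ) [NeZero N],
      pinnedIntegral (N := N) (fun φ => ENNReal.ofReal (∑ x, ∑ i, tiltedGradient φ u x i ^ 2) *
        fieldWeight U β u φ) ≤
      ENNReal.ofReal (K * Fintype.card (LatticeTorus d N)) *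
        pinnedIntegral (N := N) (fieldWeight U β u) := by
  have hA := h.pos
  have hC := h.const_nonneg
  -- Half of the Gaussian decay rate: x ≤ m + exp(x - m) at x = cS uses up one half, and the other
  -- half keeps the integral finite. With m = LT, the factor exp(-m) outweighs the Gaussian integral
  -- relative to the lower bound for the partition function.
  set c := β * A / 2 with hc
  have hc0 : 0 < c := by positivity
  set K₀ := C * ∑ i, (1 + (1 + |u i|) ^ 2) with hK₀
  have hK₀0 : 0 ≤ K₀ := mul_nonneg hC (Finset.sum_nonneg fun i _ => by positivity)
  set γ := Real.sqrt (Real.pi / c) with hγ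
  have hγ0 : 0 < γ := Real.sqrt_pos.2 (by positivity)
  set L := β * K₀ + |Real.log γ| with hL
  have hL0 : 0 ≤ L := by positivity
  refine ⟨(L + 1) / c, by positivity, fun N _ => ?_⟩
  set T : ℝ := ((Fintype.card (LatticeTorus d N) : ℕ) : ℝ) with hT
  have hT1 : 1 ≤ T := by
    rw [hT]; exact_mod_cast Fintype.card_pos
  set m := L * T with hm
  have hm0 : 0 ≤ m := by positivity
  have hmeas := measurable_fieldWeight (N := N) h.continuous β u
  calc pinnedIntegral (N := N) (fun φ => ENNReal.ofReal (∑ x, ∑ i, tiltedGradient φ u x i ^ 2) *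
        fieldWeight U β u φ)
      ≤ pinnedIntegral (N := N) (fun φ => ENNReal.ofReal (m / c) * fieldWeight U β u φ +
          ENNReal.ofReal (Real.exp (-m) / c) * ENNReal.ofReal
            (Real.exp (-c * ∑ x, ∑ i, tiltedGradient φ u x i ^ 2))) := by
        refine pinnedIntegral_mono fun φ => ?_
        set S := ∑ x, ∑ i, tiltedGradient φ u x i ^ 2 with hS
        have hS0 : 0 ≤ S := Finset.sum_nonneg fun _ _ => Finset.sum_nonneg fun _ _ => sq_nonneg _
        have hH : A * S ≤ torusHamiltonian U φ u := by
          rw [hS, Finset.mul_sum, torusHamiltonian_eq_sum]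
          refine Finset.sum_le_sum fun x _ => ?_
          rw [Finset.mul_sum]
          exact Finset.sum_le_sum fun i _ => h.lower _
        rw [fieldWeight, ← ENNReal.ofReal_mul hS0, ← ENNReal.ofReal_mul (by positivity),
          ← ENNReal.ofReal_mul (by positivity), ← ENNReal.ofReal_add (by positivity)
          (by positivity)]
        refine ENNReal.ofReal_le_ofReal ?_
        set w := Real.exp (-β * torusHamiltonian U φ u) with hw
        have hw0 : 0 < w := Real.exp_pos _
        have e1 : c * S ≤ m + Real.exp (c * S - m) := by
          linarith [Real.add_one_le_exp (c * S - m)]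
        have e2 : Real.exp (c * S - m) * w ≤ Real.exp (-m) * Real.exp (-c * S) := by
          rw [hw, ← Real.exp_add, ← Real.exp_add, Real.exp_le_exp]
          have := mul_le_mul_of_nonneg_left hH hβ.le
          have e3 : β * (A * S) = 2 * (c * S) := by rw [hc]; ring
          linarith
        have e3 := mul_le_mul_of_nonneg_right e1 hw0.le
        have e4 : c * (S * w) ≤ m * w + Real.exp (-m) * Real.exp (-c * S) := by linarith
        calc S * w = (c * (S * w)) / c := by field_simp
          _ ≤ (m * w + Real.exp (-m) * Real.exp (-c * S)) / c := by gcongr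
          _ = _ := by ring
    _ = ENNReal.ofReal (m / c) * pinnedIntegral (N := N) (fieldWeight U β u) +
          ENNReal.ofReal (Real.exp (-m) / c) * pinnedIntegral (N := N) (fun φ => ENNReal.ofReal
            (Real.exp (-c * ∑ x, ∑ i, tiltedGradient φ u x i ^ 2))) := by
        rw [pinnedIntegral_add (hmeas.const_mul _), pinnedIntegral_const_mul hmeas,
          pinnedIntegral_const_mul (measurable_gaussian c u)]
    _ ≤ ENNReal.ofReal (m / c) * pinnedIntegral (N := N) (fieldWeight U β u) +
          ENNReal.ofReal (1 / c) * pinnedIntegral (N := N) (fieldWeight U β u) := by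
        refine add_le_add le_rfl ?_
        refine (mul_le_mul_right (pinnedIntegral_gaussian_le (N := N) hc0 u) _).trans ?_
        refine le_trans ?_ (mul_le_mul_right (exp_le_pinnedIntegral (N := N) h hβ u) _)
        rw [← ENNReal.ofReal_pow hγ0.le, ← ENNReal.ofReal_mul (by positivity),
          ← ENNReal.ofReal_mul (by positivity)]
        refine ENNReal.ofReal_le_ofReal ?_
        rw [div_mul_eq_mul_div, div_mul_eq_mul_div, one_mul]
        refine div_le_div_of_nonneg_right ?_ hc0.le
        have e1 : γ ^ (Finset.univ.erase (0 : LatticeTorus d N)).card ≤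
            Real.exp (|Real.log γ| * T) := by
          rw [← Real.exp_log hγ0, ← Real.exp_nat_mul, Real.log_exp, Real.exp_le_exp, mul_comm]
          have : ((Finset.univ.erase (0 : LatticeTorus d N)).card : ℝ) ≤ T := by
            rw [hT]; exact_mod_cast Finset.card_le_univ _
          calc Real.log γ * _ ≤ |Real.log γ| * ((Finset.univ.erase (0 : LatticeTorus d N)).card : ℝ) :=
                mul_le_mul_of_nonneg_right (le_abs_self _) (Nat.cast_nonneg _)
            _ ≤ _ := by gcongr
        calc _ ≤ Real.exp (-m) * Real.exp (|Real.log γ| * T) := by gcongr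
          _ = _ := by rw [← Real.exp_add, hm, hL]; congr 1; ring
    _ = ENNReal.ofReal ((m + 1) / c) * pinnedIntegral (N := N) (fieldWeight U β u) := by
        rw [← add_mul, ← ENNReal.ofReal_add (by positivity) (by positivity), ← add_div]
    _ ≤ _ := by
        gcongr
        rw [hm, div_mul_eq_mul_div]
        gcongr
        nlinarith

theorem measurable_sum_sq_mul_fieldWeight {N : ℕ} [NeZero N] (hU : Continuous U) (u : Fin d → ℝ)
    (x : LatticeTorus d N) : Measurable fun φ : LatticeTorus d N → ℝ =>
      ENNReal.ofReal (∑ i, tiltedGradient φ u x i ^ 2) * fieldWeight U β u φ := by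
  have := continuous_tiltedGradient (N := N) u
  have := measurable_fieldWeight (N := N) hU β u
  fun_prop

/-- The expected gradient energy of a single site is bounded uniformly in the volume. -/
theorem exists_site_energy_bound [NeZero d] (h : QuadraticPotential U A C) (hβ : 0 < β)
    (u : Fin d → ℝ) : ∃ K : ℝ, 0 ≤ K ∧ ∀ (N : ℕ) [NeZero N] (x : LatticeTorus d N),
      pinnedIntegral (N := N) (fun φ => ENNReal.ofReal (∑ i, tiltedGradient φ u x i ^ 2) *
        fieldWeight U β u φ) ≤
      ENNReal.ofReal K * pinnedIntegral (N := N) (fieldWeight U β u) := by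
  obtain ⟨K, hK, hKN⟩ := exists_energy_bound h hβ u
  refine ⟨K, hK, fun N _ x => ?_⟩
  have hmeas := measurable_sum_sq_mul_fieldWeight (N := N) (β := β) h.continuous u
  -- By translation invariance all sites have the same expected energy, which is therefore the
  -- average of the total.
  have hinv : ∀ z : LatticeTorus d N, pinnedIntegral (N := N) (fun φ =>
      ENNReal.ofReal (∑ i, tiltedGradient φ u z i ^ 2) * fieldWeight U β u φ) =
      pinnedIntegral (N := N) (fun φ =>
        ENNReal.ofReal (∑ i, tiltedGradient φ u 0 i ^ 2) * fieldWeight U β u φ) := by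
    intro z
    have := lmarginal_erase_comp_equiv (hmeas 0)
      (fun φ c => by simp only [tiltedGradient_add_const, fieldWeight_add_const]) 0
      (Equiv.addRight z)
    simp only [Equiv.coe_addRight, tiltedGradient_comp_add, fieldWeight_comp_add, zero_add] at this
    exact this
  have hsum := lmarginal_sum Finset.univ hmeas (Finset.univ.erase 0) 0
  have hN := hKN N
  have e1 : (fun φ : LatticeTorus d N → ℝ => ENNReal.ofReal
      (∑ x, ∑ i, tiltedGradient φ u x i ^ 2) * fieldWeight U β u φ) = fun φ =>
      ∑ x, ENNReal.ofReal (∑ i, tiltedGradient φ u x i ^ 2) * fieldWeight U β u φ := by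
    ext φ
    rw [ENNReal.ofReal_sum_of_nonneg fun x _ => Finset.sum_nonneg fun i _ => sq_nonneg _,
      Finset.sum_mul]
  rw [e1] at hN
  have e2 := hsum.symm.trans_le hN
  change ∑ x, pinnedIntegral _ ≤ _ at e2
  simp only [hinv] at e2
  rw [Finset.sum_const, Finset.card_univ, nsmul_eq_mul, ENNReal.ofReal_mul hK,
    ENNReal.ofReal_natCast, mul_comm (ENNReal.ofReal K), mul_assoc] at e2
  rw [hinv]
  exact (ENNReal.mul_le_mul_iff_right (by exact_mod_cast Fintype.card_ne_zero)
    (ENNReal.natCast_ne_top _)).1 e2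

theorem measurable_pinned_exp {N : ℕ} [NeZero N] {f : (LatticeTorus d N → ℝ) → ENNReal}
    {X : (LatticeTorus d N → ℝ) → ℝ} (hf : Measurable f) (hX : Measurable X) :
    Measurable fun φ => ENNReal.ofReal (Real.exp (-X φ)) * f φ := by
  fun_prop

/-- Jensen's inequality for the exponential function. -/
theorem exp_neg_mul_pinnedIntegral_le {N : ℕ} [NeZero N] {f : (LatticeTorus d N → ℝ) → ENNReal}
    {X : (LatticeTorus d N → ℝ) → ℝ} (hf : Measurable f) (hX : Measurable X) (hX0 : ∀ φ, 0 ≤ X φ)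
    (hfin : pinnedIntegral f ≠ ⊤) {m : ℝ} (hm : 0 ≤ m)
    (h : pinnedIntegral (fun φ => ENNReal.ofReal (X φ) * f φ) ≤
      ENNReal.ofReal m * pinnedIntegral f) :
    ENNReal.ofReal (Real.exp (-m)) * pinnedIntegral f ≤
      pinnedIntegral fun φ => ENNReal.ofReal (Real.exp (-X φ)) * f φ := by
  -- The tangent of exp(-x) at m lies below the graph; the term in X stands on the right so that
  -- nothing is subtracted in `ENNReal`.
  have h1 : pinnedIntegral (fun φ => ENNReal.ofReal (Real.exp (-m) * (1 + m)) * f φ) ≤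
      pinnedIntegral (fun φ => ENNReal.ofReal (Real.exp (-X φ)) * f φ +
        ENNReal.ofReal (Real.exp (-m)) * (ENNReal.ofReal (X φ) * f φ)) := by
    refine pinnedIntegral_mono fun φ => ?_
    rw [← mul_assoc, ← ENNReal.ofReal_mul (Real.exp_pos _).le, ← add_mul,
      ← ENNReal.ofReal_add (Real.exp_pos _).le (mul_nonneg (Real.exp_pos _).le (hX0 φ))]
    gcongr
    have e1 := Real.add_one_le_exp (m - X φ)
    have e2 : Real.exp (-X φ) = Real.exp (-m) * Real.exp (m - X φ) := by
      rw [← Real.exp_add]; congr 1; ring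
    have e3 := mul_le_mul_of_nonneg_left e1 (Real.exp_pos (-m)).le
    rw [e2]
    linarith
  have hXf : Measurable fun φ => ENNReal.ofReal (X φ) * f φ := by fun_prop
  rw [pinnedIntegral_add (measurable_pinned_exp hf hX), pinnedIntegral_const_mul hf,
    pinnedIntegral_const_mul hXf, ENNReal.ofReal_mul (Real.exp_pos _).le,
    ENNReal.ofReal_add zero_le_one hm, mul_add, add_mul, ENNReal.ofReal_one, mul_one] at h1
  have h2 := h1.trans (add_le_add_right (mul_le_mul_right h _) _)
  rw [← mul_assoc] at h2
  refine (ENNReal.add_le_add_iff_right ?_).1 h2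
  exact ENNReal.mul_ne_top (ENNReal.mul_ne_top ENNReal.ofReal_ne_top ENNReal.ofReal_ne_top) hfin

/-! ### The skeleton and a good choice of heights on it. -/

/-- The sites of the torus that have a vanishing coordinate. -/
def skeleton (d N : ℕ) [NeZero N] : Finset (LatticeTorus d N) :=
  Finset.univ.filter fun x => ∃ i, x i = 0

theorem mem_skeleton {N : ℕ} [NeZero N] {x : LatticeTorus d N} :
    x ∈ skeleton d N ↔ ∃ i, x i = 0 := by
  simp [skeleton]

theorem zero_mem_skeleton [NeZero d] {N : ℕ} [NeZero N] : (0 : LatticeTorus d N) ∈ skeleton d N :=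
  mem_skeleton.2 ⟨0, rfl⟩

/-- The skeleton is a union of d hyperplanes with N^(d-1) sites each; the costs proportional to it
are of surface order. -/
theorem card_skeleton_mul_le (d N : ℕ) [NeZero N] :
    (skeleton d N).card * N ≤ d * Fintype.card (LatticeTorus d N) := by
  have h1 : skeleton d N = Finset.univ.biUnion fun i => Fintype.piFinset fun j =>
      if j = i then {(0 : ZMod N)} else Finset.univ := by
    ext x
    simp only [mem_skeleton, Finset.mem_biUnion, Finset.mem_univ, true_and, Fintype.mem_piFinset]
    refine exists_congr fun i => ⟨fun hi j => ?_, fun hi => ?_⟩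
    · by_cases hj : j = i
      · subst hj; simpa using hi
      · simp [hj]
    · simpa using hi i
  have h2 : ∀ i : Fin d, (Fintype.piFinset fun j => if j = i then {(0 : ZMod N)} else
      Finset.univ).card * N = Fintype.card (LatticeTorus d N) := by
    intro i
    rw [Fintype.card_piFinset, Fintype.card_pi, ← Finset.mul_prod_erase _ _ (Finset.mem_univ i),
      ← Finset.mul_prod_erase (Finset.univ : Finset (Fin d)) (fun _ => Fintype.card (ZMod N))
      (Finset.mem_univ i)]
    simp only [if_true, Finset.card_singleton, one_mul, ZMod.card]
    rw [mul_comm]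
    congr 1
    refine Finset.prod_congr rfl fun j hj => ?_
    rw [if_neg (Finset.ne_of_mem_erase hj), Finset.card_univ, ZMod.card]
  calc (skeleton d N).card * N ≤ (∑ i : Fin d, (Fintype.piFinset fun j => if j = i then
        {(0 : ZMod N)} else Finset.univ).card) * N := by
        rw [h1]
        exact Nat.mul_le_mul_right _ Finset.card_biUnion_le
    _ = _ := by
        rw [Finset.sum_mul, Finset.sum_congr rfl fun i _ => h2 i]
        simp

/-- The descent changes only a nonzero coordinate, so vanishing coordinates persist and the tree
restricts to a spanning tree of the skeleton. -/
theorem torusParent_mem_skeleton [NeZero d] {N : ℕ} [NeZero N] {x : LatticeTorus d N}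
    (hx : x ∈ skeleton d N) (hx0 : x ≠ 0) : torusParent x ∈ skeleton d N := by
  obtain ⟨i, hi⟩ := mem_skeleton.1 hx
  refine mem_skeleton.2 ⟨i, ?_⟩
  have : i ≠ descentDirection x := fun e => descentDirection_spec hx0 (e ▸ hi)
  simp [torusParent, Pi.single_eq_of_ne this, hi]

open Classical in
/-- The gradient energy of the bonds with an endpoint in the skeleton, plus their number. -/
noncomputable def skeletonEnergy {N : ℕ} [NeZero N] (φ : LatticeTorus d N → ℝ) (u : Fin d → ℝ) :
    ℝ :=
  ∑ x, ∑ i, if x ∈ skeleton d N ∨ x + Pi.single i 1 ∈ skeleton d N then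
    1 + tiltedGradient φ u x i ^ 2 else 0

theorem skeletonEnergy_nonneg {N : ℕ} [NeZero N] (φ : LatticeTorus d N → ℝ) (u : Fin d → ℝ) :
    0 ≤ skeletonEnergy φ u :=
  Finset.sum_nonneg fun _ _ => Finset.sum_nonneg fun _ _ => by split_ifs <;> positivity

theorem measurable_skeletonEnergy {N : ℕ} [NeZero N] (u : Fin d → ℝ) :
    Measurable fun φ : LatticeTorus d N → ℝ => skeletonEnergy φ u := by
  have := continuous_tiltedGradient (N := N) u
  unfold skeletonEnergy
  refine Finset.measurable_sum _ fun x _ => Finset.measurable_sum _ fun i _ => ?_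
  split_ifs <;> fun_prop

/-- The expected energy of the skeleton is at most proportional to its size. -/
theorem exists_skeleton_energy_bound [NeZero d] (h : QuadraticPotential U A C) (hβ : 0 < β)
    (u : Fin d → ℝ) : ∃ K : ℝ, 0 ≤ K ∧ ∀ (N : ℕ) [NeZero N],
      pinnedIntegral (N := N) (fun φ => ENNReal.ofReal (skeletonEnergy φ u) *
        fieldWeight U β u φ) ≤
      ENNReal.ofReal (K * (skeleton d N).card) *
        pinnedIntegral (N := N) (fieldWeight U β u) := by
  obtain ⟨K, hK, hKN⟩ := exists_site_energy_bound h hβ u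
  refine ⟨2 * d * (1 + K), by positivity, fun N _ => ?_⟩
  classical
  have hmeas := measurable_sum_sq_mul_fieldWeight (N := N) (β := β) h.continuous u
  have hfm := measurable_fieldWeight (N := N) h.continuous β u
  -- The bonds that leave x, each counted once for every endpoint in the skeleton.
  let c : LatticeTorus d N → ℝ := fun x => ∑ i : Fin d,
    ((if x ∈ skeleton d N then 1 else 0) + if x + Pi.single i 1 ∈ skeleton d N then 1 else 0)
  have hc0 : ∀ x, 0 ≤ c x := fun x => Finset.sum_nonneg fun i _ => by
    split_ifs <;> norm_num
  have hcsum : ∑ x, c x = 2 * d * (skeleton d N).card := by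
    have e1 : ∑ x : LatticeTorus d N, (if x ∈ skeleton d N then (1 : ℝ) else 0) =
        (skeleton d N).card := by simp
    have e2 : ∀ i : Fin d, ∑ x : LatticeTorus d N,
        (if x + Pi.single i 1 ∈ skeleton d N then (1 : ℝ) else 0) = (skeleton d N).card := by
      intro i
      rw [← e1]
      exact Fintype.sum_equiv (Equiv.addRight (Pi.single i 1)) _ _ fun x => rfl
    simp only [c]
    rw [Finset.sum_comm]
    simp only [Finset.sum_add_distrib, e1, e2, Finset.sum_const, Finset.card_univ,
      Fintype.card_fin, nsmul_eq_mul]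
    ring
  calc pinnedIntegral (N := N) (fun φ => ENNReal.ofReal (skeletonEnergy φ u) *
        fieldWeight U β u φ)
      ≤ pinnedIntegral (N := N) (fun φ => ∑ x, ENNReal.ofReal (c x) * (fieldWeight U β u φ +
          ENNReal.ofReal (∑ i, tiltedGradient φ u x i ^ 2) * fieldWeight U β u φ)) := by
        refine pinnedIntegral_mono fun φ => ?_
        have e1 : skeletonEnergy φ u ≤ ∑ x, c x * (1 + ∑ i, tiltedGradient φ u x i ^ 2) := by
          refine Finset.sum_le_sum fun x _ => ?_
          rw [Finset.sum_mul]
          refine Finset.sum_le_sum fun i _ => ?_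
          have e2 : tiltedGradient φ u x i ^ 2 ≤ ∑ i, tiltedGradient φ u x i ^ 2 :=
            Finset.single_le_sum (f := fun i => tiltedGradient φ u x i ^ 2)
              (fun _ _ => sq_nonneg _) (Finset.mem_univ i)
          have e3 := sq_nonneg (tiltedGradient φ u x i)
          by_cases p : x ∈ skeleton d N <;> by_cases q : x + Pi.single i 1 ∈ skeleton d N <;>
            simp only [p, q, true_or, or_true, or_self, if_true, if_false] <;> nlinarith
        have e4 : ∀ x, 0 ≤ 1 + ∑ i, tiltedGradient φ u x i ^ 2 := fun x => by positivity
        refine (mul_le_mul_left (ENNReal.ofReal_le_ofReal e1) _).trans_eq ?_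
        rw [ENNReal.ofReal_sum_of_nonneg fun x _ => mul_nonneg (hc0 x) (e4 x), Finset.sum_mul]
        refine Finset.sum_congr rfl fun x _ => ?_
        rw [ENNReal.ofReal_mul (hc0 x), ENNReal.ofReal_add zero_le_one (by positivity),
          ENNReal.ofReal_one]
        ring
    _ = ∑ x, ENNReal.ofReal (c x) * (pinnedIntegral (N := N) (fieldWeight U β u) +
          pinnedIntegral (N := N) fun φ => ENNReal.ofReal (∑ i, tiltedGradient φ u x i ^ 2) *
            fieldWeight U β u φ) := by
        rw [pinnedIntegral, lmarginal_sum (f := fun x φ => ENNReal.ofReal (c x) * (fieldWeight U β u φ +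
          ENNReal.ofReal (∑ i, tiltedGradient φ u x i ^ 2) * fieldWeight U β u φ)) _
          fun x => (hfm.add (hmeas x)).const_mul _]
        refine Finset.sum_congr rfl fun x _ => ?_
        rw [lmarginal_const_mul (f := fun φ => fieldWeight U β u φ + ENNReal.ofReal
          (∑ i, tiltedGradient φ u x i ^ 2) * fieldWeight U β u φ) (hfm.add (hmeas x)),
          lmarginal_add hfm]
        rfl
    _ ≤ ∑ x, ENNReal.ofReal (c x) * (ENNReal.ofReal (1 + K) *
          pinnedIntegral (N := N) (fieldWeight U β u)) := by
        gcongr with x _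
        rw [ENNReal.ofReal_add zero_le_one hK, add_mul, ENNReal.ofReal_one, one_mul]
        gcongr
        exact hKN N x
    _ = _ := by
        rw [← Finset.sum_mul, ← ENNReal.ofReal_sum_of_nonneg fun x _ => hc0 x, hcsum, ← mul_assoc,
          ← ENNReal.ofReal_mul (by positivity)]
        congr 2
        ring

/-- There are heights on the skeleton for which the integral over the other heights is not much
smaller than the partition function. -/
theorem exists_skeleton_heights [NeZero d] (h : QuadraticPotential U A C) (hβ : 0 < β)
    (u : Fin d → ℝ) {l : ℝ} (hl : 0 ≤ l) : ∃ K : ℝ, 0 ≤ K ∧ ∀ (N : ℕ) [NeZero N],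
      ∃ Φ : LatticeTorus d N → ℝ, Φ 0 = 0 ∧
        ENNReal.ofReal (Real.exp (-(K * (skeleton d N).card))) *
          pinnedIntegral (N := N) (fieldWeight U β u) ≤
        (∫⋯∫⁻_(skeleton d N)ᶜ, fun φ => ENNReal.ofReal (Real.exp (-(l * skeletonEnergy φ u))) *
          fieldWeight U β u φ) Φ := by
  obtain ⟨K, hK, hKN⟩ := exists_skeleton_energy_bound h hβ u
  set γ := Real.sqrt (Real.pi / 1) with hγ
  have hγ1 : 1 ≤ γ := by
    rw [hγ, div_one, Real.one_le_sqrt]; linarith [Real.pi_gt_three]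
  have hlog : 0 ≤ Real.log γ := Real.log_nonneg hγ1
  -- The term (l + 1)K is the cost in Jensen's inequality and log γ pays for the Gaussian integral
  -- over the tree of the skeleton. The final 1 makes the contradiction strict, as the skeleton is
  -- nonempty.
  refine ⟨(l + 1) * K + Real.log γ + 1, by positivity, fun N _ => ?_⟩
  set s := skeleton d N with hs
  have hs1 : (1 : ℝ) ≤ s.card := by
    exact_mod_cast Finset.card_pos.2 ⟨0, zero_mem_skeleton⟩
  -- If every choice of skeleton heights were bad, integrating over them would contradict Jensen's
  -- inequality for (l + 1) times the energy. The extra unit of energy supplies the Gaussian weight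
  -- `G`, which makes the integral over the skeleton heights finite.
  by_contra! hcon
  set Z := pinnedIntegral (N := N) (fieldWeight U β u) with hZ
  have hZt : Z ≠ ⊤ := pinnedIntegral_fieldWeight_ne_top h hβ u
  have hZ0 : Z ≠ 0 := pinnedIntegral_fieldWeight_ne_zero h hβ u
  have hfm := measurable_fieldWeight (N := N) h.continuous β u
  have hEm := measurable_skeletonEnergy (N := N) u
  have hle : pinnedIntegral (N := N) (fun φ => ENNReal.ofReal ((l + 1) * skeletonEnergy φ u) *
      fieldWeight U β u φ) ≤ ENNReal.ofReal ((l + 1) * (K * s.card)) * Z := by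
    have e : ∀ φ : LatticeTorus d N → ℝ, ENNReal.ofReal ((l + 1) * skeletonEnergy φ u) *
        fieldWeight U β u φ = ENNReal.ofReal (l + 1) *
          (ENNReal.ofReal (skeletonEnergy φ u) * fieldWeight U β u φ) := fun φ => by
      rw [ENNReal.ofReal_mul (by positivity), mul_assoc]
    simp only [e]
    rw [pinnedIntegral_const_mul (by fun_prop), ENNReal.ofReal_mul (by positivity), mul_assoc]
    gcongr
    exact hKN N
  have hJ := exp_neg_mul_pinnedIntegral_le hfm (hEm.const_mul (l + 1))
    (fun φ => mul_nonneg (by positivity) (skeletonEnergy_nonneg φ u)) hZt (by positivity) hle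
  set I : (LatticeTorus d N → ℝ) → ENNReal := fun φ =>
    ENNReal.ofReal (Real.exp (-(l * skeletonEnergy φ u))) * fieldWeight U β u φ with hI
  have hIm : Measurable I := measurable_pinned_exp hfm (hEm.const_mul l)
  set G : (LatticeTorus d N → ℝ) → ENNReal := fun φ => ∏ x ∈ s.erase 0, ENNReal.ofReal
      (Real.exp (-1 * tiltedGradient φ u (torusParent x) (descentDirection x) ^ 2)) with hG
  have hGm : Measurable G := by
    have := continuous_tiltedGradient (N := N) u
    fun_prop
  have hle2 : ∀ φ, ENNReal.ofReal (Real.exp (-((l + 1) * skeletonEnergy φ u))) *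
      fieldWeight U β u φ ≤ G φ * I φ := by
    intro φ
    simp only [hI, hG]
    rw [← ENNReal.ofReal_prod_of_nonneg fun _ _ => (Real.exp_pos _).le, ← Real.exp_sum,
      ← mul_assoc, ← ENNReal.ofReal_mul (Real.exp_pos _).le, ← Real.exp_add]
    gcongr
    rw [← Finset.mul_sum]
    have e : ∑ x ∈ s.erase 0, tiltedGradient φ u (torusParent x) (descentDirection x) ^ 2 ≤
        skeletonEnergy φ u := by
      classical
      refine le_trans (Finset.sum_le_sum fun x hx => ?_) (sum_torusParent_le (s.erase 0)
        (f := fun x i => if x ∈ skeleton d N ∨ x + Pi.single i 1 ∈ skeleton d N then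
          1 + tiltedGradient φ u x i ^ 2 else 0) fun _ _ => by split_ifs <;> positivity)
      rw [if_pos]
      · linarith
      · right
        simpa [torusParent] using (Finset.mem_erase.1 hx).2
    linarith
  have hsplit : Finset.univ.erase (0 : LatticeTorus d N) = s.erase 0 ∪ sᶜ := by
    ext x
    have h0 : (0 : LatticeTorus d N) ∈ s := zero_mem_skeleton
    simp only [Finset.mem_erase, Finset.mem_univ, and_true, Finset.mem_union, Finset.mem_compl]
    constructor
    · intro hx; by_cases hxs : x ∈ s
      · exact Or.inl ⟨hx, hxs⟩
      · exact Or.inr hxs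
    · rintro (hx | hx)
      · exact hx.1
      · rintro rfl; exact hx h0
  have hdisj : Disjoint (s.erase 0) sᶜ :=
    Finset.disjoint_left.2 fun x hx hx' => (Finset.mem_compl.1 hx') (Finset.mem_erase.1 hx).2
  have hGdep : DependsOn G (↑(sᶜ))ᶜ := by
    intro φ φ' hφ
    have hφ' : ∀ x ∈ s, φ x = φ' x := fun x hx => hφ x (by simpa using hx)
    refine Finset.prod_congr rfl fun x hx => ?_
    have hx' := Finset.mem_erase.1 hx
    rw [tiltedGradient_torusParent, tiltedGradient_torusParent, hφ' x hx'.2,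
      hφ' _ (torusParent_mem_skeleton hx'.2 hx'.1)]
  set w := ENNReal.ofReal (Real.exp (-(((l + 1) * K + Real.log γ + 1) * s.card))) * Z with hw
  have hupper : pinnedIntegral (N := N) (fun φ => ENNReal.ofReal
      (Real.exp (-((l + 1) * skeletonEnergy φ u))) * fieldWeight U β u φ) ≤
      w * ENNReal.ofReal γ ^ (s.erase 0).card := by
    calc _ ≤ pinnedIntegral (N := N) (fun φ => G φ * I φ) := pinnedIntegral_mono hle2
      _ = (∫⋯∫⁻_(s.erase 0), fun φ => G φ * (∫⋯∫⁻_sᶜ, I) φ) 0 := by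
          rw [pinnedIntegral, hsplit, lmarginal_union _ (fun φ => G φ * I φ) (hGm.mul hIm) hdisj,
            lmarginal_mul_of_dependsOn hIm hGdep]
      _ ≤ (∫⋯∫⁻_(s.erase 0), fun φ => w * G φ) 0 := by
          refine lmarginal_mono_at _ _ fun φ hφ => ?_
          rw [mul_comm]
          gcongr
          exact (hcon φ (hφ 0 (by simp))).le
      _ = _ := by
          rw [lmarginal_const_mul hGm, hG, lmarginal_gaussian_forest one_pos u _
            fun x hx => (Finset.mem_erase.1 hx).1]
  have hfinal := hJ.trans hupper
  rw [hw, mul_right_comm] at hfinal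
  have h3 := (ENNReal.mul_le_mul_iff_left hZ0 hZt).1 hfinal
  rw [← ENNReal.ofReal_pow (by positivity), ← ENNReal.ofReal_mul (Real.exp_pos _).le,
    ENNReal.ofReal_le_ofReal_iff (by positivity)] at h3
  have h4 : γ ^ (s.erase 0).card ≤ Real.exp (Real.log γ * s.card) := by
    rw [mul_comm, Real.exp_nat_mul, Real.exp_log (by positivity)]
    exact pow_le_pow_right₀ hγ1 (Finset.card_erase_le)
  have h5 := h3.trans (mul_le_mul_of_nonneg_left h4 (Real.exp_pos _).le)
  rw [← Real.exp_add, Real.exp_le_exp] at h5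
  linarith

end Torus

/-! ### Tiling a large torus by blocks: coordinates. -/

section Tiling

variable {M N q r : ℕ}

/-- The position of a coordinate within its block, when `q` blocks of length `M` are laid out; the
coordinates outside the blocks are sent to `0`. -/
def foldCoord (M q : ℕ) (t : ZMod N) : ZMod M := if t.val < q * M then (t.val : ZMod M) else 0

/-- The number of the block of a coordinate; the coordinates outside the blocks are numbered
consecutively. -/
def blockCoord (M q : ℕ) (t : ZMod N) : ℕ := if t.val < q * M then t.val / M else t.val - q * M

/-- The coordinate with given block number and given position within the block. -/
def unfoldCoord (N : ℕ) (b : ℕ) (y : ZMod M) : ZMod N := ((b * M + y.val : ℕ) : ZMod N)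

theorem ZMod.val_add_one_eq [NeZero N] (t : ZMod N) : (t + 1).val = (t.val + 1) % N := by
  rw [ZMod.val_add, ZMod.val_one_eq_one_mod, Nat.add_mod_mod]

@[simp]
theorem foldCoord_zero : foldCoord M q (0 : ZMod N) = 0 := by simp [foldCoord]

theorem foldCoord_eq_zero_of_le {t : ZMod N} (ht : q * M ≤ t.val) : foldCoord M q t = 0 := by
  rw [foldCoord, if_neg (by omega)]

theorem foldCoord_add_one [NeZero N] (hN : N = q * M + r) {t : ZMod N} (ht : t.val < q * M) :
    foldCoord M q (t + 1) = foldCoord M q t + 1 := by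
  rw [foldCoord, foldCoord, if_pos ht, ZMod.val_add_one_eq]
  rcases Nat.lt_or_ge (t.val + 1) (q * M) with h | h
  · rw [Nat.mod_eq_of_lt (by omega), if_pos h]; push_cast; rfl
  · have e : t.val + 1 = q * M := by omega
    have e' : ((t.val : ZMod M) + 1) = 0 := by
      rw [← Nat.cast_one, ← Nat.cast_add, e]; simp
    rw [e', e]
    split_ifs with h'
    · rw [hN] at h' ⊢
      rcases Nat.eq_zero_or_pos r with hr | hr
      · simp [hr]
      · rw [Nat.mod_eq_of_lt (by omega)]; simp
    · rfl

theorem foldCoord_add_one_of_le [NeZero N] (hN : N = q * M + r) {t : ZMod N}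
    (ht : q * M ≤ t.val) : foldCoord M q (t + 1) = 0 := by
  have hlt := ZMod.val_lt t
  rcases Nat.lt_or_ge (t.val + 1) N with h | h
  · refine foldCoord_eq_zero_of_le ?_
    rw [ZMod.val_add_one_eq, Nat.mod_eq_of_lt h]
    omega
  · have : (t + 1).val = 0 := by
      rw [ZMod.val_add_one_eq, show t.val + 1 = N by omega, Nat.mod_self]
    simp [foldCoord, this]

/-- A step can change the block only by arriving at position 0, that is, in the skeleton of a block.
-/
theorem blockCoord_add_one [NeZero N] (hN : N = q * M + r) {t : ZMod N} (ht : t.val < q * M)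
    (h : foldCoord M q (t + 1) ≠ 0) : blockCoord M q (t + 1) = blockCoord M q t := by
  have h1 : (t + 1).val < q * M := by
    by_contra hcon
    exact h (foldCoord_eq_zero_of_le (not_lt.1 hcon))
  rw [foldCoord, if_pos h1] at h
  rw [blockCoord, blockCoord, if_pos h1, if_pos ht]
  have h2 : (t + 1).val = t.val + 1 := by
    rw [ZMod.val_add_one_eq]
    rcases Nat.lt_or_ge (t.val + 1) N with h | h'
    · exact Nat.mod_eq_of_lt h
    · exfalso
      have hlt := ZMod.val_lt t
      rw [ZMod.val_add_one_eq, show t.val + 1 = N by omega, Nat.mod_self] at h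
      simp at h
  rw [h2] at h ⊢
  rw [Ne, ZMod.natCast_eq_zero_iff] at h
  exact Nat.succ_div_of_not_dvd h

/-- The r leftover coordinates reuse the numbers of existing blocks, which requires r ≤ q. -/
theorem blockCoord_lt [NeZero N] (hN : N = q * M + r) (hr : r ≤ q) (t : ZMod N) :
    blockCoord M q t < q := by
  have hlt := ZMod.val_lt t
  rw [blockCoord]
  split_ifs with h
  · exact Nat.div_lt_of_lt_mul (by rwa [mul_comm])
  · omega

theorem val_unfoldCoord_aux [NeZero M] {b : ℕ} (hb : b < q) (y : ZMod M) :
    b * M + y.val < q * M := by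
  have := ZMod.val_lt y
  nlinarith [Nat.mul_le_mul_right M (Nat.succ_le_of_lt hb)]

theorem val_unfoldCoord [NeZero M] [NeZero N] (hN : N = q * M + r) {b : ℕ} (hb : b < q)
    (y : ZMod M) : (unfoldCoord N b y).val = b * M + y.val := by
  rw [unfoldCoord, ZMod.val_natCast_of_lt]
  have := val_unfoldCoord_aux hb y
  omega

theorem foldCoord_unfoldCoord [NeZero M] [NeZero N] (hN : N = q * M + r) {b : ℕ} (hb : b < q)
    (y : ZMod M) : foldCoord M q (unfoldCoord N b y) = y := by
  rw [foldCoord, val_unfoldCoord hN hb, if_pos (val_unfoldCoord_aux hb y)]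
  simp

theorem blockCoord_unfoldCoord [NeZero M] [NeZero N] (hN : N = q * M + r) {b : ℕ} (hb : b < q)
    (y : ZMod M) : blockCoord M q (unfoldCoord N b y) = b := by
  rw [blockCoord, val_unfoldCoord hN hb, if_pos (val_unfoldCoord_aux hb y), mul_comm,
    Nat.mul_add_div (NeZero.pos M), Nat.div_eq_of_lt (ZMod.val_lt y), add_zero]

theorem unfoldCoord_blockCoord [NeZero N] {t : ZMod N} (ht : t.val < q * M) :
    unfoldCoord N (blockCoord M q t) (foldCoord M q t) = t := by
  rw [blockCoord, foldCoord, if_pos ht, if_pos ht, unfoldCoord, ZMod.val_natCast, mul_comm,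
    Nat.div_add_mod, ZMod.natCast_zmod_val]

/-- Number and position are ambiguous, since leftover coordinates share them with first coordinates
of blocks. Recording whether t lies in a block resolves this; this binary choice per direction is
the 2^d in `sum_block_fold_le`. -/
theorem coord_ext [NeZero N] {t t' : ZMod N} (hb : blockCoord M q t = blockCoord M q t')
    (hf : foldCoord M q t = foldCoord M q t') (hlt : t.val < q * M ↔ t'.val < q * M) : t = t' := by
  by_cases ht : t.val < q * M
  · rw [← unfoldCoord_blockCoord ht, hb, hf, unfoldCoord_blockCoord (hlt.1 ht)]
  · have ht' : ¬ t'.val < q * M := fun h => ht (hlt.2 h)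
    rw [blockCoord, blockCoord, if_neg ht, if_neg ht'] at hb
    exact ZMod.val_injective N (by omega)

theorem val_lt_of_foldCoord_ne_zero {t : ZMod N} (h : foldCoord M q t ≠ 0) : t.val < q * M := by
  by_contra hcon
  exact h (foldCoord_eq_zero_of_le (not_lt.1 hcon))

variable {d : ℕ}

/-- The position of a site within its block. -/
def foldSite (M q : ℕ) (x : LatticeTorus d N) : LatticeTorus d M := fun i => foldCoord M q (x i)

/-- The number of the block of a site. -/
def blockSite (M q : ℕ) (x : LatticeTorus d N) : Fin d → ℕ := fun i => blockCoord M q (x i)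

/-- The site with given block number and given position within the block. -/
def unfoldSite (N : ℕ) (b : Fin d → ℕ) (y : LatticeTorus d M) : LatticeTorus d N :=
  fun i => unfoldCoord N (b i) (y i)

/-- The block numbers. -/
def blocks (d q : ℕ) : Finset (Fin d → ℕ) := Fintype.piFinset fun _ => Finset.range q

theorem mem_blocks {b : Fin d → ℕ} : b ∈ blocks d q ↔ ∀ i, b i < q := by simp [blocks]

theorem card_blocks : (blocks d q).card = q ^ d := by simp [blocks]

theorem blockSite_mem [NeZero N] (hN : N = q * M + r) (hr : r ≤ q) (x : LatticeTorus d N) :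
    blockSite M q x ∈ blocks d q :=
  mem_blocks.2 fun i => blockCoord_lt hN hr (x i)

variable [NeZero M] [NeZero N]

theorem foldSite_unfoldSite (hN : N = q * M + r) {b : Fin d → ℕ} (hb : b ∈ blocks d q)
    (y : LatticeTorus d M) : foldSite M q (unfoldSite N b y) = y :=
  funext fun i => foldCoord_unfoldCoord hN (mem_blocks.1 hb i) (y i)

theorem blockSite_unfoldSite (hN : N = q * M + r) {b : Fin d → ℕ} (hb : b ∈ blocks d q)
    (y : LatticeTorus d M) : blockSite M q (unfoldSite N b y) = b :=
  funext fun i => blockCoord_unfoldCoord hN (mem_blocks.1 hb i) (y i)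

theorem unfoldSite_blockSite {x : LatticeTorus d N} (hx : foldSite M q x ∉ skeleton d M) :
    unfoldSite N (blockSite M q x) (foldSite M q x) = x := by
  rw [mem_skeleton, not_exists] at hx
  exact funext fun i => unfoldCoord_blockCoord (val_lt_of_foldCoord_ne_zero (hx i))

/-- A sum over the sites is at most `2 ^ d` times the sum over blocks and positions. -/
theorem sum_block_fold_le (hN : N = q * M + r) (hr : r ≤ q)
    {F : (Fin d → ℕ) → LatticeTorus d M → ℝ} (hF : ∀ b y, 0 ≤ F b y) :
    ∑ x : LatticeTorus d N, F (blockSite M q x) (foldSite M q x) ≤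
      2 ^ d * ∑ b ∈ blocks d q, ∑ y, F b y := by
  classical
  let e : LatticeTorus d N → (Fin d → Bool) × ((Fin d → ℕ) × LatticeTorus d M) := fun x =>
    (fun i => decide ((x i).val < q * M), (blockSite M q x, foldSite M q x))
  have he : Function.Injective e := by
    intro x x' h
    simp only [e, Prod.mk.injEq] at h
    refine funext fun i => coord_ext (congrFun h.2.1 i) (congrFun h.2.2 i) ?_
    simpa using congrFun h.1 i
  calc ∑ x : LatticeTorus d N, F (blockSite M q x) (foldSite M q x)
      = ∑ z ∈ Finset.univ.image e, F z.2.1 z.2.2 := by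
        rw [Finset.sum_image he.injOn]
    _ ≤ ∑ z ∈ Finset.univ ×ˢ (blocks d q ×ˢ Finset.univ), F z.2.1 z.2.2 := by
        refine Finset.sum_le_sum_of_subset_of_nonneg ?_ fun _ _ _ => hF _ _
        intro z hz
        obtain ⟨x, -, rfl⟩ := Finset.mem_image.1 hz
        simp [e, blockSite_mem hN hr x]
    _ = _ := by
        rw [Finset.sum_product]
        simp [Finset.sum_product]

/-- A sum over the sites in the interior of a block is at most the sum over blocks and
positions. -/
theorem sum_block_fold_interior_le (hN : N = q * M + r) (hr : r ≤ q)
    {F : (Fin d → ℕ) → LatticeTorus d M → ℝ} (hF : ∀ b y, 0 ≤ F b y) :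
    ∑ x : LatticeTorus d N, (if foldSite M q x ∈ skeleton d M then 0 else
      F (blockSite M q x) (foldSite M q x)) ≤ ∑ b ∈ blocks d q, ∑ y, F b y := by
  classical
  let e : LatticeTorus d N → (Fin d → ℕ) × LatticeTorus d M := fun x =>
    (blockSite M q x, foldSite M q x)
  set S : Finset (LatticeTorus d N) := Finset.univ.filter fun x => foldSite M q x ∉ skeleton d M
    with hS
  have he : Set.InjOn e S := by
    intro x hx x' hx' h
    simp only [e, Prod.mk.injEq] at h
    have hx1 : foldSite M q x ∉ skeleton d M := by simpa [hS] using hx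
    have hx2 : foldSite M q x' ∉ skeleton d M := by simpa [hS] using hx'
    rw [← unfoldSite_blockSite hx1, ← unfoldSite_blockSite hx2, h.1, h.2]
  calc _ = ∑ x ∈ S, F (blockSite M q x) (foldSite M q x) := by
        rw [hS, Finset.sum_filter]
        exact Finset.sum_congr rfl fun x _ => by rw [ite_not]
    _ = ∑ z ∈ S.image e, F z.1 z.2 := by
        rw [Finset.sum_image he]
    _ ≤ ∑ z ∈ blocks d q ×ˢ Finset.univ, F z.1 z.2 := by
        refine Finset.sum_le_sum_of_subset_of_nonneg ?_ fun _ _ _ => hF _ _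
        intro z hz
        obtain ⟨x, -, rfl⟩ := Finset.mem_image.1 hz
        simp [e, blockSite_mem hN hr x]
    _ = _ := Finset.sum_product _ _ _

end Tiling

/-! ### Tiling a large torus by blocks: comparison of energies. -/

section Tiling

variable {M N q r d : ℕ} [NeZero N] {U : ℝ → ℝ} {A C : ℝ} {β : ℝ}

theorem foldSite_add_single (hN : N = q * M + r) {x : LatticeTorus d N} {i : Fin d}
    (hx : (x i).val < q * M) :
    foldSite M q (x + Pi.single i 1) = foldSite M q x + Pi.single i 1 := by
  ext j
  by_cases hj : j = i
  · subst hj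
    simp [foldSite, foldCoord_add_one hN hx]
  · simp [foldSite, Pi.single_eq_of_ne hj]

theorem foldSite_add_single_of_le (hN : N = q * M + r) {x : LatticeTorus d N} {i : Fin d}
    (hx : q * M ≤ (x i).val) : foldSite M q (x + Pi.single i 1) = foldSite M q x := by
  ext j
  by_cases hj : j = i
  · subst hj
    simp [foldSite, foldCoord_add_one_of_le hN hx, foldCoord_eq_zero_of_le hx]
  · simp [foldSite, Pi.single_eq_of_ne hj]

variable [NeZero M]

open Classical in
/-- The heights in the block `b` of a height field on the large torus, with the heights on the
skeleton replaced by the ones of `Φ`. -/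
noncomputable def blockField (Φ : LatticeTorus d M → ℝ) (ω : LatticeTorus d N → ℝ)
    (b : Fin d → ℕ) : LatticeTorus d M → ℝ :=
  fun y => if y ∈ skeleton d M then Φ y else ω (unfoldSite N b y)

theorem blockSite_add_single (hN : N = q * M + r) {x : LatticeTorus d N} {i : Fin d}
    (hx : (x i).val < q * M) (h : foldSite M q (x + Pi.single i 1) ∉ skeleton d M) :
    blockSite M q (x + Pi.single i 1) = blockSite M q x := by
  rw [mem_skeleton, not_exists] at h
  ext j
  by_cases hj : j = i
  · subst hj
    have := h j
    simp only [foldSite, Pi.add_apply, Pi.single_eq_same] at this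
    simp [blockSite, blockCoord_add_one hN hx this]
  · simp [blockSite, Pi.single_eq_of_ne hj]

variable {Φ : LatticeTorus d M → ℝ} {ω : LatticeTorus d N → ℝ}

/-- On the skeleton the block field is Φ for every b, so b has to be the block of x only off the
skeleton. Both endpoints of a bond between two blocks can thus be compared with one block field. -/
theorem sub_blockField_mem
    (hω : ∀ x, foldSite M q x ∈ skeleton d M → ω x - Φ (foldSite M q x) ∈ Set.Icc (0 : ℝ) 1)
    {x : LatticeTorus d N} {b : Fin d → ℕ}
    (hb : foldSite M q x ∉ skeleton d M → blockSite M q x = b) :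
    ω x - blockField Φ ω b (foldSite M q x) ∈ Set.Icc (0 : ℝ) 1 := by
  rw [blockField]
  split_ifs with h
  · exact hω x h
  · rw [← hb h, unfoldSite_blockSite h]; simp

theorem potential_add_le (h : QuadraticPotential U A C) {a s : ℝ} (hs : |s| ≤ 1) :
    U (a + s) ≤ 3 * C * (1 + a ^ 2) := by
  refine (h.upper _).trans ?_
  have h1 : s ^ 2 ≤ 1 := by
    rw [← sq_abs]; exact pow_le_one₀ (abs_nonneg s) hs
  have h2 : 1 + (a + s) ^ 2 ≤ 3 * (1 + a ^ 2) := by nlinarith [sq_nonneg (a - s)]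
  calc C * (1 + (a + s) ^ 2) ≤ C * (3 * (1 + a ^ 2)) :=
        mul_le_mul_of_nonneg_left h2 h.const_nonneg
    _ = _ := by ring

open Classical in
/-- The energy of a bond of the large torus is controlled by the one of its image in a block. -/
theorem potential_tiltedGradient_le (h : QuadraticPotential U A C) (hN : N = q * M + r)
    (u : Fin d → ℝ)
    (hω : ∀ x, foldSite M q x ∈ skeleton d M → ω x - Φ (foldSite M q x) ∈ Set.Icc (0 : ℝ) 1)
    (x : LatticeTorus d N) (i : Fin d) :
    U (tiltedGradient ω u x i) ≤
      (if foldSite M q x ∈ skeleton d M then 0 else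
        U (tiltedGradient (blockField Φ ω (blockSite M q x)) u (foldSite M q x) i)) +
      (3 * C + C * (1 + (1 + ∑ j, |u j|) ^ 2)) *
        (if foldSite M q x ∈ skeleton d M ∨ foldSite M q x + Pi.single i 1 ∈ skeleton d M then
          1 + tiltedGradient (blockField Φ ω (blockSite M q x)) u (foldSite M q x) i ^ 2
          else 0) := by
  have hC := h.const_nonneg
  have h1 := sub_blockField_mem hω (x := x) fun _ => rfl
  have hsum : |u i| ≤ ∑ j, |u j| :=
    Finset.single_le_sum (f := fun j => |u j|) (fun _ _ => abs_nonneg _) (Finset.mem_univ i)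
  set a := tiltedGradient (blockField Φ ω (blockSite M q x)) u (foldSite M q x) i with ha
  have hU := h.nonneg a
  have hD : 0 ≤ C * (1 + (1 + ∑ j, |u j|) ^ 2) := by positivity
  -- If the i-th coordinate lies in a block, the bond folds to a bond of the small torus: its
  -- gradient is unchanged away from the skeleton and changes by at most 1 near it. Otherwise both
  -- endpoints fold to the same skeleton site, and the gradient itself is at most 1 before the tilt.
  rcases Nat.lt_or_ge (x i).val (q * M) with hx | hx
  · have h2 := sub_blockField_mem hω (x := x + Pi.single i 1)
      fun hs => blockSite_add_single hN hx hs
    rw [foldSite_add_single hN hx] at h2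
    set s := ω (x + Pi.single i 1) - blockField Φ ω (blockSite M q x)
      (foldSite M q x + Pi.single i 1) -
      (ω x - blockField Φ ω (blockSite M q x) (foldSite M q x)) with hs
    have has : tiltedGradient ω u x i = a + s := by
      rw [ha, hs]; simp only [tiltedGradient, torusGradient]; ring
    have hs1 : |s| ≤ 1 := by
      rw [abs_le]; constructor <;> linarith [h1.1, h1.2, h2.1, h2.2]
    by_cases ht : foldSite M q x ∈ skeleton d M ∨ foldSite M q x + Pi.single i 1 ∈ skeleton d M
    · rw [if_pos ht, has]
      have h3 := potential_add_le (a := a) h hs1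
      have h4 : 0 ≤ C * (1 + (1 + ∑ j, |u j|) ^ 2) * (1 + a ^ 2) := by positivity
      have h5 : 0 ≤ (if foldSite M q x ∈ skeleton d M then 0 else U a) := by
        split_ifs <;> simp [hU]
      linarith
    · rw [if_neg ht, mul_zero, add_zero]
      rw [not_or] at ht
      rw [if_neg ht.1, has]
      have e1 : ω x = blockField Φ ω (blockSite M q x) (foldSite M q x) := by
        rw [blockField, if_neg ht.1, unfoldSite_blockSite ht.1]
      have e2 : ω (x + Pi.single i 1) = blockField Φ ω (blockSite M q x)
          (foldSite M q x + Pi.single i 1) := by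
        have ht2 := ht.2
        rw [← foldSite_add_single hN hx] at ht2
        rw [blockField, if_neg ht.2, ← blockSite_add_single hN hx ht2,
          ← foldSite_add_single hN hx, unfoldSite_blockSite ht2]
      rw [hs, e1, e2]; simp
  · have hsk : foldSite M q x ∈ skeleton d M :=
      mem_skeleton.2 ⟨i, foldCoord_eq_zero_of_le hx⟩
    have e := foldSite_add_single_of_le hN hx
    have h3 := hω x hsk
    have h4 := hω (x + Pi.single i 1) (by rwa [e])
    rw [e] at h4
    rw [if_pos hsk, if_pos (Or.inl hsk), zero_add]
    have h5 : |tiltedGradient ω u x i| ≤ 1 + ∑ j, |u j| := by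
      refine (abs_add_le _ _).trans (add_le_add ?_ hsum)
      rw [torusGradient, abs_le]
      constructor <;> linarith [h3.1, h3.2, h4.1, h4.2]
    have h6 : U (tiltedGradient ω u x i) ≤ C * (1 + (1 + ∑ j, |u j|) ^ 2) := by
      refine (h.upper _).trans (mul_le_mul_of_nonneg_left ?_ hC)
      rw [add_le_add_iff_left, ← sq_abs]
      exact pow_le_pow_left₀ (abs_nonneg _) h5 2
    nlinarith [mul_nonneg (add_nonneg (mul_nonneg (by norm_num : (0 : ℝ) ≤ 3) hC) hD)
      (sq_nonneg a)]

/-- The energy of a height field on the large torus is controlled by the energies of its blocks. -/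
theorem torusHamiltonian_le_sum_blocks (h : QuadraticPotential U A C) (hN : N = q * M + r)
    (hr : r ≤ q) (u : Fin d → ℝ)
    (hω : ∀ x, foldSite M q x ∈ skeleton d M → ω x - Φ (foldSite M q x) ∈ Set.Icc (0 : ℝ) 1) :
    torusHamiltonian U ω u ≤ ∑ b ∈ blocks d q, (torusHamiltonian U (blockField Φ ω b) u +
      2 ^ d * (3 * C + C * (1 + (1 + ∑ j, |u j|) ^ 2)) * skeletonEnergy (blockField Φ ω b) u) := by
  classical
  have hC := h.const_nonneg
  set L := 3 * C + C * (1 + (1 + ∑ j, |u j|) ^ 2) with hL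
  have hL0 : 0 ≤ L := by positivity
  set F : (Fin d → ℕ) → LatticeTorus d M → ℝ := fun b y =>
    ∑ i, U (tiltedGradient (blockField Φ ω b) u y i) with hF
  set G : (Fin d → ℕ) → LatticeTorus d M → ℝ := fun b y =>
    ∑ i, if y ∈ skeleton d M ∨ y + Pi.single i 1 ∈ skeleton d M then
      1 + tiltedGradient (blockField Φ ω b) u y i ^ 2 else 0 with hG
  have hF0 : ∀ b y, 0 ≤ F b y := fun b y => Finset.sum_nonneg fun i _ => h.nonneg _
  have hG0 : ∀ b y, 0 ≤ G b y := fun b y => Finset.sum_nonneg fun i _ => by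
    split_ifs <;> positivity
  have h1 := sum_block_fold_interior_le hN hr hF0
  have h2 := sum_block_fold_le hN hr hG0
  calc torusHamiltonian U ω u
      ≤ ∑ x, ((if foldSite M q x ∈ skeleton d M then 0 else
          F (blockSite M q x) (foldSite M q x)) +
          L * G (blockSite M q x) (foldSite M q x)) := by
        rw [torusHamiltonian_eq_sum]
        refine Finset.sum_le_sum fun x _ => ?_
        refine (Finset.sum_le_sum fun i _ => potential_tiltedGradient_le h hN u hω x i).trans ?_
        rw [Finset.sum_add_distrib, ← Finset.mul_sum]
        refine add_le_add (le_of_eq ?_) le_rfl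
        split_ifs <;> simp [hF]
    _ ≤ ∑ b ∈ blocks d q, ∑ y, F b y + L * (2 ^ d * ∑ b ∈ blocks d q, ∑ y, G b y) := by
        rw [Finset.sum_add_distrib, ← Finset.mul_sum]
        gcongr
    _ = _ := by
        rw [Finset.sum_add_distrib]
        congr 1
        rw [← Finset.mul_sum, ← mul_assoc, mul_comm L]
        rfl

end Tiling

/-! ### Tiling a large torus by blocks: comparison of partition functions. -/

section Tiling

variable {M N q r d : ℕ} [NeZero M] {U : ℝ → ℝ} {A C : ℝ} {β : ℝ}

theorem measurable_blockField (Φ : LatticeTorus d M → ℝ) (b : Fin d → ℕ) :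
    Measurable fun ω : LatticeTorus d N → ℝ => blockField Φ ω b := by
  classical
  refine measurable_pi_iff.2 fun y => ?_
  unfold blockField
  split_ifs
  · exact measurable_const
  · exact measurable_pi_apply _

variable [NeZero N]

theorem unfoldSite_injective (hN : N = q * M + r) {b : Fin d → ℕ} (hb : b ∈ blocks d q) :
    Function.Injective (unfoldSite (M := M) N b) := fun y y' h => by
  rw [← foldSite_unfoldSite hN hb y, h, foldSite_unfoldSite hN hb y']

/-- The integral of a function of one block over the heights in the interior of this block. -/
theorem lmarginal_comp_blockField (hN : N = q * M + r) {b : Fin d → ℕ} (hb : b ∈ blocks d q)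
    {I : (LatticeTorus d M → ℝ) → ENNReal} (hI : Measurable I) (Φ : LatticeTorus d M → ℝ)
    (ω : LatticeTorus d N → ℝ) :
    (∫⋯∫⁻_((skeleton d M)ᶜ.image (unfoldSite N b)), fun ω => I (blockField Φ ω b)) ω =
      (∫⋯∫⁻_(skeleton d M)ᶜ, I) Φ := by
  classical
  let f : (LatticeTorus d M → ℝ) → ENNReal := fun φ =>
    I fun y => if y ∈ skeleton d M then Φ y else φ y
  have hf : Measurable f := by
    refine hI.comp (measurable_pi_iff.2 fun y => ?_)
    split_ifs
    · exact measurable_const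
    · exact measurable_pi_apply _
  have h1 := lmarginal_image (μ := fun _ : LatticeTorus d N => (volume : Measure ℝ))
    (unfoldSite_injective (M := M) hN hb) (skeleton d M)ᶜ hf ω
  have h2 : (fun ω : LatticeTorus d N → ℝ => I (blockField Φ ω b)) =
      f ∘ fun ω : LatticeTorus d N → ℝ => fun y => ω (unfoldSite N b y) := by
    ext ω
    rfl
  rw [h2]
  refine h1.trans ?_
  simp only [MeasureTheory.lmarginal]
  refine lintegral_congr fun z => ?_
  simp only [f]
  congr 1
  ext y
  by_cases hy : y ∈ skeleton d M <;> simp [Function.updateFinset, hy]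

theorem dependsOn_blockField (hN : N = q * M + r) (Φ : LatticeTorus d M → ℝ)
    {I : (LatticeTorus d M → ℝ) → ENNReal} {b b' : Fin d → ℕ} (hb : b ∈ blocks d q)
    (hb' : b' ∈ blocks d q) (hne : b ≠ b') :
    DependsOn (fun ω : LatticeTorus d N → ℝ => I (blockField Φ ω b))
      (↑((skeleton d M)ᶜ.image (unfoldSite N b')))ᶜ := by
  intro ω ω' h
  simp only
  congr 1
  ext y
  rw [blockField, blockField]
  split_ifs
  · rfl
  · refine h _ fun hmem => ?_
    obtain ⟨y', -, e⟩ := Finset.mem_image.1 (Finset.mem_coe.1 hmem)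
    apply hne
    rw [← blockSite_unfoldSite hN hb y, ← e, blockSite_unfoldSite hN hb']

/-- The partition function of a large torus is at least the product of the constrained partition
functions of the blocks. -/
theorem pow_lmarginal_skeleton_le [NeZero d] (h : QuadraticPotential U A C) (hβ : 0 < β)
    (hN : N = q * M + r) (hr : r ≤ q) (u : Fin d → ℝ) {Φ : LatticeTorus d M → ℝ} (hΦ : Φ 0 = 0) :
    ((∫⋯∫⁻_(skeleton d M)ᶜ, fun φ => ENNReal.ofReal (Real.exp
      (-(β * (2 ^ d * (3 * C + C * (1 + (1 + ∑ j, |u j|) ^ 2))) * skeletonEnergy φ u))) *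
        fieldWeight U β u φ) Φ) ^ q ^ d ≤ pinnedIntegral (N := N) (fieldWeight U β u) := by
  classical
  set L := 2 ^ d * (3 * C + C * (1 + (1 + ∑ j, |u j|) ^ 2)) with hL
  set I : (LatticeTorus d M → ℝ) → ENNReal := fun φ =>
    ENNReal.ofReal (Real.exp (-(β * L * skeletonEnergy φ u))) * fieldWeight U β u φ with hI
  have hIm : Measurable I := measurable_pinned_exp (measurable_fieldWeight h.continuous β u)
    ((measurable_skeletonEnergy u).const_mul _)
  set X : (Fin d → ℕ) → Finset (LatticeTorus d N) :=
    fun b => (skeleton d M)ᶜ.image (unfoldSite N b) with hX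
  set D := (blocks d q).biUnion X with hD
  have hDmem : ∀ x : LatticeTorus d N, x ∈ D ↔ foldSite M q x ∉ skeleton d M := by
    intro x
    simp only [hD, hX, Finset.mem_biUnion, Finset.mem_image, Finset.mem_compl]
    constructor
    · rintro ⟨b, hb, y, hy, rfl⟩
      rwa [foldSite_unfoldSite hN hb]
    · intro hx
      exact ⟨_, blockSite_mem hN hr x, _, hx, unfoldSite_blockSite hx⟩
  have h0 : (0 : LatticeTorus d N) ∉ D := by
    rw [hDmem, not_not]
    exact mem_skeleton.2 ⟨0, by simp [foldSite]⟩
  set R := Finset.univ.erase (0 : LatticeTorus d N) \ D with hR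
  have hRD : Finset.univ.erase (0 : LatticeTorus d N) = R ∪ D := by
    rw [hR, Finset.sdiff_union_of_subset]
    intro x hx
    simp only [Finset.mem_erase, Finset.mem_univ, and_true]
    rintro rfl
    exact h0 hx
  have hdisj : Disjoint R D := Finset.sdiff_disjoint
  -- The heights outside the block interiors are confined to windows of length one above the copies
  -- of Φ. The windows have total mass 1, so the restriction costs only the energy at the skeletons;
  -- given them, the blocks decouple.
  set P : (LatticeTorus d N → ℝ) → ENNReal := fun ω => ∏ x ∈ R,
    Set.indicator (Set.Icc (Φ (foldSite M q x)) (Φ (foldSite M q x) + 1)) 1 (ω x) with hP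
  have hPm : Measurable P := Finset.measurable_prod _ fun x _ =>
    (measurable_one.indicator measurableSet_Icc).comp (measurable_pi_apply x)
  have hPdep : DependsOn P (↑D)ᶜ := by
    intro ω ω' hω
    refine Finset.prod_congr rfl fun x hx => ?_
    rw [hω x fun hx' => (Finset.mem_sdiff.1 hx).2 (Finset.mem_coe.1 hx')]
  set J : (LatticeTorus d N → ℝ) → ENNReal := fun ω =>
    ∏ b ∈ blocks d q, I (blockField Φ ω b) with hJ
  have hJm1 : ∀ b, Measurable fun ω : LatticeTorus d N → ℝ => I (blockField Φ ω b) := fun b =>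
    hIm.comp (measurable_blockField Φ b)
  have hJm : Measurable J := Finset.measurable_prod _ fun b _ => hJm1 b
  have hJint : ∀ ω, (∫⋯∫⁻_D, J) ω = ((∫⋯∫⁻_(skeleton d M)ᶜ, I) Φ) ^ q ^ d := by
    intro ω
    rw [hD, hJ, lmarginal_biUnion_prod (blocks d q) X (fun b ω => I (blockField Φ ω b)) hJm1,
      Finset.prod_congr rfl fun b hb => lmarginal_comp_blockField hN hb hIm Φ ω,
      Finset.prod_const, card_blocks]
    · intro b hb b' hb' hne
      refine Finset.disjoint_left.2 fun x hx hx' => hne ?_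
      obtain ⟨y, -, rfl⟩ := Finset.mem_image.1 hx
      obtain ⟨y', -, e⟩ := Finset.mem_image.1 hx'
      rw [← blockSite_unfoldSite hN hb y, ← e, blockSite_unfoldSite hN hb']
    · exact fun b hb b' hb' hne => dependsOn_blockField hN Φ hb hb' hne
  have hPint : (∫⋯∫⁻_R, P) (0 : LatticeTorus d N → ℝ) = 1 := by
    rw [hP, lmarginal_prod_single R (fun x => Set.indicator (Set.Icc (Φ (foldSite M q x))
      (Φ (foldSite M q x) + 1)) 1) fun x => measurable_one.indicator measurableSet_Icc]
    refine Finset.prod_eq_one fun x _ => ?_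
    rw [lintegral_indicator_one measurableSet_Icc]; simp
  calc ((∫⋯∫⁻_(skeleton d M)ᶜ, I) Φ) ^ q ^ d
      = (∫⋯∫⁻_R, fun ω => P ω * (∫⋯∫⁻_D, J) ω) 0 := by
        simp only [hJint]
        simp only [mul_comm (P _)]
        rw [lmarginal_const_mul hPm, hPint, mul_one]
    _ = pinnedIntegral (N := N) fun ω => P ω * J ω := by
        rw [pinnedIntegral, hRD, lmarginal_union _ (fun ω => P ω * J ω) (hPm.mul hJm) hdisj,
          lmarginal_mul_of_dependsOn hJm hPdep]
    _ ≤ _ := by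
        refine lmarginal_mono_at _ _ fun ω hω => ?_
        have hω0 : ω 0 = 0 := hω 0 (by simp)
        by_cases hall : ∀ x ∈ R,
            ω x ∈ Set.Icc (Φ (foldSite M q x)) (Φ (foldSite M q x) + 1)
        · have hall' : ∀ x, foldSite M q x ∈ skeleton d M →
              ω x - Φ (foldSite M q x) ∈ Set.Icc (0 : ℝ) 1 := by
            intro x hx
            by_cases hx0 : x = 0
            · have : foldSite M q (0 : LatticeTorus d N) = 0 := by
                ext i; simp [foldSite]
              rw [hx0, hω0, this, hΦ]; simp
            · have hxR : x ∈ R := by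
                rw [hR, Finset.mem_sdiff, hDmem, not_not]
                exact ⟨by simpa using hx0, hx⟩
              have := hall x hxR
              constructor <;> linarith [this.1, this.2]
          have hP1 : P ω = 1 := Finset.prod_eq_one fun x hx => by
            rw [Set.indicator_of_mem (hall x hx)]; rfl
          rw [hP1, one_mul]
          have hle := torusHamiltonian_le_sum_blocks h hN hr u hall'
          have hJ1 : J ω = ENNReal.ofReal (Real.exp (∑ b ∈ blocks d q,
              (-(β * L * skeletonEnergy (blockField Φ ω b) u) +
                -β * torusHamiltonian U (blockField Φ ω b) u))) := by
            rw [Real.exp_sum, ENNReal.ofReal_prod_of_nonneg fun _ _ => (Real.exp_pos _).le]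
            refine Finset.prod_congr rfl fun b _ => ?_
            rw [Real.exp_add, ENNReal.ofReal_mul (Real.exp_pos _).le]
            rfl
          rw [hJ1, fieldWeight]
          refine ENNReal.ofReal_le_ofReal (Real.exp_le_exp.2 ?_)
          have hle' := mul_le_mul_of_nonneg_left hle hβ.le
          rw [← hL, Finset.mul_sum] at hle'
          rw [neg_mul, le_neg, ← Finset.sum_neg_distrib]
          refine hle'.trans (Finset.sum_le_sum fun b _ => le_of_eq ?_)
          ring
        · push Not at hall
          obtain ⟨x, hx, hx'⟩ := hall
          have hP0 : P ω = 0 := Finset.prod_eq_zero hx (Set.indicator_of_notMem hx' _)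
          rw [hP0, zero_mul]
          exact zero_le

end Tiling

/-! ### Existence of the thermodynamic limit. -/

/-- An almost superadditivity criterion for convergence. -/
theorem exists_tendsto_of_almost_superadditive (d : ℕ) {a : ℕ → ℝ} {P K : ℝ}
    (hP : ∀ n, |a n| ≤ P)
    (h : ∀ m n : ℕ, (n + 1) % (m + 1) ≤ (n + 1) / (m + 1) →
      ((((n + 1) / (m + 1) * (m + 1) : ℕ) : ℝ) / ((n + 1 : ℕ) : ℝ)) ^ d *
        (a m - K / ((m + 1 : ℕ) : ℝ)) ≤ a n) :
    ∃ l, Tendsto a atTop (𝓝 l) := by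
  have hup : IsBoundedUnder (· ≤ ·) atTop a :=
    isBoundedUnder_of ⟨P, fun n => (le_abs_self _).trans (hP n)⟩
  have hlow : IsBoundedUnder (· ≥ ·) atTop a :=
    isBoundedUnder_of ⟨-P, fun n => (abs_le.1 (hP n)).1⟩
  have hone : Tendsto (fun n : ℕ => ((n + 1 : ℕ) : ℝ)) atTop atTop :=
    tendsto_natCast_atTop_atTop.comp (tendsto_add_atTop_nat 1)
  -- For fixed m the fraction of the large torus covered by blocks tends to 1. Letting m tend to
  -- infinity afterwards bounds the limsup by the liminf.
  have h1 : ∀ m : ℕ, a m - K / ((m + 1 : ℕ) : ℝ) ≤ liminf a atTop := by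
    intro m
    have ht : Tendsto (fun n : ℕ => (((n + 1) / (m + 1) * (m + 1) : ℕ) : ℝ) / ((n + 1 : ℕ) : ℝ))
        atTop (𝓝 1) := by
      have h2 : Tendsto (fun n : ℕ => 1 - ((m + 1 : ℕ) : ℝ) / ((n + 1 : ℕ) : ℝ)) atTop (𝓝 1) := by
        simpa using (tendsto_const_nhds (x := (1 : ℝ))).sub (hone.const_div_atTop ((m + 1 : ℕ) : ℝ))
      refine tendsto_of_tendsto_of_tendsto_of_le_of_le h2 tendsto_const_nhds ?_ ?_
      · intro n
        have hn : (0 : ℝ) < ((n + 1 : ℕ) : ℝ) := by positivity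
        change 1 - ((m + 1 : ℕ) : ℝ) / ((n + 1 : ℕ) : ℝ) ≤ _
        rw [one_sub_div hn.ne']
        refine div_le_div_of_nonneg_right ?_ hn.le
        rw [sub_le_iff_le_add]
        have := Nat.div_add_mod (n + 1) (m + 1)
        have h3 := Nat.mod_lt (n + 1) (show 0 < m + 1 by omega)
        rw [mul_comm] at this
        exact_mod_cast (by omega :
          n + 1 ≤ (n + 1) / (m + 1) * (m + 1) + (m + 1))
      · intro n
        exact div_le_one_of_le₀ (Nat.cast_le.2 (Nat.div_mul_le_self _ _)) (Nat.cast_nonneg _)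
    have ht2 := (ht.pow d).mul_const (a m - K / ((m + 1 : ℕ) : ℝ))
    rw [one_pow, one_mul] at ht2
    rw [← ht2.liminf_eq]
    refine liminf_le_liminf ?_ ht2.isBoundedUnder_ge hup.isCoboundedUnder_ge
    -- For such n the quotient is at least m + 1 and hence exceeds the remainder.
    filter_upwards [eventually_ge_atTop ((m + 1) * (m + 1))] with n hn
    refine h m n ?_
    have h3 := Nat.mod_lt (n + 1) (show 0 < m + 1 by omega)
    have h4 : m + 1 ≤ (n + 1) / (m + 1) := by
      rw [Nat.le_div_iff_mul_le (show 0 < m + 1 by omega)]; omega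
    exact h3.le.trans h4
  refine ⟨liminf a atTop, tendsto_of_le_liminf_of_limsup_le le_rfl ?_ hup hlow⟩
  have ht : Tendsto (fun m : ℕ => liminf a atTop + K / ((m + 1 : ℕ) : ℝ)) atTop
      (𝓝 (liminf a atTop)) := by
    simpa using (tendsto_const_nhds (x := liminf a atTop)).add (hone.const_div_atTop K)
  rw [← ht.limsup_eq]
  refine limsup_le_limsup (Eventually.of_forall fun m => ?_) hlow.isCoboundedUnder_le
    ht.isBoundedUnder_le
  have := h1 m
  change a m ≤ liminf a atTop + K / ((m + 1 : ℕ) : ℝ)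
  linarith

section Torus

variable {d : ℕ} {U : ℝ → ℝ} {A C : ℝ} {β : ℝ}

/-- The logarithm of the partition function. -/
noncomputable def logPartition (d N : ℕ) [NeZero N] (U : ℝ → ℝ) (β : ℝ) (u : Fin d → ℝ) : ℝ :=
  Real.log (pinnedIntegral (N := N) (fieldWeight U β u)).toReal

theorem card_latticeTorus (d N : ℕ) [NeZero N] : Fintype.card (LatticeTorus d N) = N ^ d := by
  simp [ZMod.card]

theorem le_logPartition_iff [NeZero d] (h : QuadraticPotential U A C) (hβ : 0 < β)
    (u : Fin d → ℝ) {N : ℕ} [NeZero N] {x : ℝ} : x ≤ logPartition d N U β u ↔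
      ENNReal.ofReal (Real.exp x) ≤ pinnedIntegral (N := N) (fieldWeight U β u) := by
  have h1 := pinnedIntegral_fieldWeight_ne_top (N := N) h hβ u
  have h2 := pinnedIntegral_fieldWeight_ne_zero (N := N) h hβ u
  rw [logPartition, Real.le_log_iff_exp_le (ENNReal.toReal_pos h2 h1),
    ENNReal.ofReal_le_iff_le_toReal h1]

theorem ofReal_exp_logPartition [NeZero d] (h : QuadraticPotential U A C) (hβ : 0 < β)
    (u : Fin d → ℝ) {N : ℕ} [NeZero N] : ENNReal.ofReal (Real.exp (logPartition d N U β u)) =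
      pinnedIntegral (N := N) (fieldWeight U β u) := by
  have h1 := pinnedIntegral_fieldWeight_ne_top (N := N) h hβ u
  have h2 := pinnedIntegral_fieldWeight_ne_zero (N := N) h hβ u
  rw [logPartition, Real.exp_log (ENNReal.toReal_pos h2 h1), ENNReal.ofReal_toReal h1]

/-- The logarithm of the partition function is at most proportional to the volume. -/
theorem exists_abs_logPartition_le [NeZero d] (h : QuadraticPotential U A C) (hβ : 0 < β)
    (u : Fin d → ℝ) : ∃ P : ℝ, ∀ (N : ℕ) [NeZero N],
      |logPartition d N U β u| ≤ P * (N : ℝ) ^ d := by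
  set γ := Real.sqrt (Real.pi / (β * A)) with hγ
  have hA := h.pos
  have hγ0 : 0 < γ := Real.sqrt_pos.2 (by positivity)
  set K := β * (C * ∑ i, (1 + (1 + |u i|) ^ 2)) with hK
  have hK0 : 0 ≤ K := mul_nonneg hβ.le (mul_nonneg h.const_nonneg
    (Finset.sum_nonneg fun i _ => by positivity))
  refine ⟨K + |Real.log γ|, fun N _ => ?_⟩
  have h1 := exp_le_pinnedIntegral (N := N) h hβ u
  rw [← le_logPartition_iff h hβ, card_latticeTorus] at h1
  push_cast at h1
  rw [← hK] at h1
  have h2 := ((lmarginal_mono (fieldWeight_le_gaussian h hβ u) 0).trans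
    (pinnedIntegral_gaussian_le (N := N) (mul_pos hβ h.pos) u))
  change pinnedIntegral _ ≤ _ at h2
  rw [← ofReal_exp_logPartition h hβ, ← hγ, ← ENNReal.ofReal_pow hγ0.le,
    ENNReal.ofReal_le_ofReal_iff (by positivity)] at h2
  have h3 := Real.log_le_log (Real.exp_pos _) h2
  rw [Real.log_exp, Real.log_pow] at h3
  have h4 : ((Finset.univ.erase (0 : LatticeTorus d N)).card : ℝ) ≤ (N : ℝ) ^ d := by
    have := Finset.card_le_univ (Finset.univ.erase (0 : LatticeTorus d N))
    rw [card_latticeTorus] at this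
    exact_mod_cast this
  have h5 : ((Finset.univ.erase (0 : LatticeTorus d N)).card : ℝ) * Real.log γ ≤
      (N : ℝ) ^ d * |Real.log γ| :=
    (mul_le_mul_of_nonneg_left (le_abs_self _) (Nat.cast_nonneg _)).trans
      (mul_le_mul_of_nonneg_right h4 (abs_nonneg _))
  have h6 : 0 ≤ (N : ℝ) ^ d * |Real.log γ| := by positivity
  have h7 : 0 ≤ K * (N : ℝ) ^ d := by positivity
  rw [abs_le]
  constructor <;> linarith

/-- The partition functions are almost supermultiplicative. -/
theorem exists_logPartition_superadditive [NeZero d] (h : QuadraticPotential U A C) (hβ : 0 < β)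
    (u : Fin d → ℝ) : ∃ K : ℝ, ∀ (M N q r : ℕ) [NeZero M] [NeZero N], N = q * M + r → r ≤ q →
      (q : ℝ) ^ d * (logPartition d M U β u - K * (M : ℝ) ^ d / M) ≤ logPartition d N U β u := by
  have hC := h.const_nonneg
  -- The weight l of the skeleton energy is the one that `pow_lmarginal_skeleton_le` charges for
  -- gluing the blocks.
  obtain ⟨K, hK, hKM⟩ := exists_skeleton_heights h hβ u
    (l := β * (2 ^ d * (3 * C + C * (1 + (1 + ∑ j, |u j|) ^ 2)))) (by positivity)
  refine ⟨K * d, fun M N q r _ _ hN hr => ?_⟩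
  obtain ⟨Φ, hΦ, hle⟩ := hKM M
  have h1 := (pow_le_pow_left' hle (q ^ d)).trans (pow_lmarginal_skeleton_le h hβ hN hr u hΦ)
  rw [← ofReal_exp_logPartition h hβ, ← ENNReal.ofReal_mul (Real.exp_pos _).le, ← Real.exp_add,
    ← ENNReal.ofReal_pow (Real.exp_pos _).le, ← Real.exp_nat_mul, ← le_logPartition_iff h hβ]
    at h1
  refine le_trans ?_ h1
  push_cast
  refine mul_le_mul_of_nonneg_left ?_ (by positivity)
  have h2 := card_skeleton_mul_le d M
  rw [card_latticeTorus] at h2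
  have hM : (0 : ℝ) < M := by exact_mod_cast NeZero.pos M
  have h3 : ((skeleton d M).card : ℝ) ≤ d * (M : ℝ) ^ d / M := by
    rw [le_div_iff₀ hM]; exact_mod_cast h2
  have h4 := mul_le_mul_of_nonneg_left h3 hK
  have h5 : K * (d * (M : ℝ) ^ d / M) = K * d * (M : ℝ) ^ d / M := by ring
  linarith

/-- Existence of the thermodynamic limit. -/
theorem exists_tendsto_logPartition [NeZero d] (h : QuadraticPotential U A C) (hβ : 0 < β)
    (u : Fin d → ℝ) : ∃ l, Tendsto (fun n : ℕ => logPartition d (n + 1) U β u /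
      ((n + 1 : ℕ) : ℝ) ^ d) atTop (𝓝 l) := by
  obtain ⟨P, hP⟩ := exists_abs_logPartition_le h hβ u
  obtain ⟨K, hK⟩ := exists_logPartition_superadditive h hβ u
  refine exists_tendsto_of_almost_superadditive d (P := P) (K := K) (fun n => ?_)
    fun m n hmn => ?_
  · have hn : (0 : ℝ) < ((n + 1 : ℕ) : ℝ) ^ d := by positivity
    rw [abs_div, abs_of_pos hn, div_le_iff₀ hn]
    exact hP (n + 1)
  · have hn : (0 : ℝ) < ((n + 1 : ℕ) : ℝ) ^ d := by positivity
    have hm : (0 : ℝ) < ((m + 1 : ℕ) : ℝ) ^ d := by positivity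
    have h1 := hK (m + 1) (n + 1) _ _ (by rw [mul_comm]; exact (Nat.div_add_mod _ _).symm) hmn
    rw [div_pow, div_mul_eq_mul_div]
    refine div_le_div_of_nonneg_right (le_trans (le_of_eq ?_) h1) hn.le
    rw [Nat.cast_mul, mul_pow, mul_assoc]
    congr 1
    field_simp

end Torus

/-! ### Normalisation of the potential and conclusion. -/

namespace SmoothPotential

variable {U U₁ U₂ : ℝ → ℝ} {A B K : ℝ}

/-- Adding B makes the potential at least A s². The partition functions are all multiplied by the
same constant, which cancels in the surface tension. -/
theorem add_const (h : SmoothPotential U U₁ U₂ A B K) :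
    SmoothPotential (fun s => U s + B) U₁ U₂ A 0 K where
  hasDerivAt s := (h.hasDerivAt s).add_const B
  hasDerivAt' := h.hasDerivAt'
  continuous₂ := h.continuous₂
  abs_le := h.abs_le
  pos := h.pos
  lower s := by linarith [h.lower s]

theorem exists_quadraticPotential (h : SmoothPotential U U₁ U₂ A 0 K) :
    ∃ C, QuadraticPotential U A C := by
  have hK := h.bound_nonneg
  refine ⟨|U 0| + 2 * |U₁ 0| + K, h.continuous, h.pos, fun s => by simpa using h.lower s,
    fun s => ?_⟩
  have h1 := (convex_closedBall (0 : ℝ) |s|).norm_image_sub_le_of_norm_hasDerivWithin_le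
    (f := U) (f' := U₁) (C := |U₁ 0| + K * |s|) (fun x _ => (h.hasDerivAt x).hasDerivWithinAt)
    (fun x hx => (h.abs_deriv_le x).trans (by
      have : |x| ≤ |s| := by simpa using hx
      gcongr)) (Metric.mem_closedBall_self (abs_nonneg s))
    (show s ∈ Metric.closedBall (0 : ℝ) |s| by simp)
  rw [Real.norm_eq_abs, sub_zero, Real.norm_eq_abs] at h1
  have h2 := (le_abs_self _).trans h1
  have h3 := le_abs_self (U 0)
  have h4 : (|U₁ 0| + K * |s|) * |s| = |U₁ 0| * |s| + K * s ^ 2 := by rw [← sq_abs s]; ring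
  have h5 : |s| ≤ 2 * (1 + s ^ 2) := by rw [← sq_abs s]; nlinarith [sq_nonneg (|s| - 1)]
  have h6 := mul_le_mul_of_nonneg_left h5 (abs_nonneg (U₁ 0))
  nlinarith [mul_nonneg (abs_nonneg (U 0)) (sq_nonneg s)]

end SmoothPotential

section Torus

variable {d N : ℕ} [NeZero N]

theorem continuous_boltzmannWeight {U : ℝ → ℝ} (hU : Continuous U) (β : ℝ) (u : Fin d → ℝ) :
    Continuous (boltzmannWeight d N U β u) := by
  have h1 : Continuous (pinnedField (d := d) (N := N)) := by
    refine continuous_pi fun x => ?_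
    unfold pinnedField
    split_ifs
    · exact continuous_const
    · exact continuous_apply _
  have h2 := (continuous_torusHamiltonian hU u).comp h1
  exact Real.continuous_exp.comp (continuous_const.mul h2)

theorem lintegral_boltzmannWeight (U : ℝ → ℝ) (β : ℝ) (u : Fin d → ℝ) :
    ∫⁻ ψ, ENNReal.ofReal (boltzmannWeight d N U β u ψ) =
      pinnedIntegral (N := N) (fieldWeight U β u) :=
  lintegral_pinnedField (fieldWeight U β u)

theorem torusPartitionFunction_eq {U : ℝ → ℝ} (hU : Continuous U) (β : ℝ) (u : Fin d → ℝ) :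
    torusPartitionFunction d N U β u =
      (pinnedIntegral (N := N) (fieldWeight U β u)).toReal := by
  rw [torusPartitionFunction, integral_eq_lintegral_of_nonneg_ae
    (f := boltzmannWeight d N U β u) (Eventually.of_forall fun ψ => (Real.exp_pos _).le)
    (continuous_boltzmannWeight hU β u).aestronglyMeasurable, lintegral_boltzmannWeight]

theorem torusHamiltonian_add_const (U : ℝ → ℝ) (B : ℝ) (φ : LatticeTorus d N → ℝ)
    (u : Fin d → ℝ) : torusHamiltonian (fun s => U s + B) φ u =
      torusHamiltonian U φ u + Fintype.card (LatticeTorus d N) * (d * B) := by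
  simp [torusHamiltonian, Finset.sum_add_distrib]

theorem pinnedIntegral_eq_add_const {U : ℝ → ℝ} (hU : Continuous U) (β B : ℝ) (u : Fin d → ℝ) :
    pinnedIntegral (N := N) (fieldWeight U β u) =
      ENNReal.ofReal (Real.exp (β * (Fintype.card (LatticeTorus d N) * (d * B)))) *
        pinnedIntegral (N := N) (fieldWeight (fun s => U s + B) β u) := by
  have hU' : Continuous fun s => U s + B := hU.add continuous_const
  rw [← pinnedIntegral_const_mul (measurable_fieldWeight hU' β u)]
  congr 1
  ext φ
  rw [fieldWeight, fieldWeight, ← ENNReal.ofReal_mul (Real.exp_pos _).le, ← Real.exp_add,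
    torusHamiltonian_add_const]
  congr 2
  ring

variable [NeZero d] {U : ℝ → ℝ} {A B C β : ℝ}

theorem integrable_boltzmannWeight (hU : Continuous U)
    (h : QuadraticPotential (fun s => U s + B) A C) (hβ : 0 < β) (u : Fin d → ℝ) :
    Integrable (boltzmannWeight d N U β u) := by
  refine ⟨(continuous_boltzmannWeight hU β u).aestronglyMeasurable, ?_⟩
  rw [hasFiniteIntegral_iff_ofReal (f := boltzmannWeight d N U β u)
    (Eventually.of_forall fun ψ => (Real.exp_pos _).le),
    lintegral_boltzmannWeight, pinnedIntegral_eq_add_const hU β B]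
  exact ENNReal.mul_lt_top ENNReal.ofReal_lt_top
    (pinnedIntegral_fieldWeight_ne_top h hβ u).lt_top

theorem torusSurfaceTension_eq (hU : Continuous U)
    (h : QuadraticPotential (fun s => U s + B) A C) (hβ : 0 < β) (u : Fin d → ℝ) :
    torusSurfaceTension d N U β u =
      logPartition d N (fun s => U s + B) β 0 / (N : ℝ) ^ d -
        logPartition d N (fun s => U s + B) β u / (N : ℝ) ^ d := by
  have hpos : ∀ u : Fin d → ℝ,
      0 < (pinnedIntegral (N := N) (fieldWeight (fun s => U s + B) β u)).toReal := fun u =>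
    ENNReal.toReal_pos (pinnedIntegral_fieldWeight_ne_zero h hβ u)
      (pinnedIntegral_fieldWeight_ne_top h hβ u)
  rw [torusSurfaceTension, torusPartitionFunction_eq hU, torusPartitionFunction_eq hU,
    pinnedIntegral_eq_add_const hU β B u, pinnedIntegral_eq_add_const hU β B 0, ENNReal.toReal_mul,
    ENNReal.toReal_mul, ENNReal.toReal_ofReal (Real.exp_pos _).le,
    mul_div_mul_left _ _ (Real.exp_pos _).ne', Real.log_div (hpos u).ne' (hpos 0).ne',
    card_latticeTorus]
  simp only [logPartition]
  push_cast
  ring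

/-- Uniform strict concavity of the logarithm of the partition function of an even torus. -/
theorem add_le_logPartition (hN : 2 ∣ N) {U₁ U₂ : ℝ → ℝ} {K : ℝ}
    (hS : SmoothPotential U U₁ U₂ A 0 K) (hsymm : ∀ s, U (-s) = U s) (hβ : 0 < β) {κ : ℝ}
    (hκ0 : 0 ≤ κ)
    (hκ : ∀ (t : Fin d ⊕ Fin d → ℝ) j k, κ * sitePartition U β t ^ 2 ≤
      sitePartition U β t * (∫ s, U₁ (t j - s) * U₁ (t k - s) * siteWeight U β t s) -
        (∫ s, U₁ (t j - s) * siteWeight U β t s) * (∫ s, U₁ (t k - s) * siteWeight U β t s))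
    {a b : ℝ} (ha : 0 < a) (hb : 0 < b) (hab : a + b = 1) (u u' : Fin d → ℝ) :
    a * (logPartition d N U β u / (N : ℝ) ^ d) + b * (logPartition d N U β u' / (N : ℝ) ^ d) +
      β ^ 2 * κ / 2 * (a * b) * ∑ i, (u' i - u i) ^ 2 ≤
      logPartition d N U β (a • u + b • u') / (N : ℝ) ^ d := by
  obtain ⟨C, hC⟩ := hS.exists_quadraticPotential
  have h1 := pinnedIntegral_logConcave hN (NeZero.pos d) hS hsymm hβ hκ0 hκ ha hb hab u u'
  rw [← ofReal_exp_logPartition hC hβ u, ← ofReal_exp_logPartition hC hβ u',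
    ← ofReal_exp_logPartition hC hβ, ENNReal.ofReal_rpow_of_pos (Real.exp_pos _),
    ENNReal.ofReal_rpow_of_pos (Real.exp_pos _), ← ENNReal.ofReal_mul (by positivity),
    ← ENNReal.ofReal_mul (by positivity), ← Real.exp_mul, ← Real.exp_mul, ← Real.exp_add,
    ← Real.exp_add, ENNReal.ofReal_le_ofReal_iff (Real.exp_pos _).le, Real.exp_le_exp,
    card_latticeTorus] at h1
  have hNpos : (0 : ℝ) < (N : ℝ) ^ d := pow_pos (by exact_mod_cast NeZero.pos N) d
  rw [le_div_iff₀ hNpos]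
  push_cast at h1
  have e : (a * (logPartition d N U β u / (N : ℝ) ^ d) +
      b * (logPartition d N U β u' / (N : ℝ) ^ d) +
      β ^ 2 * κ / 2 * (a * b) * ∑ i, (u' i - u i) ^ 2) * (N : ℝ) ^ d =
      logPartition d N U β u * a + logPartition d N U β u' * b +
        β ^ 2 * κ / 2 * (a * b) * (N : ℝ) ^ d * ∑ i, (u' i - u i) ^ 2 := by
    field_simp
  linarith

end Torus

theorem theorem8p3 (d : ℕ) (hd : 1 ≤ d) (β : ℝ) (hβ : 0 < β)
    (U V g : ℝ → ℝ) (hV : ContDiff ℝ 2 V) (hg : ContDiff ℝ 2 g)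
    (hUVg : ∀ s, U s = V s + g s)
    -- `U` is symmetric and grows at least quadratically
    (hsymm : ∀ s, U (-s) = U s)
    (hA0 : ∃ A B : ℝ, 0 < A ∧ ∀ s, A * |s| ^ 2 - B ≤ U s)
    -- `V` is uniformly convex with bounded second derivative, `g` is a concave perturbation
    (C₀ C₁ C₂ : ℝ) (hC₁ : 0 < C₁) (hC₁₂ : C₁ < C₂) (hC₂₀ : C₂ < C₀)
    (hV'' : ∀ s, C₁ ≤ deriv (deriv V) s ∧ deriv (deriv V) s ≤ C₂)
    (hg'' : ∀ s, -C₀ ≤ deriv (deriv g) s ∧ deriv (deriv g) s ≤ 0)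
    -- the smallness condition on `β` and on the (finite) `L^q` norm of `g''`
    (hA2 : ∃ q : ℝ, 1 ≤ q ∧ MemLp (deriv (deriv g)) (ENNReal.ofReal q) volume ∧
      β ^ (1 / (2 * q)) * (eLpNorm (deriv (deriv g)) (ENNReal.ofReal q) volume).toReal <
        C₁ ^ ((3 : ℝ) / 2) / (2 * C₂ ^ ((q + 1) / (2 * q)) * (2 * (d : ℝ)) ^ (1 / (2 * q)))) :
    -- all the partition functions are finite
    (∀ (N : ℕ) (u : Fin d → ℝ), Integrable (boltzmannWeight d (N + 1) U β u) volume) ∧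
    -- the torus surface tensions converge, and their limit is strictly convex
    ∃ σ : (Fin d → ℝ) → ℝ,
      (∀ u : Fin d → ℝ,
        Tendsto (fun N : ℕ => torusSurfaceTension d (N + 1) U β u) atTop (𝓝 (σ u))) ∧
      StrictConvexOn ℝ Set.univ σ := by
  have : NeZero d := ⟨by omega⟩
  have hderiv : ∀ {f : ℝ → ℝ}, ContDiff ℝ 2 f → (∀ s, HasDerivAt f (deriv f s) s) ∧
      (∀ s, HasDerivAt (deriv f) (deriv (deriv f) s) s) ∧ Continuous (deriv (deriv f)) := by
    intro f hf
    have h1 : ContDiff ℝ 1 (deriv f) :=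
      ((contDiff_succ_iff_deriv (n := 1)).1 (by simpa [one_add_one_eq_two] using hf)).2.2
    exact ⟨fun s => (hf.differentiable (by norm_num) s).hasDerivAt,
      fun s => (h1.differentiable (by norm_num) s).hasDerivAt, h1.continuous_deriv le_rfl⟩
  obtain ⟨hV1, hV2, hVc⟩ := hderiv hV
  obtain ⟨hg1, hg2, hgc⟩ := hderiv hg
  obtain ⟨A, B, hA, hlower⟩ := hA0
  obtain ⟨q, hq, hm, hsmall⟩ := hA2
  have hS : SmoothPotential U (fun s => deriv V s + deriv g s)
      (fun s => deriv (deriv V) s + deriv (deriv g) s) A B (C₂ + C₀) :=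
    { hasDerivAt := fun s => by
        rw [show U = fun s => V s + g s from funext hUVg]
        exact (hV1 s).add (hg1 s)
      hasDerivAt' := fun s => (hV2 s).add (hg2 s)
      continuous₂ := hVc.add hgc
      abs_le := fun s => abs_le.2
        ⟨by linarith [(hV'' s).1, (hg'' s).1], by linarith [(hV'' s).2, (hg'' s).2]⟩
      pos := hA
      lower := fun s => by simpa using hlower s }
  have hW := hS.add_const
  obtain ⟨C, hQ⟩ := hW.exists_quadraticPotential
  -- Here n = 2d, the number of neighbours of a site, which is the source of 2d in (A2).
  obtain ⟨k₀, k₁, hk₁, hκ, hinc⟩ := exists_increment_lower_bound hβ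
    (show (0 : ℝ) < 2 * d by positivity) hV2 hg2 hgc hC₁ hC₁₂ hV'' (fun s => (hg'' s).2)
    hq hm hsmall
  set κ := k₁ / (β * (2 * d) * C₂) - k₀ / 2 with hκdef
  have hcov : ∀ (t : Fin d ⊕ Fin d → ℝ) j k,
      κ * sitePartition (fun s => U s + B) β t ^ 2 ≤
      sitePartition (fun s => U s + B) β t * (∫ s, (deriv V (t j - s) + deriv g (t j - s)) *
          (deriv V (t k - s) + deriv g (t k - s)) * siteWeight (fun s => U s + B) β t s) -
        (∫ s, (deriv V (t j - s) + deriv g (t j - s)) * siteWeight (fun s => U s + B) β t s) *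
        (∫ s, (deriv V (t k - s) + deriv g (t k - s)) * siteWeight (fun s => U s + B) β t s) := by
    intro t j k
    have : Nonempty (Fin d ⊕ Fin d) := ⟨j⟩
    have h1 := hW.covariance_ge hβ t (hC₁.trans hC₁₂)
      (fun s => by linarith [(hV'' s).2, (hg'' s).2]) hk₁ hinc j k
    have h2 : ((Fintype.card (Fin d ⊕ Fin d) : ℕ) : ℝ) = 2 * d := by
      rw [Fintype.card_sum, Fintype.card_fin]; push_cast; ring
    rwa [h2, ← hκdef] at h1
  choose l hl using fun u => exists_tendsto_logPartition (d := d) hQ hβ u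
  refine ⟨fun N u => integrable_boltzmannWeight hS.continuous hQ hβ u, fun u => l 0 - l u,
    fun u => ?_, convex_univ, ?_⟩
  · simp only [torusSurfaceTension_eq hS.continuous hQ hβ u]
    exact (hl 0).sub (hl u)
  · intro u _ u' _ hne a b ha hb hab
    -- Index k stands for side length k + 1, so these are the even side lengths 2n + 2.
    have hsub : Tendsto (fun n : ℕ => 2 * n + 1) atTop atTop :=
      tendsto_atTop_mono (fun n => (by omega : n ≤ 2 * n + 1)) tendsto_id
    have hle : a * l u + b * l u' + β ^ 2 * κ / 2 * (a * b) * ∑ i, (u' i - u i) ^ 2 ≤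
        l (a • u + b • u') := by
      refine le_of_tendsto_of_tendsto' (((((hl u).const_mul a).add
        ((hl u').const_mul b)).add_const _).comp hsub) ((hl (a • u + b • u')).comp hsub)
        fun n => ?_
      exact add_le_logPartition (N := 2 * n + 1 + 1) ⟨n + 1, by ring⟩ hW
        (fun s => by rw [hsymm]) hβ hκ.le hcov ha hb hab u u'
    have hpos : 0 < ∑ i, (u' i - u i) ^ 2 := by
      obtain ⟨i, hi⟩ := Function.ne_iff.1 hne
      refine Finset.sum_pos' (fun i _ => sq_nonneg _) ⟨i, Finset.mem_univ i, ?_⟩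
      exact sq_pos_of_ne_zero (sub_ne_zero.2 (Ne.symm hi))
    have hpos' : 0 < β ^ 2 * κ / 2 * (a * b) * ∑ i, (u' i - u i) ^ 2 := by positivity
    simp only [smul_eq_mul]
    -- The surface tension is l 0 - l u, so strict concavity of l is what is needed.
    have : l 0 = a * l 0 + b * l 0 := by rw [← add_mul, hab, one_mul]
    linarith
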